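/- Let $S$ be either the hyperbolic plane $\mathbb H^2$ (curvature $-1$) or the unit sphere $\mathbb S^2\subset\mathbb R^3$, each with its standard orientation. Fix a base point $x_0\in S$, a unit tangent vector $v_0\in T_{x_0}S$, lengths $l_1,l_2,l_3>0$, angular velocities $\omega_1,\omega_2,\omega_3\in\mathbb R$ and initial angles $\theta_1,\theta_2,\theta_3\in\mathbb R$. For $t\ge 0$ the three-joint swiveling arm at time $t$ is the following chain of geodesic segments. The first joint starts at $x_0$, has length $l_1$, and its initial direction is $v_0$ rotated counterclockwise by the angle $\theta_1+\omega_1t$. For $j=2,3$ the $j$-th joint starts at the end of the $(j-1)$-st joint, has length $l_j$, and its initial direction is the direction in which the geodesic of the $(j-1)$-st joint continues, rotated counterclockwise by the angle $\theta_j+\omega_jt$. Let $z(t)\in S$ be the end of the third joint. The asymptotic angular velocity of $z$ about $x_0$ is said to exist and to be equal to $\omega$ if (i) there is a complex (conformal, orientation preserving) chart $\varphi$, defined on an open set containing a closed metric ball about $x_0$ (of $S$) which contains $z(t)$ for all $t\ge0$, and (ii) for every such chart there is a continuous function $\phi:[0,\infty)\to\mathbb R$ such that for all $t\ge 0$ $$\varphi(z(t))-\varphi(x_0)=r(t)e^{i\phi(t)}\quad\text{with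 } r(t)\in\mathbb R$$ (the sign of $r(t)$ is free, so that the branch $\phi$ of the argument continues through the moments when $z(t)=x_0$), and every such $\phi$ satisfies $\lim_{t\to\infty}\phi(t)/t=\omega$. **Theorem.** Suppose that $l_1<l_2+l_3$, $l_2<l_3+l_1$, $l_3<l_1+l_2$, that $\omega_1,\omega_2,\omega_3$ are linearly independent over $\mathbb Q$, and, in the case $S=\mathbb S^2$, that $l_1+l_2+l_3<\pi$. Then there exists a geodesic triangle on $S$ with sides of lengths $l_1,l_2,l_3$, and its angles $\alpha_1,\alpha_2,\alpha_3$, where $\alpha_j$ is opposite to the side of length $l_j$, are uniquely determined by $l_1,l_2,l_3$. For all $x_0$, $v_0$ and all initial angles $\theta_1,\theta_2,\theta_3$, the asymptotic angular velocity of $z$ about $x_0$ exists and is equal to $$\omega=\omega_1+\frac{\pi-\alpha_1}{\pi}\,\omega_2+\frac{\alpha_3}{\pi}\,\omega_3 .$$ -/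

import Mathlib

namespace SwivelingArm

/-! ### The argument along a planar curve -/

/-- `ϕ` is a continuous branch of the argument along the curve `w : [0, ∞) → ℂ`:
`w t = r t * exp (i ϕ t)` with a real `r t` whose sign is free, so that the branch
continues through the zeros of `w`. -/
def IsArgBranch (w : ℝ → ℂ) (ϕ : ℝ → ℝ) : Prop :=
  ContinuousOn ϕ (Set.Ici 0) ∧
    ∀ t : ℝ, 0 ≤ t → ∃ r : ℝ, w t = (r : ℂ) * Complex.exp ((ϕ t : ℂ) * Complex.I)

/-- The argument along `w` has a continuous branch, and `ϕ t / t → a` for each such branch. -/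
def HasAngularVelocity (w : ℝ → ℂ) (a : ℝ) : Prop :=
  (∃ ϕ : ℝ → ℝ, IsArgBranch w ϕ) ∧
    ∀ ϕ : ℝ → ℝ, IsArgBranch w ϕ →
      Filter.Tendsto (fun t : ℝ => ϕ t / t) Filter.atTop (nhds a)

/-! ### The hyperbolic plane: Mathlib's upper half-plane, with its hyperbolic distance -/

/-- Unit tangent vectors of the upper half-plane. The tangent space at `p` is `ℂ`, with the
metric `|dz| / Im z`. -/
structure HypUnitTangent where
  pt : UpperHalfPlane
  vec : ℂ
  norm_vec : ‖vec‖ = pt.im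

namespace HypUnitTangent

/-- Counterclockwise rotation by the angle `θ` in the tangent plane. -/
noncomputable def rotate (ξ : HypUnitTangent) (θ : ℝ) : HypUnitTangent where
  pt := ξ.pt
  vec := Complex.exp ((θ : ℂ) * Complex.I) * ξ.vec
  norm_vec := by rw [norm_mul, Complex.norm_exp_ofReal_mul_I, one_mul, ξ.norm_vec]

/-- With `u` the Euclidean unit vector `vec / Im pt`, the number
`cosh (s / 2) + i u sinh (s / 2)`. -/
noncomputable def den (ξ : HypUnitTangent) (s : ℝ) : ℂ :=
  (Real.cosh (s / 2) : ℂ) +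
    Complex.I * (ξ.vec / (ξ.pt.im : ℂ)) * (Real.sinh (s / 2) : ℂ)

/-- The complex number `(p cosh (s / 2) + i u p̄ sinh (s / 2)) / (cosh (s / 2) + i u sinh (s / 2))`,
where `p = pt`: the point at signed distance `s` along the geodesic with initial velocity `vec`. -/
noncomputable def geodesicPoint (ξ : HypUnitTangent) (s : ℝ) : ℂ :=
  ((ξ.pt : ℂ) * (Real.cosh (s / 2) : ℂ) +
    Complex.I * (ξ.vec / (ξ.pt.im : ℂ)) * (starRingEnd ℂ) (ξ.pt : ℂ) *
      (Real.sinh (s / 2) : ℂ)) / ξ.den s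

theorem den_ne_zero (ξ : HypUnitTangent) (s : ℝ) : ξ.den s ≠ 0 := by
  intro h
  have hp : (0 : ℝ) < ξ.pt.im := ξ.pt.im_pos
  have h1 : (Real.cosh (s / 2) : ℂ) =
      -(Complex.I * (ξ.vec / (ξ.pt.im : ℂ)) * (Real.sinh (s / 2) : ℂ)) :=
    eq_neg_of_add_eq_zero_left h
  have h2 := congrArg (fun z : ℂ => ‖z‖) h1
  simp only [norm_neg, norm_mul, Complex.norm_I, norm_div, ξ.norm_vec, Complex.norm_real,
    Real.norm_eq_abs, abs_of_pos hp, div_self hp.ne', one_mul] at h2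
  have h3 := Real.cosh_sq_sub_sinh_sq (s / 2)
  rw [← sq_abs (Real.cosh _), h2, sq_abs, sub_self] at h3
  exact zero_ne_one h3

theorem geodesicPoint_im (ξ : HypUnitTangent) (s : ℝ) :
    (ξ.geodesicPoint s).im = ξ.pt.im / Complex.normSq (ξ.den s) := by
  have hp : (0 : ℝ) < ξ.pt.im := ξ.pt.im_pos
  have hd : Complex.normSq (ξ.den s) ≠ 0 := by
    simpa [Complex.normSq_eq_zero] using ξ.den_ne_zero s
  have hc := Real.cosh_sq_sub_sinh_sq (s / 2)
  have hv : (ξ.vec.re / ξ.pt.im) ^ 2 + (ξ.vec.im / ξ.pt.im) ^ 2 = 1 := by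
    have h := ξ.norm_vec
    have h' : ξ.vec.re * ξ.vec.re + ξ.vec.im * ξ.vec.im = ξ.pt.im ^ 2 := by
      rw [← h, ← Complex.normSq_apply, Complex.normSq_eq_norm_sq]
    field_simp
    linarith
  rw [geodesicPoint, Complex.div_im, ← sub_div]
  congr 1
  simp only [den, Complex.add_re, Complex.add_im, Complex.mul_re, Complex.mul_im,
    Complex.ofReal_re, Complex.ofReal_im, Complex.I_re, Complex.I_im,
    Complex.div_ofReal_re, Complex.div_ofReal_im, Complex.conj_re, Complex.conj_im,
    UpperHalfPlane.coe_re, UpperHalfPlane.coe_im]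
  generalize ξ.vec.re / ξ.pt.im = a at *
  generalize ξ.vec.im / ξ.pt.im = b at *
  generalize Real.cosh (s / 2) = c at *
  generalize Real.sinh (s / 2) = d at *
  linear_combination ξ.pt.im * hc - ξ.pt.im * d ^ 2 * hv

/-- The geodesic flow: the velocity vector at time `s` of the unit speed geodesic with
initial velocity `ξ`. -/
noncomputable def flow (ξ : HypUnitTangent) (s : ℝ) : HypUnitTangent where
  pt := ⟨ξ.geodesicPoint s, by
    rw [geodesicPoint_im]
    exact div_pos ξ.pt.im_pos (Complex.normSq_pos.2 (ξ.den_ne_zero s))⟩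
  vec := ξ.vec / ξ.den s ^ 2
  norm_vec := by
    show ‖ξ.vec / ξ.den s ^ 2‖ = (ξ.geodesicPoint s).im
    rw [geodesicPoint_im, norm_div, norm_pow, ξ.norm_vec, Complex.normSq_eq_norm_sq]

end HypUnitTangent

/-- The end of the three-joint swiveling arm with lengths `l`, based at `ξ.pt`. The angle of the
first joint is measured from `ξ`, that of each other joint from the direction in which
the previous joint continues. -/
noncomputable def hypArm (ξ : HypUnitTangent) (l θ : Fin 3 → ℝ) : UpperHalfPlane :=
  ((((((ξ.rotate (θ 0)).flow (l 0)).rotate (θ 1)).flow (l 1)).rotate (θ 2)).flow (l 2)).pt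

/-- `α` is the angle at `A` between the geodesic segments from `A` to `B` and from `A` to `C`. -/
def IsHypAngle (A B C : UpperHalfPlane) (α : ℝ) : Prop :=
  ∃ ξ η : HypUnitTangent, ξ.pt = A ∧ η.pt = A ∧
    (ξ.flow (dist A B)).pt = B ∧ (η.flow (dist A C)).pt = C ∧
    α = InnerProductGeometry.angle ξ.vec η.vec

/-- There is a hyperbolic triangle with side lengths `l 0, l 1, l 2` in which the angle
opposite to the side of length `l j` is `α j`. -/
def IsHypTriangle (l α : Fin 3 → ℝ) : Prop :=
  ∃ A B C : UpperHalfPlane, dist B C = l 0 ∧ dist C A = l 1 ∧ dist A B = l 2 ∧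
    IsHypAngle A B C (α 0) ∧ IsHypAngle B C A (α 1) ∧ IsHypAngle C A B (α 2)

/-- `φ` is a complex (conformal, orientation preserving) chart with the open domain `U`. -/
def IsHypChart (U : Set UpperHalfPlane) (φ : UpperHalfPlane → ℂ) : Prop :=
  IsOpen U ∧ Set.InjOn φ U ∧
    ∀ p ∈ U, DifferentiableAt ℂ (φ ∘ UpperHalfPlane.ofComplex) (p : ℂ)

/-- `φ` is a complex chart whose domain contains a closed ball about `x₀` that contains the
curve `z`. -/
def IsHypChartFor (x₀ : UpperHalfPlane) (z : ℝ → UpperHalfPlane)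
    (U : Set UpperHalfPlane) (φ : UpperHalfPlane → ℂ) : Prop :=
  IsHypChart U φ ∧
    ∃ R : ℝ, (∀ t : ℝ, 0 ≤ t → dist x₀ (z t) ≤ R) ∧ ∀ p, dist x₀ p ≤ R → p ∈ U

/-- The curve `z` in the hyperbolic plane has the asymptotic angular velocity `a` about `x₀`: a
complex chart as required exists, and in each of them the argument about the image of `x₀`
has the asymptotic velocity `a`. -/
def HypHasAngularVelocity (x₀ : UpperHalfPlane) (z : ℝ → UpperHalfPlane) (a : ℝ) : Prop :=
  (∃ U φ, IsHypChartFor x₀ z U φ) ∧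
    ∀ U φ, IsHypChartFor x₀ z U φ → HasAngularVelocity (fun t => φ (z t) - φ x₀) a

/-! ### The unit sphere in Euclidean space, oriented by the outward normal -/

/-- Euclidean 3-space. -/
abbrev E3 : Type := EuclideanSpace ℝ (Fin 3)

/-- The cross product. -/
noncomputable def cross (p v : E3) : E3 := WithLp.toLp 2 (crossProduct p.ofLp v.ofLp)

theorem cross_inner_left (p v : E3) : inner ℝ p (cross p v) = 0 := by
  simp [cross, PiLp.inner_apply, Fin.sum_univ_three, cross_apply]
  ring

theorem cross_inner_right (p v : E3) : inner ℝ v (cross p v) = 0 := by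
  simp [cross, PiLp.inner_apply, Fin.sum_univ_three, cross_apply]
  ring

theorem cross_inner_self (p v : E3) :
    inner ℝ (cross p v) (cross p v) =
      inner ℝ p p * inner ℝ v v - inner ℝ p v ^ 2 := by
  simp only [cross, PiLp.inner_apply, Fin.sum_univ_three, cross_apply, RCLike.inner_apply,
    conj_trivial, Matrix.cons_val]
  ring

theorem norm_eq_one_of_orthonormal {p q : E3} (hp : ‖p‖ = 1) (hq : ‖q‖ = 1)
    (h : inner ℝ p q = 0) {a b : ℝ} (hab : a ^ 2 + b ^ 2 = 1) : ‖a • p + b • q‖ = 1 := by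
  have h1 : ‖a • p + b • q‖ ^ 2 = 1 := by
    rw [norm_add_sq_real, norm_smul, norm_smul, inner_smul_left, inner_smul_right, h, hp, hq]
    simp [hab]
  have h2 := norm_nonneg (a • p + b • q)
  nlinarith

/-- Unit tangent vectors of the unit sphere. -/
structure SphUnitTangent where
  pt : E3
  vec : E3
  norm_pt : ‖pt‖ = 1
  norm_vec : ‖vec‖ = 1
  inner_eq : inner ℝ pt vec = 0

namespace SphUnitTangent

theorem norm_cross (ξ : SphUnitTangent) : ‖cross ξ.pt ξ.vec‖ = 1 := by
  have h := cross_inner_self ξ.pt ξ.vec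
  rw [real_inner_self_eq_norm_sq, real_inner_self_eq_norm_sq, real_inner_self_eq_norm_sq,
    ξ.norm_pt, ξ.norm_vec, ξ.inner_eq] at h
  have h2 := norm_nonneg (cross ξ.pt ξ.vec)
  nlinarith

/-- Counterclockwise rotation (seen from outside the sphere) by the angle `θ` in the
tangent plane. -/
noncomputable def rotate (ξ : SphUnitTangent) (θ : ℝ) : SphUnitTangent where
  pt := ξ.pt
  vec := Real.cos θ • ξ.vec + Real.sin θ • cross ξ.pt ξ.vec
  norm_pt := ξ.norm_pt
  norm_vec := norm_eq_one_of_orthonormal ξ.norm_vec ξ.norm_cross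
    (cross_inner_right _ _) (Real.cos_sq_add_sin_sq θ)
  inner_eq := by
    rw [inner_add_right, inner_smul_right, inner_smul_right, ξ.inner_eq, cross_inner_left]
    simp

/-- The geodesic flow: the velocity vector at time `s` of the unit speed great circle with
initial velocity `ξ`. -/
noncomputable def flow (ξ : SphUnitTangent) (s : ℝ) : SphUnitTangent where
  pt := Real.cos s • ξ.pt + Real.sin s • ξ.vec
  vec := (-Real.sin s) • ξ.pt + Real.cos s • ξ.vec
  norm_pt := norm_eq_one_of_orthonormal ξ.norm_pt ξ.norm_vec ξ.inner_eq
    (Real.cos_sq_add_sin_sq s)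
  norm_vec := norm_eq_one_of_orthonormal ξ.norm_pt ξ.norm_vec ξ.inner_eq
    (by rw [neg_sq]; exact Real.sin_sq_add_cos_sq s)
  inner_eq := by
    simp only [inner_add_left, inner_add_right, inner_smul_left, inner_smul_right,
      real_inner_self_eq_norm_sq, ξ.norm_pt, ξ.norm_vec, ξ.inner_eq,
      real_inner_comm ξ.pt ξ.vec]
    simp
    ring

end SphUnitTangent

/-- The end of the three-joint swiveling arm with lengths `l`, based at `ξ.pt`. The angle of the
first joint is measured from `ξ`, that of each other joint from the direction in which
the previous joint continues. -/
noncomputable def sphArm (ξ : SphUnitTangent) (l θ : Fin 3 → ℝ) : E3 :=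
  ((((((ξ.rotate (θ 0)).flow (l 0)).rotate (θ 1)).flow (l 1)).rotate (θ 2)).flow (l 2)).pt

/-- The unit sphere. -/
def S2 : Set E3 := Metric.sphere 0 1

/-- The spherical (great circle) distance of two points of the unit sphere. -/
noncomputable def sphDist (p q : E3) : ℝ := InnerProductGeometry.angle p q

/-- `α` is the angle at `A` between the geodesic segments from `A` to `B` and from `A` to `C`. -/
def IsSphAngle (A B C : E3) (α : ℝ) : Prop :=
  ∃ ξ η : SphUnitTangent, ξ.pt = A ∧ η.pt = A ∧
    (ξ.flow (sphDist A B)).pt = B ∧ (η.flow (sphDist A C)).pt = C ∧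
    α = InnerProductGeometry.angle ξ.vec η.vec

/-- There is a spherical triangle with side lengths `l 0, l 1, l 2` in which the angle
opposite to the side of length `l j` is `α j`. -/
def IsSphTriangle (l α : Fin 3 → ℝ) : Prop :=
  ∃ A ∈ S2, ∃ B ∈ S2, ∃ C ∈ S2, sphDist B C = l 0 ∧ sphDist C A = l 1 ∧ sphDist A B = l 2 ∧
    IsSphAngle A B C (α 0) ∧ IsSphAngle B C A (α 1) ∧ IsSphAngle C A B (α 2)

/-- `φ` restricts to a complex (conformal, orientation preserving) chart of the unit sphere with
the domain `U ∩ S2`: it is injective there, and its differential turns the rotation by a right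
angle in the tangent plane, `v ↦ p × v`, into the multiplication by `i`. -/
def IsSphChart (U : Set E3) (φ : E3 → ℂ) : Prop :=
  IsOpen U ∧ Set.InjOn φ (U ∩ S2) ∧
    ∀ p ∈ U ∩ S2, ∃ D : E3 →L[ℝ] ℂ, HasFDerivWithinAt φ D S2 p ∧
      ∀ v : E3, inner ℝ p v = 0 → D (cross p v) = Complex.I * D v

/-- `φ` is a complex chart whose domain contains a closed ball about `x₀` that contains the
curve `z`. -/
def IsSphChartFor (x₀ : E3) (z : ℝ → E3) (U : Set E3) (φ : E3 → ℂ) : Prop :=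
  IsSphChart U φ ∧
    ∃ R : ℝ, (∀ t : ℝ, 0 ≤ t → sphDist x₀ (z t) ≤ R) ∧ ∀ p ∈ S2, sphDist x₀ p ≤ R → p ∈ U

/-- The curve `z` on the unit sphere has the asymptotic angular velocity `a` about `x₀`: a
complex chart as required exists, and in each of them the argument about the image of `x₀`
has the asymptotic velocity `a`. -/
def SphHasAngularVelocity (x₀ : E3) (z : ℝ → E3) (a : ℝ) : Prop :=
  (∃ U φ, IsSphChartFor x₀ z U φ) ∧
    ∀ U φ, IsSphChartFor x₀ z U φ → HasAngularVelocity (fun t => φ (z t) - φ x₀) a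

end SwivelingArm

/-!
The proof treats both geometries at once. For curvature `κ = -1` (`κ = 1`) use the Poincaré disk
(stereographic) coordinate centred at `x₀`, and replace a length `l` by its half-length coordinate
`tanh (l / 2)` (`tan (l / 2)`). Translations along geodesics become the Möbius maps
`z ↦ (a + z) / (1 - κ a z)`, so that with `B = θ₁ + ω₁ t`, `C = θ₂ + ω₂ t` (indices `0, 1, 2`) the
end of the arm has the coordinate (`armCoord`, `disk_hypArm`, `ofStereo_armCoord`)
`exp (i (θ₀ + ω₀ t)) (a₀ + exp (i B) q(C)) / (1 - κ a₀ exp (i B) q(C))`, where `q = twoJoint` is the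
end of the two-joint arm that is formed by the last two joints. The denominator stays in the right
half-plane, and a factor with values there has a bounded argument, so only the mean motion of the
planar curve `a₀ + exp (i B) q(C)` is needed.

By the law of cosines `‖q(C)‖ > a₀` exactly if `|C| < δ = π - α₀` modulo `2 π`, and
`arg q(±δ) = ±α₂` (`IsTriangleData.isLapCurve`). While `‖q‖ > a₀`, the argument of the curve stays
within `π / 2` of `B + arg q + m π` for a constant integer `m`, and while `‖q‖ < a₀`, it stays
within `π / 2` of some `m' π`. Where the two regimes meet, `exp (i B) q = a₀ exp (i u)`, so the
argument is `u / 2` modulo `π`, which determines `m' - m` as `2 * round (u / (2 π))` unless the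
curve passes through `0` there (`sub_eq_two_mul_round`). Let `ω₂ > 0`; complex conjugation reduces
the case `ω₂ < 0` to this one. During one period of `C` the argument thus grows,
up to a bounded error that does not accumulate, by `2 π` times a difference of rounded values of two
orbits of the rotation by `ω₁ / ω₂`, which lie `(δ ω₁ / ω₂ + α₂) / π` turns apart. The rotation is
irrational, so the sawtooth functions `x - round x` average to `0` along its orbits
(`tendsto_average_sub_round`), and the rounding may be omitted in the mean. This gives the velocity
`(δ ω₁ + α₂ ω₂) / π` (`IsLapCurve.hasAngularVelocity`). Irrationality also shows that the curve has
only finitely many zeros, so that, being analytic, it has a continuous branch of the argument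
(`exists_isArgBranch_of_analyticAt`).

Finally, another complex chart is an injective holomorphic function `f` of the coordinate `w` on a
closed disk, and `f w - f 0 = w exp (h w)` with a continuous, hence bounded, function `h`
(`exists_sub_eq_mul_exp`): the angular velocity is the same in each chart.
-/

namespace SwivelingArm

open Filter Topology

/-! ### Branches of the argument -/

theorem IsArgBranch.mul_exp {w w' : ℝ → ℂ} {ϕ k c : ℝ → ℝ} (hϕ : IsArgBranch w ϕ)
    (hk : ContinuousOn k (Set.Ici 0))
    (h : ∀ t, 0 ≤ t → w' t = w t * c t * Complex.exp (k t * Complex.I)) :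
    IsArgBranch w' (fun t => ϕ t + k t) := by
  refine ⟨hϕ.1.add hk, fun t ht => ?_⟩
  obtain ⟨r, hr⟩ := hϕ.2 t ht
  refine ⟨r * c t, ?_⟩
  rw [h t ht, hr]
  push_cast
  rw [add_mul, Complex.exp_add]
  ring

/-- Multiplication by a curve with a continuous argument `k` adds the angular velocity of `k`. -/
theorem HasAngularVelocity.mul_exp {w w' : ℝ → ℂ} {a b : ℝ} {k c : ℝ → ℝ}
    (hw : HasAngularVelocity w a) (hk : ContinuousOn k (Set.Ici 0))
    (hc : ∀ t, 0 ≤ t → c t ≠ 0) (hb : Tendsto (fun t => k t / t) atTop (𝓝 b))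
    (h : ∀ t, 0 ≤ t → w' t = w t * c t * Complex.exp (k t * Complex.I)) :
    HasAngularVelocity w' (a + b) := by
  obtain ⟨⟨ϕ, hϕ⟩, hall⟩ := hw
  refine ⟨⟨_, hϕ.mul_exp hk h⟩, fun ϕ' hϕ' => ?_⟩
  have h2 : IsArgBranch w (fun t => ϕ' t + -k t) := by
    refine hϕ'.mul_exp (c := fun t => (c t)⁻¹) hk.neg fun t ht => ?_
    have := hc t ht
    have h3 : Complex.exp (k t * Complex.I) * Complex.exp (((-k t : ℝ) : ℂ) * Complex.I) = 1 := by
      rw [← Complex.exp_add]; simp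
    have h4 : (c t : ℂ) ≠ 0 := by exact_mod_cast this
    rw [h t ht]
    have h5 : (c t : ℂ) * (c t : ℂ)⁻¹ = 1 := mul_inv_cancel₀ h4
    rw [Complex.ofReal_inv]
    linear_combination (-w t * (c t : ℂ) * (c t : ℂ)⁻¹) * h3 - w t * h5
  refine ((hall _ h2).add hb).congr fun t => ?_
  ring

theorem tendsto_div_atTop_of_bounded {k : ℝ → ℝ} {C : ℝ} (h : ∀ t, 0 ≤ t → |k t| ≤ C) :
    Tendsto (fun t => k t / t) atTop (𝓝 0) := by
  have h0 : Tendsto (fun t : ℝ => C / t) atTop (𝓝 0) := tendsto_const_nhds.div_atTop tendsto_id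
  refine squeeze_zero_norm' ?_ h0
  filter_upwards [eventually_gt_atTop 0] with t ht
  rw [Real.norm_eq_abs, abs_div, abs_of_pos ht]
  gcongr
  exact h t ht.le

/-- Multiplication by `exp ∘ h` does not change the angular velocity if `Im h` is bounded. -/
theorem HasAngularVelocity.mul_cexp {w w' h : ℝ → ℂ} {a C : ℝ}
    (hw : HasAngularVelocity w a) (hh : ContinuousOn h (Set.Ici 0))
    (hC : ∀ t, 0 ≤ t → |(h t).im| ≤ C)
    (h' : ∀ t, 0 ≤ t → w' t = w t * Complex.exp (h t)) :
    HasAngularVelocity w' a := by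
  rw [← add_zero a]
  refine hw.mul_exp (k := fun t => (h t).im) (c := fun t => Real.exp (h t).re)
    (Complex.continuous_im.comp_continuousOn hh) (fun t _ => (Real.exp_pos _).ne')
    (tendsto_div_atTop_of_bounded hC) fun t ht => ?_
  rw [h' t ht, mul_assoc, Complex.ofReal_exp, ← Complex.exp_add, Complex.re_add_im]

theorem HasAngularVelocity.congr {w w' : ℝ → ℂ} {a : ℝ} (hw : HasAngularVelocity w a)
    (h : ∀ t, 0 ≤ t → w' t = w t) : HasAngularVelocity w' a :=
  hw.mul_cexp (h := fun _ => 0) (C := 0) continuousOn_const (by simp)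
    (fun t ht => by simp [h t ht])

/-- Multiplication by a curve in the right half-plane does not change the angular velocity. -/
theorem HasAngularVelocity.mul_of_re_pos {w g : ℝ → ℂ} {a : ℝ} (hw : HasAngularVelocity w a)
    (hg : Continuous g) (hpos : ∀ t, 0 < (g t).re) :
    HasAngularVelocity (fun t => w t * g t) a := by
  refine hw.mul_cexp (h := fun t => Complex.log (g t)) (C := Real.pi) ?_ ?_ ?_
  · exact (hg.clog fun t => Or.inl (hpos t)).continuousOn
  · intro t _
    rw [Complex.log_im]
    exact Complex.abs_arg_le_pi _
  · intro t _
    rw [Complex.exp_log]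
    intro h
    simpa [h] using hpos t

theorem HasAngularVelocity.div_of_re_pos {w g : ℝ → ℂ} {a : ℝ} (hw : HasAngularVelocity w a)
    (hg : Continuous g) (hpos : ∀ t, 0 < (g t).re) :
    HasAngularVelocity (fun t => w t / g t) a := by
  have hne : ∀ t, g t ≠ 0 := fun t h => by simpa [h] using hpos t
  refine (hw.mul_of_re_pos (hg.inv₀ hne) fun t => ?_).congr fun t _ => div_eq_mul_inv _ _
  rw [Pi.inv_apply, Complex.inv_re]
  exact div_pos (hpos t) (Complex.normSq_pos.2 (hne t))

theorem IsArgBranch.conj {w : ℝ → ℂ} {ϕ : ℝ → ℝ} (h : IsArgBranch w ϕ) :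
    IsArgBranch (fun t => (starRingEnd ℂ) (w t)) (fun t => -ϕ t) := by
  refine ⟨h.1.neg, fun t ht => ?_⟩
  obtain ⟨r, hr⟩ := h.2 t ht
  refine ⟨r, ?_⟩
  beta_reduce
  rw [hr, map_mul, ← Complex.exp_conj]
  simp

theorem HasAngularVelocity.conj {w : ℝ → ℂ} {a : ℝ} (h : HasAngularVelocity w a) :
    HasAngularVelocity (fun t => (starRingEnd ℂ) (w t)) (-a) := by
  obtain ⟨⟨ϕ, hϕ⟩, hall⟩ := h
  refine ⟨⟨_, hϕ.conj⟩, fun ϕ' hϕ' => ?_⟩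
  have := hϕ'.conj
  simp only [Complex.conj_conj] at this
  refine (hall _ this).neg.congr fun t => ?_
  ring

/-! ### Existence of a branch along an analytic curve -/

theorem isSimplyConnected_univ_of_module {E : Type*} [AddCommGroup E] [Module ℝ E]
    [TopologicalSpace E] [IsTopologicalAddGroup E] [ContinuousSMul ℝ E] :
    IsSimplyConnected (Set.univ : Set E) := by
  have : ContractibleSpace (Set.univ : Set E) :=
    (convex_univ : Convex ℝ (Set.univ : Set E)).contractibleSpace Set.univ_nonempty
  exact SimplyConnectedSpace.ofContractible _

theorem analyticAt_dslope {f : ℝ → ℂ} (hf : ∀ t, AnalyticAt ℝ f t) (t₀ t : ℝ) :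
    AnalyticAt ℝ (dslope f t₀) t := by
  rcases eq_or_ne t t₀ with rfl | h
  · obtain ⟨p, hp⟩ := hf t
    exact ⟨_, hp.has_fpower_series_dslope_fslope⟩
  · have h1 : AnalyticAt ℝ (fun s : ℝ => (s - t₀)⁻¹ • (f s - f t₀)) t := by
      have : t - t₀ ≠ 0 := sub_ne_zero.2 h
      exact ((analyticAt_id.sub analyticAt_const).inv this).smul ((hf t).sub analyticAt_const)
    refine h1.congr ?_
    filter_upwards [dslope_eventuallyEq_slope_of_ne f h] with s hs
    rw [hs, slope_def_module]

theorem isArgBranch_of_analyticAt_of_ne_zero {f : ℝ → ℂ} (hf : ∀ t, AnalyticAt ℝ f t)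
    (h0 : ∀ t, f t ≠ 0) : ∃ ϕ : ℝ → ℝ, IsArgBranch f ϕ := by
  have hc : Continuous f := continuous_iff_continuousAt.2 fun t => (hf t).continuousAt
  obtain ⟨h, hh, he⟩ := Complex.exists_continuousOn_eqOn_exp_comp (X := ℝ) (U := Set.univ)
    (g := f) isSimplyConnected_univ_of_module isOpen_univ hc.continuousOn (by simpa using h0)
  refine ⟨fun t => (h t).im, (Complex.continuous_im.comp_continuousOn hh).mono
    (Set.subset_univ _), fun t _ => ⟨Real.exp (h t).re, ?_⟩⟩
  rw [← he (Set.mem_univ t), Complex.ofReal_exp, ← Complex.exp_add, Complex.re_add_im]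
  rfl

/-- The branch continues through the zeros, since `f = (t - t₀) ^ n g` near a zero `t₀`, where
`g t₀ ≠ 0` and the first factor is real. -/
theorem exists_isArgBranch_of_analyticAt {f : ℝ → ℂ} (hf : ∀ t, AnalyticAt ℝ f t)
    (hfin : {t | f t = 0}.Finite) : ∃ ϕ : ℝ → ℝ, IsArgBranch f ϕ := by
  induction hn : hfin.toFinset.card using Nat.strong_induction_on generalizing f with
  | _ n ih =>
  by_cases hz : ∃ t₀, f t₀ = 0
  swap
  · push Not at hz
    exact isArgBranch_of_analyticAt_of_ne_zero hf hz
  obtain ⟨t₀, ht₀⟩ := hz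
  obtain ⟨p, hp⟩ := hf t₀
  have hp0 : p ≠ 0 := by
    intro h
    have h1 : ∀ᶠ t in 𝓝 t₀, f t = 0 := hp.locally_zero_iff.2 h
    exact infinite_of_mem_nhds t₀ h1 hfin
  set g : ℝ → ℂ := (Function.swap dslope t₀)^[p.order] f with hg
  have hga : ∀ m : ℕ, ∀ t, AnalyticAt ℝ ((Function.swap dslope t₀)^[m] f) t := by
    intro m
    induction m with
    | zero => exact hf
    | succ m ihm =>
      rw [Function.iterate_succ_apply']
      exact analyticAt_dslope ihm t₀
  have hg0 : g t₀ ≠ 0 := hp.iterate_dslope_fslope_ne_zero hp0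
  have hfg : ∀ t, f t = (t - t₀) ^ p.order • g t := hp.eq_pow_order_mul_iterate_dslope
  have hsub : {t | g t = 0} ⊆ {t | f t = 0} := fun t ht => by
    simp only [Set.mem_ofPred_eq] at ht ⊢
    rw [hfg, ht, smul_zero]
  have hgfin := hfin.subset hsub
  obtain ⟨ϕ, hϕ⟩ := ih hgfin.toFinset.card (by
    rw [← hn]
    refine Finset.card_lt_card ⟨by simpa using hsub, fun h => hg0 ?_⟩
    have : t₀ ∈ hgfin.toFinset := h (by simpa using ht₀)
    simpa using this) (hga _) hgfin rfl
  have := hϕ.mul_exp (w' := f) (k := fun _ => 0) (c := fun t => (t - t₀) ^ p.order)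
    continuousOn_const (fun t _ => by
      rw [hfg t, Complex.real_smul]
      simp
      ring)
  exact ⟨_, this⟩

/-! ### Equidistribution of the sawtooth function along an irrational rotation -/

/-- The distance to the nearest integer grows at most like a shift of the current one. -/
theorem sq_sub_round_add_le (x η : ℝ) :
    (x + η - round (x + η)) ^ 2 ≤ (x - round x + η) ^ 2 := by
  have := round_le (x + η) (round x)
  rw [← sq_abs, ← sq_abs (x - round x + η)]
  have h2 : x - round x + η = x + η - round x := by ring
  rw [h2]
  gcongr

theorem abs_sum_shift_sub_le {G : ℕ → ℝ} {C : ℝ} (hG : ∀ k, |G k| ≤ C) (q n : ℕ) :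
    |∑ k ∈ Finset.range n, (G (k + q) - G k)| ≤ q * (2 * C) := by
  induction q with
  | zero => simp
  | succ q ih =>
    have h1 : ∑ k ∈ Finset.range n, (G (k + (q + 1)) - G k) =
        ∑ k ∈ Finset.range n, (G (k + q) - G k) + (G (n + q) - G q) := by
      have h2 := Finset.sum_range_sub (fun k => G (k + q)) n
      simp only [zero_add] at h2
      rw [← h2, ← Finset.sum_add_distrib]
      refine Finset.sum_congr rfl fun k _ => ?_
      rw [add_right_comm k 1 q, ← add_assoc k q 1]
      ring
    rw [h1]
    have h2 := abs_le.1 (hG (n + q))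
    have h3 := abs_le.1 (hG q)
    rw [abs_le] at ih ⊢
    push_cast
    constructor <;> linarith

/-- The averages of the sawtooth function `x - round x` along the orbit of an irrational rotation
tend to its integral, zero. With `F x = (x - round x) ^ 2`, a continuous primitive of twice the
sawtooth function, `F (x + η) - F x` is at most `2 η (x - round x) + η ^ 2`. For a multiple `q β`
of the rotation number at a small distance `η` from an integer, the left side telescopes along the
orbit. -/
theorem tendsto_average_sub_round {β : ℝ} (hβ : Irrational β) (x : ℝ) :
    Tendsto (fun n : ℕ => (∑ k ∈ Finset.range n, (x + k * β - round (x + k * β))) / n)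
      atTop (𝓝 0) := by
  rw [Metric.tendsto_atTop]
  intro ε hε
  obtain ⟨N, hN⟩ := exists_nat_gt (1 / ε)
  obtain ⟨p, q, hq, -, hpq⟩ := Real.exists_int_int_abs_mul_sub_le β (n := N + 1) (by omega)
  lift q to ℕ using hq.le
  set η : ℝ := q * β - p with hη
  have hq' : q ≠ 0 := by rintro rfl; simp at hq
  have hη0 : η ≠ 0 := by
    intro h
    refine (hβ.natCast_mul hq').ne_int p ?_
    linarith
  have hηε : |η| < ε := by
    refine lt_of_le_of_lt (b := 1 / (((N + 1 : ℕ) : ℝ) + 1)) hpq ?_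
    rw [div_lt_iff₀ (by positivity)]
    rw [div_lt_iff₀ hε] at hN
    push_cast
    nlinarith
  set S : ℕ → ℝ := fun k => x + k * β - round (x + k * β) with hS
  set F : ℕ → ℝ := fun k => S k ^ 2 with hF
  have hSb : ∀ k, |S k| ≤ 1 / 2 := fun k => abs_sub_round _
  have hFb : ∀ k, |F k| ≤ 1 / 4 := fun k => by
    simp only [hF]
    rw [abs_of_nonneg (sq_nonneg _), ← sq_abs]
    have := hSb k
    have := abs_nonneg (S k)
    nlinarith
  have hshift : ∀ k, x + ((k + q : ℕ) : ℝ) * β = (x + k * β + η) + (p : ℤ) := fun k => by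
    rw [hη]; push_cast; ring
  have hSq : ∀ k, S (k + q) = x + k * β + η - round (x + k * β + η) := fun k => by
    simp only [hS]
    rw [hshift, round_add_intCast]
    push_cast
    ring
  have h1 : ∀ k, F (k + q) - F k ≤ 2 * η * S k + η ^ 2 := fun k => by
    have := sq_sub_round_add_le (x + k * β) η
    simp only [hF, hSq]
    simp only [hS]
    linarith
  have h2 : ∀ k, F k - F (k + q) ≤ -(2 * η * S (k + q)) + η ^ 2 := fun k => by
    have := sq_sub_round_add_le (x + k * β + η) (-η)
    rw [← hSq, add_neg_cancel_right] at this
    simp only [hF]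
    simp only [hS] at this ⊢
    linarith
  have hb := fun n => abs_sum_shift_sub_le hFb q n
  have hb' := fun n => abs_sum_shift_sub_le hSb q n
  have key : ∀ n : ℕ, |η * ∑ k ∈ Finset.range n, S k| ≤ q * (1 + |η|) + n * η ^ 2 / 2 := by
    intro n
    have e1 := Finset.sum_le_sum fun k (_ : k ∈ Finset.range n) => h1 k
    have e2 := Finset.sum_le_sum fun k (_ : k ∈ Finset.range n) => h2 k
    have e3 := abs_le.1 (hb n)
    have e4 : |η * ∑ k ∈ Finset.range n, (S (k + q) - S k)| ≤ |η| * (q * (2 * (1 / 2))) := by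
      rw [abs_mul]
      exact mul_le_mul_of_nonneg_left (hb' n) (abs_nonneg _)
    have e5 := abs_le.1 e4
    simp only [Finset.sum_add_distrib, Finset.sum_sub_distrib, Finset.sum_neg_distrib,
      ← Finset.mul_sum, Finset.sum_const, Finset.card_range, nsmul_eq_mul, mul_sub] at e1 e2 e3 e5
    have : (0 : ℝ) ≤ q := by positivity
    rw [abs_le]
    constructor <;> nlinarith
  have hηp : 0 < |η| := abs_pos.2 hη0
  obtain ⟨M, hM⟩ := exists_nat_gt (q * (1 + |η|) / |η| / (ε / 2))
  refine ⟨M + 1, fun n hn => ?_⟩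
  have hn0 : (0 : ℝ) < n := by exact_mod_cast (by omega : 0 < n)
  rw [Real.dist_0_eq_abs, abs_div, abs_of_pos hn0, div_lt_iff₀ hn0]
  have h3 := key n
  rw [abs_mul, ← sq_abs] at h3
  have h4 : q * (1 + |η|) / |η| < (ε / 2) * n := by
    have : (M : ℝ) < n := by exact_mod_cast (by omega : M < n)
    rw [div_lt_iff₀ (by positivity)] at hM
    nlinarith
  rw [div_lt_iff₀ hηp] at h4
  have h5 : |η| * |∑ k ∈ Finset.range n, S k| < |η| * (ε * n) := by
    nlinarith [mul_pos hηp hn0, mul_lt_mul_of_pos_left hηε (mul_pos hηp hn0)]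
  exact lt_of_mul_lt_mul_left h5 hηp.le

end SwivelingArm

namespace SwivelingArm

open Filter Topology Real

/-! ### Counting laps -/

/-- A continuous angle whose cosine has no zeros stays within `π / 2` of a fixed multiple of `π`. -/
theorem exists_int_abs_sub_mul_pi_le {f : ℝ → ℝ} {s t : ℝ} (hst : s < t)
    (hf : ContinuousOn f (Set.Icc s t)) (hcos : ∀ x ∈ Set.Ioo s t, cos (f x) ≠ 0) :
    ∃ m : ℤ, ∀ x ∈ Set.Icc s t, |f x - m * π| ≤ π / 2 := by
  obtain ⟨x₀, hx₀⟩ := exists_between hst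
  have hx₀' : x₀ ∈ Set.Ioo s t := hx₀
  set m : ℤ := round (f x₀ / π) with hm
  have h0 : |f x₀ - m * π| ≤ π / 2 := by
    have h := abs_sub_round (f x₀ / π)
    have e : f x₀ - m * π = (f x₀ / π - m) * π := by field_simp
    rw [e, abs_mul, abs_of_pos pi_pos]
    nlinarith [pi_pos]
  have hconn : (f '' Set.Ioo s t).OrdConnected :=
    (isPreconnected_Ioo.image f (hf.mono Set.Ioo_subset_Icc_self)).ordConnected
  have havoid : ∀ n : ℤ, (2 * n + 1) * π / 2 ∉ f '' Set.Ioo s t := by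
    rintro n ⟨y, hy, hfy⟩
    exact hcos y hy (cos_eq_zero_iff.2 ⟨n, hfy⟩)
  have h1 : f '' Set.Ioo s t ⊆ Set.Icc (m * π - π / 2) (m * π + π / 2) := by
    rintro _ ⟨x, hx, rfl⟩
    rw [abs_le] at h0
    constructor
    · by_contra! hlt
      refine havoid (m - 1) (hconn.out ⟨x, hx, rfl⟩ ⟨x₀, hx₀', rfl⟩ ⟨?_, ?_⟩) <;>
        (push_cast; linarith)
    · by_contra! hlt
      refine havoid m (hconn.out ⟨x₀, hx₀', rfl⟩ ⟨x, hx, rfl⟩ ⟨?_, ?_⟩) <;> linarith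
  refine ⟨m, fun x hx => ?_⟩
  have h2 : f x ∈ closure (f '' Set.Ioo s t) := by
    rw [← closure_Ioo hst.ne] at hf hx
    exact hf.image_closure ⟨x, hx, rfl⟩
  have h3 := closure_minimal h1 isClosed_Icc h2
  rw [abs_le]
  constructor <;> linarith [h3.1, h3.2]

theorem round_eq_of_abs_sub_lt {x : ℝ} {n : ℤ} (h : |x - n| < 1 / 2) : round x = n := by
  rw [round_eq, Int.floor_eq_iff]
  rw [abs_lt] at h
  constructor <;> linarith [h.1, h.2]

theorem sin_eq_zero_of_real_mul_exp_eq {x y c r : ℝ} (hc : c ≠ 0)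
    (h : (c : ℂ) * Complex.exp (x * Complex.I) = r * Complex.exp (y * Complex.I)) :
    sin (x - y) = 0 := by
  have h1 : (c : ℂ) * Complex.exp (((x - y : ℝ) : ℂ) * Complex.I) = r := by
    have : Complex.exp (((x - y : ℝ) : ℂ) * Complex.I) =
        Complex.exp (x * Complex.I) * Complex.exp (-(y * Complex.I)) := by
      rw [← Complex.exp_add]; push_cast; ring_nf
    rw [this, ← mul_assoc, h, mul_assoc, ← Complex.exp_add, add_neg_cancel, Complex.exp_zero,
      mul_one]
  have h2 := congrArg Complex.im h1
  rw [Complex.im_ofReal_mul, Complex.exp_ofReal_mul_I_im, Complex.ofReal_im] at h2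
  exact (mul_eq_zero.1 h2).resolve_left hc

theorem one_add_exp_mul_I (u : ℝ) : 1 + Complex.exp (u * Complex.I) =
    ((2 * cos (u / 2) : ℝ) : ℂ) * Complex.exp (((u / 2 : ℝ) : ℂ) * Complex.I) := by
  have e : Complex.exp (u * Complex.I) = Complex.exp (((u / 2 : ℝ) : ℂ) * Complex.I) ^ 2 := by
    rw [← Complex.exp_nat_mul]; congr 1; push_cast; ring
  rw [e, Complex.exp_mul_I, ← Complex.ofReal_cos, ← Complex.ofReal_sin]
  have h : ((sin (u / 2) : ℝ) : ℂ) ^ 2 = 1 - ((cos (u / 2) : ℝ) : ℂ) ^ 2 := by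
    have := sin_sq (u / 2)
    exact_mod_cast this
  push_cast at h ⊢
  linear_combination Complex.I ^ 2 * h + (1 - Complex.cos (u / 2) ^ 2) * Complex.I_sq

/-- The comparison of two normalizations of a branch `ϕ` of the argument along
`a + q exp (i B)` at a moment when `q exp (i B) = a exp (i u)`. -/
theorem sub_eq_two_mul_round {a r ϕ u : ℝ} {m m' : ℤ} (ha : 0 < a)
    (h : (a : ℂ) * (1 + Complex.exp (u * Complex.I)) = r * Complex.exp (ϕ * Complex.I))
    (h1 : |ϕ - u - m * π| ≤ π / 2) (h2 : |ϕ - m' * π| ≤ π / 2) :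
    |(m' - m : ℝ) - 2 * round (u / (2 * π))| ≤ 2 ∧
      (cos (u / 2) ≠ 0 → (m' - m : ℝ) - 2 * round (u / (2 * π)) = 0) := by
  have hπ := pi_pos
  constructor
  · have h3 := abs_sub_round (u / (2 * π))
    have e1 : u = u / (2 * π) * (2 * π) := by field_simp
    generalize u / (2 * π) = x at h3 e1 ⊢
    rw [abs_le] at h1 h2 h3 ⊢
    subst e1
    constructor <;> nlinarith
  · intro hc
    rw [one_add_exp_mul_I, ← mul_assoc, ← Complex.ofReal_mul] at h
    obtain ⟨n, hn⟩ := sin_eq_zero_iff.1 (sin_eq_zero_of_real_mul_exp_eq (by positivity) h)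
    have hne : ∀ j : ℤ, u / 2 ≠ (2 * j + 1) * π / 2 := fun j hj =>
      hc (cos_eq_zero_iff.2 ⟨j, hj⟩)
    rw [abs_le] at h1 h2
    have g1 := hne (-(n + m) - 1)
    have g2 := hne (-(n + m))
    have g3 := hne (n + m')
    have g4 := hne (n + m' - 1)
    push_cast at g1 g2 g3 g4
    have l1 : u / 2 < (2 * (-(n + m)) + 1) * π / 2 := lt_of_le_of_ne (by linarith) g2
    have l2 : (2 * (-(n + m) - 1) + 1) * π / 2 < u / 2 := lt_of_le_of_ne (by linarith) g1.symm
    have l3 : u / 2 < (2 * (n + m') + 1) * π / 2 := lt_of_le_of_ne (by linarith) g3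
    have l4 : (2 * (n + m' - 1) + 1) * π / 2 < u / 2 := lt_of_le_of_ne (by linarith) g4.symm
    have z1 : (2 * n + m + m' : ℝ) < 1 := by nlinarith
    have z2 : (-1 : ℝ) < 2 * n + m + m' := by nlinarith
    have z : 2 * n + m + m' = 0 := by
      have z1' : 2 * n + m + m' < 1 := by exact_mod_cast z1
      have z2' : -1 < 2 * n + m + m' := by exact_mod_cast z2
      omega
    have hr : round (u / (2 * π)) = n + m' := by
      apply round_eq_of_abs_sub_lt
      have e1 : u = u / (2 * π) * (2 * π) := by field_simp
      generalize u / (2 * π) = x at e1 ⊢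
      subst e1
      push_cast
      rw [abs_lt]
      constructor <;> nlinarith
    rw [hr]
    have z' : (2 * n + m + m' : ℝ) = 0 := by exact_mod_cast z
    push_cast
    linarith

/-- An orbit of an irrational rotation meets a half-integer at most once. -/
theorem subsingleton_cos_eq_zero {β : ℝ} (hβ : Irrational β) (x : ℝ) :
    {k : ℕ | cos (π * (x + k * β)) = 0}.Subsingleton := by
  intro k hk j hj
  obtain ⟨m, hm⟩ := cos_eq_zero_iff.1 hk
  obtain ⟨n, hn⟩ := cos_eq_zero_iff.1 hj
  by_contra hkj
  have h : ((k : ℝ) - j) * β = m - n := by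
    have hπ := pi_ne_zero
    field_simp at hm hn
    linarith
  have h2 : ((k - j : ℤ) : ℝ) * β = ((m - n : ℤ) : ℝ) := by push_cast; exact h
  exact (hβ.intCast_mul (by omega : (k - j : ℤ) ≠ 0)).ne_int _ h2

theorem abs_sum_le_of_subsingleton {e : ℕ → ℝ} {P : Set ℕ} {c : ℝ} (hP : P.Subsingleton)
    (hc : 0 ≤ c) (he : ∀ k, |e k| ≤ c) (h0 : ∀ k, k ∉ P → e k = 0) (n : ℕ) :
    |∑ k ∈ Finset.range n, e k| ≤ c := by
  by_cases h : ∃ k ∈ Finset.range n, k ∈ P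
  · obtain ⟨k, hk, hkP⟩ := h
    rw [Finset.sum_eq_single_of_mem k hk fun j _ hj => h0 j fun hjP => hj (hP hjP hkP)]
    exact he k
  · push Not at h
    rw [Finset.sum_eq_zero fun k hk => h0 k (h k hk), abs_zero]
    exact hc

theorem tendsto_average_round_sub_round {β : ℝ} (hβ : Irrational β) (x y : ℝ) :
    Tendsto (fun n : ℕ =>
      (∑ k ∈ Finset.range n, ((round (x + k * β) : ℝ) - round (y + k * β))) / n)
      atTop (𝓝 (x - y)) := by
  have h := ((tendsto_average_sub_round hβ y).sub (tendsto_average_sub_round hβ x)).const_add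
    (x - y)
  rw [sub_zero, add_zero] at h
  refine h.congr' ?_
  filter_upwards [eventually_gt_atTop 0] with n hn
  have hn' : (n : ℝ) ≠ 0 := by positivity
  have e : ∀ k : ℕ, ((round (x + k * β) : ℝ) - round (y + k * β)) =
      (x - y) + ((y + k * β - round (y + k * β)) - (x + k * β - round (x + k * β))) := fun k => by
    ring
  simp only [e]
  rw [Finset.sum_add_distrib, Finset.sum_const, Finset.card_range, nsmul_eq_mul,
    Finset.sum_sub_distrib fun k : ℕ => y + k * β - round (y + k * β)]
  rw [add_div, mul_div_cancel_left₀ _ hn', sub_div]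

/-- An integer sequence that increases by twice the difference of two rounded irrational rotations,
up to an error at no more than one moment for each rotation, grows linearly. -/
theorem tendsto_div_of_round_steps {β x y : ℝ} (hβ : Irrational β) {M : ℕ → ℤ} {L : ℕ → ℤ}
    (h1 : ∀ k, |(M (k + 1) - L k : ℝ) - 2 * round (x + k * β)| ≤ 2)
    (h1' : ∀ k : ℕ, cos (π * (x + k * β)) ≠ 0 →
      (M (k + 1) - L k : ℝ) - 2 * round (x + k * β) = 0)
    (h2 : ∀ k, |(M k - L k : ℝ) - 2 * round (y + k * β)| ≤ 2)
    (h2' : ∀ k : ℕ, cos (π * (y + k * β)) ≠ 0 →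
      (M k - L k : ℝ) - 2 * round (y + k * β) = 0) :
    Tendsto (fun n : ℕ => (M n : ℝ) / n) atTop (𝓝 (2 * (x - y))) := by
  have b1 := abs_sum_le_of_subsingleton (subsingleton_cos_eq_zero hβ x) zero_le_two h1
    (fun k hk => h1' k hk)
  have b2 := abs_sum_le_of_subsingleton (subsingleton_cos_eq_zero hβ y) zero_le_two h2
    (fun k hk => h2' k hk)
  have e : ∀ n : ℕ, (M n : ℝ) =
      2 * ∑ k ∈ Finset.range n, ((round (x + k * β) : ℝ) - round (y + k * β)) +
      (M 0 + (∑ k ∈ Finset.range n, ((M (k + 1) - L k : ℝ) - 2 * round (x + k * β)) -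
      ∑ k ∈ Finset.range n, ((M k - L k : ℝ) - 2 * round (y + k * β)))) := fun n => by
    have := Finset.sum_range_sub (fun k => (M k : ℝ)) n
    rw [← Finset.sum_sub_distrib, add_left_comm, Finset.mul_sum, ← Finset.sum_add_distrib,
      ← sub_eq_iff_eq_add', ← this]
    exact Finset.sum_congr rfl fun k _ => by ring
  have hlim : Tendsto (fun n : ℕ => ((M 0 : ℝ) +
      (∑ k ∈ Finset.range n, ((M (k + 1) - L k : ℝ) - 2 * round (x + k * β)) -
      ∑ k ∈ Finset.range n, ((M k - L k : ℝ) - 2 * round (y + k * β)))) / n) atTop (𝓝 0) := by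
    refine squeeze_zero_norm' (a := fun n : ℕ => (|(M 0 : ℝ)| + 4) / n) ?_
      (tendsto_const_nhds.div_atTop tendsto_natCast_atTop_atTop)
    filter_upwards [eventually_gt_atTop 0] with n hn
    have hn' : (0 : ℝ) < n := by positivity
    rw [Real.norm_eq_abs, abs_div, abs_of_pos hn']
    gcongr
    refine (abs_add_le _ _).trans (add_le_add le_rfl ((abs_sub _ _).trans ?_))
    linarith [b1 n, b2 n]
  have h := ((tendsto_average_round_sub_round hβ x y).const_mul 2).add hlim
  rw [add_zero] at h
  refine h.congr fun n => ?_
  rw [e n]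
  ring

/-- A function that stays near `π M n` during the `n`-th lap has the velocity that the mean growth
of `M` per lap dictates. -/
theorem tendsto_div_of_laps {ϕ : ℝ → ℝ} {M : ℕ → ℤ} {L ν τ C : ℝ} (hν : 0 < ν)
    (hM : Tendsto (fun n : ℕ => (M n : ℝ) / n) atTop (𝓝 L))
    (h : ∀ (n : ℕ) (t : ℝ), (n : ℝ) ≤ ν * t + τ → ν * t + τ ≤ n + 1 → |ϕ t - M n * π| ≤ C) :
    Tendsto (fun t => ϕ t / t) atTop (𝓝 (π * L * ν)) := by
  set y : ℝ → ℝ := fun t => ν * t + τ with hy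
  have hyt : Tendsto y atTop atTop :=
    tendsto_atTop_add_const_right _ _ (tendsto_id.const_mul_atTop hν)
  have h1 : Tendsto (fun t => (M ⌊y t⌋₊ : ℝ) / (⌊y t⌋₊ : ℝ)) atTop (𝓝 L) :=
    hM.comp (tendsto_nat_floor_atTop.comp hyt)
  have h2 : Tendsto (fun t => (⌊y t⌋₊ : ℝ) / y t) atTop (𝓝 1) :=
    tendsto_nat_floor_div_atTop.comp hyt
  have h3 : Tendsto (fun t => y t / t) atTop (𝓝 ν) := by
    have : Tendsto (fun t : ℝ => ν + τ / t) atTop (𝓝 (ν + 0)) :=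
      tendsto_const_nhds.add (tendsto_const_nhds.div_atTop tendsto_id)
    rw [add_zero] at this
    refine this.congr' ?_
    filter_upwards [eventually_gt_atTop 0] with t ht
    rw [hy]
    field_simp
  have h4 : Tendsto (fun t => (ϕ t - M ⌊y t⌋₊ * π) / t) atTop (𝓝 0) := by
    refine squeeze_zero_norm' (a := fun t : ℝ => C / t) ?_
      (tendsto_const_nhds.div_atTop tendsto_id)
    filter_upwards [eventually_gt_atTop 0, hyt.eventually_ge_atTop 0] with t ht hyt
    rw [Real.norm_eq_abs, abs_div, abs_of_pos ht]
    gcongr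
    exact h _ t (Nat.floor_le hyt) (Nat.lt_floor_add_one _).le
  have h5 := h4.add (((h1.mul h2).mul h3).const_mul π)
  have e : 0 + π * (L * 1 * ν) = π * L * ν := by ring
  rw [e] at h5
  refine h5.congr' ?_
  filter_upwards [eventually_gt_atTop 0, hyt.eventually_ge_atTop 1] with t ht hyt
  have : (0 : ℝ) < ⌊y t⌋₊ := by exact_mod_cast Nat.floor_pos.2 hyt
  have : 0 < y t := by linarith
  field_simp
  ring

/-! ### The mean motion of a rotating lap curve -/

theorem re_real_mul_exp (r x : ℝ) : ((r : ℂ) * Complex.exp (x * Complex.I)).re = r * cos x := by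
  rw [Complex.re_ofReal_mul, Complex.exp_ofReal_mul_I_re]

/-- A closed curve of vectors `q` of the angular variable `x`, longer than `a` for `|x| < δ` and
shorter than `a` for `δ < x < 2 π - δ`, together with its argument `ψ` on `[-δ, δ]`, which takes the
values `±α` at the end points. -/
structure IsLapCurve (q : ℝ → ℂ) (ψ : ℝ → ℝ) (a δ α : ℝ) : Prop where
  pos : 0 < a
  delta_pos : 0 < δ
  delta_lt : δ < π
  periodic : Function.Periodic q (2 * π)
  continuousOn : ContinuousOn ψ (Set.Icc (-δ) δ)
  polar : ∀ x ∈ Set.Icc (-δ) δ, q x = ‖q x‖ * Complex.exp (ψ x * Complex.I)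
  bound : ∀ x, |ψ x| ≤ π
  lt_norm : ∀ x ∈ Set.Ioo (-δ) δ, a < ‖q x‖
  norm_lt : ∀ x ∈ Set.Ioo δ (2 * π - δ), ‖q x‖ < a
  norm_right : ‖q δ‖ = a
  norm_left : ‖q (-δ)‖ = a
  arg_right : ψ δ = α
  arg_left : ψ (-δ) = -α

section Laps

variable {q : ℝ → ℂ} {ψ : ℝ → ℝ} {a δ α : ℝ}

/-- While `q` is longer than `a`, the vector `a + q exp (i B)` is never perpendicular to
`q exp (i B)`. Hence its argument follows that of `q exp (i B)`. -/
theorem IsLapCurve.long_part (H : IsLapCurve q ψ a δ α) {N : ℝ → ℂ} {ϕ : ℝ → ℝ}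
    {θ ω θ' ω' : ℝ} (hω' : 0 < ω') (hϕ : IsArgBranch N ϕ)
    (hN : ∀ t, 0 ≤ t → N t = a + Complex.exp (((θ + ω * t : ℝ) : ℂ) * Complex.I) * q (ω' * t + θ'))
    (k : ℕ) {s t : ℝ} (hs0 : 0 ≤ s) (hs : ω' * s + θ' = 2 * π * k - δ)
    (ht : ω' * t + θ' = 2 * π * k + δ) :
    ∃ m : ℤ, ∀ x ∈ Set.Icc s t,
      |ϕ x - (θ + ω * x + ψ (ω' * x + θ' - 2 * π * k)) - m * π| ≤ π / 2 := by
  have hst : s < t := by nlinarith [H.delta_pos]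
  have hmaps : ∀ x ∈ Set.Icc s t, ω' * x + θ' - 2 * π * k ∈ Set.Icc (-δ) δ := fun x hx =>
    ⟨by nlinarith [hx.1], by nlinarith [hx.2]⟩
  refine exists_int_abs_sub_mul_pi_le hst ?_ fun x hx => ?_
  · refine (hϕ.1.mono fun x hx => hs0.trans hx.1).sub ((by fun_prop : Continuous fun x : ℝ =>
      θ + ω * x).continuousOn.add (H.continuousOn.comp (by fun_prop) hmaps))
  · have hx' := hmaps x (Set.Ioo_subset_Icc_self hx)
    have hx0 : 0 ≤ x := hs0.trans hx.1.le
    obtain ⟨r, hr⟩ := hϕ.2 x hx0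
    have hper : q (ω' * x + θ') = q (ω' * x + θ' - 2 * π * k) := by
      have := (H.periodic.nat_mul k).sub_eq (ω' * x + θ')
      rw [← this]
      congr 1
      ring
    have hlt := H.lt_norm (ω' * x + θ' - 2 * π * k) ⟨by nlinarith [hx.1], by nlinarith [hx.2]⟩
    have hpol := H.polar _ hx'
    rw [hN x hx0, hper] at hr
    generalize ω' * x + θ' - 2 * π * k = c at *
    have h1 : (a : ℂ) * Complex.exp (((-(θ + ω * x + ψ c) : ℝ) : ℂ) * Complex.I) + ‖q c‖ =
        r * Complex.exp (((ϕ x - (θ + ω * x + ψ c) : ℝ) : ℂ) * Complex.I) := by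
      have e1 : Complex.exp (((ϕ x - (θ + ω * x + ψ c) : ℝ) : ℂ) * Complex.I) =
          Complex.exp (ϕ x * Complex.I) *
            Complex.exp (((-(θ + ω * x + ψ c) : ℝ) : ℂ) * Complex.I) := by
        rw [← Complex.exp_add]; push_cast; ring_nf
      have e2 : Complex.exp (((θ + ω * x : ℝ) : ℂ) * Complex.I) * Complex.exp (ψ c * Complex.I) *
          Complex.exp (((-(θ + ω * x + ψ c) : ℝ) : ℂ) * Complex.I) = 1 := by
        rw [← Complex.exp_add, ← Complex.exp_add, ← Complex.exp_zero]
        congr 1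
        push_cast
        ring
      rw [e1, ← mul_assoc, ← hr]
      rw [hpol]
      simp only [norm_mul, Complex.norm_real, norm_norm, Complex.norm_exp_ofReal_mul_I, mul_one]
      linear_combination (-(‖q c‖ : ℂ)) * e2
    have h2 := congrArg Complex.re h1
    rw [Complex.add_re, re_real_mul_exp, re_real_mul_exp, Complex.ofReal_re] at h2
    intro h0
    rw [h0] at h2
    nlinarith [neg_one_le_cos (-(θ + ω * x + ψ c)), H.pos]

/-- While `q` is shorter than `a`, the vector `a + q exp (i B)` is never perpendicular to the real
axis. Hence its argument stays near a multiple of `π`. -/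
theorem IsLapCurve.short_part (H : IsLapCurve q ψ a δ α) {N : ℝ → ℂ} {ϕ : ℝ → ℝ}
    {θ ω θ' ω' : ℝ} (hω' : 0 < ω') (hϕ : IsArgBranch N ϕ)
    (hN : ∀ t, 0 ≤ t → N t = a + Complex.exp (((θ + ω * t : ℝ) : ℂ) * Complex.I) * q (ω' * t + θ'))
    (k : ℕ) {s t : ℝ} (hs0 : 0 ≤ s) (hs : ω' * s + θ' = 2 * π * k + δ)
    (ht : ω' * t + θ' = 2 * π * (k + 1) - δ) :
    ∃ m : ℤ, ∀ x ∈ Set.Icc s t, |ϕ x - m * π| ≤ π / 2 := by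
  have hst : s < t := by nlinarith [H.delta_lt]
  refine exists_int_abs_sub_mul_pi_le hst (hϕ.1.mono fun x hx => hs0.trans hx.1) fun x hx => ?_
  have hx0 : 0 ≤ x := hs0.trans hx.1.le
  obtain ⟨r, hr⟩ := hϕ.2 x hx0
  have hper : q (ω' * x + θ') = q (ω' * x + θ' - 2 * π * k) := by
    have := (H.periodic.nat_mul k).sub_eq (ω' * x + θ')
    rw [← this]
    congr 1
    ring
  have hlt := H.norm_lt (ω' * x + θ' - 2 * π * k) ⟨by nlinarith [hx.1], by nlinarith [hx.2]⟩
  rw [hN x hx0, hper] at hr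
  generalize ω' * x + θ' - 2 * π * k = c at *
  have h2 := congrArg Complex.re hr
  rw [Complex.add_re, re_real_mul_exp, Complex.ofReal_re] at h2
  have h3 := Complex.abs_re_le_norm (Complex.exp (((θ + ω * x : ℝ) : ℂ) * Complex.I) * q c)
  rw [norm_mul, Complex.norm_exp_ofReal_mul_I, one_mul, abs_le] at h3
  intro h0
  rw [h0] at h2
  linarith [h3.1]

/-- At the end of a long or short part `q exp (i B) = a exp (i u)`. -/
theorem IsLapCurve.transition (H : IsLapCurve q ψ a δ α) {N : ℝ → ℂ} {ϕ : ℝ → ℝ}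
    {θ ω θ' ω' : ℝ} (hϕ : IsArgBranch N ϕ)
    (hN : ∀ t, 0 ≤ t → N t = a + Complex.exp (((θ + ω * t : ℝ) : ℂ) * Complex.I) * q (ω' * t + θ'))
    (k : ℕ) {t c : ℝ} (ht0 : 0 ≤ t) (hc : c ∈ Set.Icc (-δ) δ) (hcn : ‖q c‖ = a)
    (ht : ω' * t + θ' = 2 * π * k + c) :
    ∃ r : ℝ, (a : ℂ) * (1 + Complex.exp (((θ + ω * t + ψ c : ℝ) : ℂ) * Complex.I)) =
      r * Complex.exp (ϕ t * Complex.I) := by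
  obtain ⟨r, hr⟩ := hϕ.2 t ht0
  refine ⟨r, ?_⟩
  have hper : q (ω' * t + θ') = q c := by
    have := (H.periodic.nat_mul k) c
    rw [← this, ht]
    congr 1
    ring
  rw [← hr, hN t ht0, hper, H.polar c hc, hcn]
  push_cast
  rw [add_mul (_ + _) _ Complex.I, Complex.exp_add]
  ring

/-- The normalization `θ' ≤ -δ` makes the laps that are counted from `0` lie in `[0, ∞)`. -/
theorem IsLapCurve.tendsto_of_le (H : IsLapCurve q ψ a δ α) {N : ℝ → ℂ} {ϕ : ℝ → ℝ}
    {θ ω θ' ω' : ℝ} (hω' : 0 < ω') (hirr : Irrational (ω / ω')) (hθ' : θ' ≤ -δ)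
    (hϕ : IsArgBranch N ϕ)
    (hN : ∀ t, 0 ≤ t →
      N t = a + Complex.exp (((θ + ω * t : ℝ) : ℂ) * Complex.I) * q (ω' * t + θ')) :
    Tendsto (fun t => ϕ t / t) atTop (𝓝 (δ / π * ω + α / π * ω')) := by
  have hπ := pi_pos
  have hδ := H.delta_pos
  -- `s k` and `e k` are the beginning and the end of the long part of the `k`-th lap
  set s : ℕ → ℝ := fun k => (2 * π * k - δ - θ') / ω' with hs
  set e : ℕ → ℝ := fun k => (2 * π * k + δ - θ') / ω' with he
  have hs0 : ∀ k, 0 ≤ s k := fun k => div_nonneg (by nlinarith [k.cast_nonneg (α := ℝ)]) hω'.le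
  have hse : ∀ k, s k < e k := fun k => div_lt_div_of_pos_right (by linarith) hω'
  have hes : ∀ k, e k < s (k + 1) := fun k => by
    refine div_lt_div_of_pos_right ?_ hω'
    push_cast
    nlinarith [H.delta_lt]
  have hsv : ∀ k : ℕ, ω' * s k + θ' = 2 * π * k - δ := fun k => by
    rw [hs]; field_simp; ring
  have hev : ∀ k : ℕ, ω' * e k + θ' = 2 * π * k + δ := fun k => by
    rw [he]; field_simp; ring
  choose L hL using fun k => H.long_part hω' hϕ hN k (hs0 k) (hsv k) (hev k)
  choose M hM using fun k => H.short_part hω' hϕ hN k ((hs0 k).trans (hse k).le) (hev k)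
    (t := s (k + 1)) (by rw [hsv]; push_cast; ring)
  have endE : ∀ k, |(M k - L k : ℝ) - 2 * round ((θ + ω * e k + ψ δ) / (2 * π))| ≤ 2 ∧
      (cos ((θ + ω * e k + ψ δ) / 2) ≠ 0 →
        (M k - L k : ℝ) - 2 * round ((θ + ω * e k + ψ δ) / (2 * π)) = 0) := fun k => by
    obtain ⟨r, hr⟩ := H.transition hϕ hN k ((hs0 k).trans (hse k).le)
      ⟨by linarith, le_rfl⟩ H.norm_right (hev k)
    refine sub_eq_two_mul_round H.pos hr ?_ (hM k _ ⟨le_rfl, (hes k).le⟩)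
    have := hL k (e k) ⟨(hse k).le, le_rfl⟩
    rwa [hev, add_sub_cancel_left] at this
  have endS : ∀ k, |(M k - L (k + 1) : ℝ) -
        2 * round ((θ + ω * s (k + 1) + ψ (-δ)) / (2 * π))| ≤ 2 ∧
      (cos ((θ + ω * s (k + 1) + ψ (-δ)) / 2) ≠ 0 →
        (M k - L (k + 1) : ℝ) - 2 * round ((θ + ω * s (k + 1) + ψ (-δ)) / (2 * π)) = 0) :=
      fun k => by
    obtain ⟨r, hr⟩ := H.transition hϕ hN (k + 1) (hs0 (k + 1))
      ⟨le_rfl, by linarith⟩ H.norm_left (hsv (k + 1))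
    refine sub_eq_two_mul_round H.pos hr ?_ (hM k _ ⟨(hes k).le, le_rfl⟩)
    have := hL (k + 1) (s (k + 1)) ⟨le_rfl, (hse (k + 1)).le⟩
    rwa [hsv, sub_sub_cancel_left] at this
  set β := ω / ω' with hβ
  set x : ℝ := (θ + ω * e 1 + α) / (2 * π) with hx
  set y : ℝ := (θ + ω * s 1 - α) / (2 * π) with hy
  have hex : ∀ k : ℕ, (θ + ω * e (k + 1) + ψ δ) / (2 * π) = x + k * β := fun k => by
    rw [H.arg_right, hx, he, hβ]; push_cast; field_simp; ring
  have hsy : ∀ k : ℕ, (θ + ω * s (k + 1) + ψ (-δ)) / (2 * π) = y + k * β := fun k => by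
    rw [H.arg_left, hy, hs, hβ]; push_cast; field_simp; ring
  have half : ∀ z : ℝ, z / 2 = π * (z / (2 * π)) := fun z => by field_simp
  -- `M k` and `M (k + 1)` are both compared with `L (k + 1)`, on the two sides of that long part
  have growth := tendsto_div_of_round_steps (M := M) (L := fun k => L (k + 1)) (x := x) (y := y)
    hirr
    (fun k => by rw [← hex]; exact (endE (k + 1)).1)
    (fun k hk => by rw [← hex, ← half] at hk; rw [← hex]; exact (endE (k + 1)).2 hk)
    (fun k => by rw [← hsy]; exact (endS k).1)
    (fun k hk => by rw [← hsy, ← half] at hk; rw [← hsy]; exact (endS k).2 hk)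
  have hlaps : ∀ (n : ℕ) (t : ℝ), (n : ℝ) ≤ ω' / (2 * π) * t + (θ' + δ) / (2 * π) →
      ω' / (2 * π) * t + (θ' + δ) / (2 * π) ≤ n + 1 →
      |ϕ t - M n * π| ≤ 4 * π + |ω| * (2 * δ / ω') := by
    intro n t h1 h2
    have e1 : ω' / (2 * π) * t + (θ' + δ) / (2 * π) = (ω' * t + θ' + δ) / (2 * π) := by ring
    rw [e1, le_div_iff₀ (by positivity)] at h1
    rw [e1, div_le_iff₀ (by positivity)] at h2
    have hst : s n ≤ t := by rw [hs, div_le_iff₀ hω']; linarith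
    have hts : t ≤ s (n + 1) := by rw [hs, le_div_iff₀ hω']; push_cast; linarith
    have hpos : 0 ≤ |ω| * (2 * δ / ω') := by positivity
    rcases le_total (e n) t with h | h
    · exact (hM n t ⟨h, hts⟩).trans (by linarith)
    · have b1 := abs_le.1 (hL n t ⟨hst, h⟩)
      have b2 := abs_le.1 (hL n (e n) ⟨(hse n).le, le_rfl⟩)
      have b3 := abs_le.1 (hM n (e n) ⟨le_rfl, (hes n).le⟩)
      have b4 := abs_le.1 (H.bound (ω' * t + θ' - 2 * π * n))
      have b5 := abs_le.1 (H.bound (ω' * e n + θ' - 2 * π * n))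
      have b6 : |ω * (t - e n)| ≤ |ω| * (2 * δ / ω') := by
        rw [abs_mul]
        refine mul_le_mul_of_nonneg_left ?_ (abs_nonneg _)
        have e2 : 2 * δ / ω' = e n - s n := by rw [hs, he]; ring
        rw [e2, abs_le]
        constructor <;> linarith
      have b7 := abs_le.1 b6
      rw [abs_le]
      constructor <;> linarith
  have := tendsto_div_of_laps (by positivity : 0 < ω' / (2 * π)) growth hlaps
  convert this using 2
  rw [hx, hy, he, hs]
  field_simp
  ring

theorem IsLapCurve.tendsto (H : IsLapCurve q ψ a δ α) {N : ℝ → ℂ} {ϕ : ℝ → ℝ}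
    {θ ω θ' ω' : ℝ} (hω' : 0 < ω') (hirr : Irrational (ω / ω')) (hϕ : IsArgBranch N ϕ)
    (hN : ∀ t, 0 ≤ t →
      N t = a + Complex.exp (((θ + ω * t : ℝ) : ℂ) * Complex.I) * q (ω' * t + θ')) :
    Tendsto (fun t => ϕ t / t) atTop (𝓝 (δ / π * ω + α / π * ω')) := by
  obtain ⟨K, hK⟩ := exists_nat_ge ((θ' + δ) / (2 * π))
  rw [div_le_iff₀ (by positivity)] at hK
  refine H.tendsto_of_le (θ := θ) (θ' := θ' - K * (2 * π)) hω' hirr (by linarith) hϕ fun t ht => ?_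
  rw [hN t ht, ← add_sub_assoc, (H.periodic.nat_mul K).sub_eq]

/-- At two zeros of `a + q exp (i B)` with the same `C` modulo `2 π` the angles `B` agree
modulo `2 π` as well, which the irrationality forbids. -/
theorem IsLapCurve.subsingleton_zeros (H : IsLapCurve q ψ a δ α) {θ ω θ' ω' : ℝ} (hω' : 0 < ω')
    (hirr : Irrational (ω / ω')) (c : ℝ) :
    {t : ℝ | (a : ℂ) + Complex.exp (((θ + ω * t : ℝ) : ℂ) * Complex.I) * q (ω' * t + θ') = 0 ∧
      ∃ k : ℤ, ω' * t + θ' = c + k * (2 * π)}.Subsingleton := by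
  rintro t ⟨ht, k, hk⟩ t' ⟨ht', k', hk'⟩
  have hπ := pi_pos
  have hper : ∀ k : ℤ, q (c + k * (2 * π)) = q c := fun k => H.periodic.int_mul k c
  rw [hk, hper] at ht
  rw [hk', hper] at ht'
  have hq : q c ≠ 0 := by
    intro h
    rw [h, mul_zero, add_zero, Complex.ofReal_eq_zero] at ht
    exact H.pos.ne' ht
  have hexp : Complex.exp (((θ + ω * t : ℝ) : ℂ) * Complex.I) =
      Complex.exp (((θ + ω * t' : ℝ) : ℂ) * Complex.I) := by
    refine mul_right_cancel₀ hq ?_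
    linear_combination ht - ht'
  obtain ⟨j, hj⟩ := Complex.exp_eq_exp_iff_exists_int.1 hexp
  have hj' : θ + ω * t = θ + ω * t' + j * (2 * π) := by
    have : (((θ + ω * t : ℝ) : ℂ)) * Complex.I =
        ((θ + ω * t' + j * (2 * π) : ℝ) : ℂ) * Complex.I := by
      rw [hj]; push_cast; ring
    exact_mod_cast mul_right_cancel₀ Complex.I_ne_zero this
  by_contra hne
  have h1 : ω' * (t - t') = (k - k') * (2 * π) := by linarith
  have h2 : ω * (t - t') = j * (2 * π) := by linarith
  have hsub : t - t' ≠ 0 := sub_ne_zero.2 hne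
  have h3 : ω / ω' = ((j / (k - k') : ℚ) : ℝ) := by
    have hk0 : ((k : ℝ) - k') ≠ 0 := by
      intro h
      rw [h, zero_mul] at h1
      exact (mul_ne_zero hω'.ne' hsub) h1
    push_cast
    rw [div_eq_div_iff hω'.ne' hk0]
    have : (ω * (k - k')) * (2 * π * (t - t')) = (j * ω') * (2 * π * (t - t')) := by
      linear_combination 2 * π * (k - k') * h2 - 2 * π * j * h1
    exact mul_right_cancel₀ (by positivity) this
  exact hirr ⟨_, h3.symm⟩

/-- Zeros of `a + q exp (i B)` occur only where `‖q‖ = a`, that is, for `C = ±δ` modulo `2 π`. -/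
theorem IsLapCurve.finite_zeros (H : IsLapCurve q ψ a δ α) {θ ω θ' ω' : ℝ} (hω' : 0 < ω')
    (hirr : Irrational (ω / ω')) :
    {t : ℝ | (a : ℂ) + Complex.exp (((θ + ω * t : ℝ) : ℂ) * Complex.I) * q (ω' * t + θ') = 0}.Finite
    := by
  refine ((H.subsingleton_zeros (θ := θ) (θ' := θ') hω' hirr δ).finite.union
    (H.subsingleton_zeros (θ := θ) (θ' := θ') hω' hirr (-δ)).finite).subset fun t ht => ?_
  obtain ⟨k, hk, -⟩ := existsUnique_add_zsmul_mem_Ico (by positivity : 0 < 2 * π)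
    (ω' * t + θ') (-δ)
  rw [zsmul_eq_mul] at hk
  generalize hc : ω' * t + θ' + k * (2 * π) = c at hk
  have hk' : ∃ k : ℤ, ω' * t + θ' = c + k * (2 * π) := ⟨-k, by push_cast; linarith⟩
  have hnorm : ‖q c‖ = a := by
    rw [← hc, H.periodic.int_mul k]
    have h1 := congrArg norm (eq_neg_of_add_eq_zero_right ht)
    rwa [norm_mul, Complex.norm_exp_ofReal_mul_I, one_mul, norm_neg, Complex.norm_real,
      norm_of_nonneg H.pos.le] at h1
  rcases eq_or_lt_of_le hk.1 with h | h
  · exact Or.inr ⟨ht, h ▸ hk'⟩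
  rcases lt_trichotomy c δ with h2 | rfl | h2
  · exact absurd hnorm (H.lt_norm c ⟨h, h2⟩).ne'
  · exact Or.inl ⟨ht, hk'⟩
  · exact absurd hnorm (H.norm_lt c ⟨h2, by linarith [hk.2]⟩).ne

/-- The mean motion of `a + q exp (i B)`. -/
theorem IsLapCurve.hasAngularVelocity (H : IsLapCurve q ψ a δ α) (hq : ∀ x, AnalyticAt ℝ q x)
    {θ ω θ' ω' : ℝ} (hω' : 0 < ω') (hirr : Irrational (ω / ω')) :
    HasAngularVelocity
      (fun t => (a : ℂ) + Complex.exp (((θ + ω * t : ℝ) : ℂ) * Complex.I) * q (ω' * t + θ'))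
      (δ / π * ω + α / π * ω') := by
  refine ⟨exists_isArgBranch_of_analyticAt (fun t => ?_) (H.finite_zeros hω' hirr),
    fun ϕ hϕ => H.tendsto hω' hirr hϕ fun t _ => rfl⟩
  have h1 : AnalyticAt ℝ (fun t : ℝ => ω' * t + θ') t := by fun_prop
  have h2 : AnalyticAt ℝ (fun t : ℝ => Complex.exp (((θ + ω * t : ℝ) : ℂ) * Complex.I)) t := by
    have : AnalyticAt ℝ (fun t : ℝ => (((θ + ω * t : ℝ) : ℂ) * Complex.I)) t :=
      ((Complex.ofRealCLM.analyticAt _).comp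
        (by fun_prop : AnalyticAt ℝ (fun t => θ + ω * t) t)).mul analyticAt_const
    exact (analyticAt_cexp.restrictScalars (𝕜 := ℝ)).comp this
  exact analyticAt_const.add (h2.mul ((hq _).comp h1))

end Laps

/-! ### Two joints in a conformal coordinate -/

/-- The cosine of the angle opposite to the side with half-length coordinate `z` in a triangle in
the plane of curvature `κ = ±1`. The half-length coordinate of a side of length `l` is
`tan (l / 2)` for `κ = 1` and `tanh (l / 2)` for `κ = -1`. -/
noncomputable def cosAngle (κ x y z : ℝ) : ℝ :=
  (x ^ 2 + y ^ 2 - z ^ 2 * (1 + x ^ 2 * y ^ 2)) / (2 * x * y * (1 + κ * z ^ 2))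

/-- The end of a two-joint arm with half-length coordinates `b`, `c` in the conformal coordinate
that is centred at the start of the arm and in which the first joint points along the positive
real axis; `x` is the angle of the second joint. -/
noncomputable def twoJoint (κ b c x : ℝ) : ℂ :=
  (b + c * Complex.exp (x * Complex.I)) / (1 - κ * b * c * Complex.exp (x * Complex.I))

/-- Half-length coordinates of the sides of a nondegenerate triangle in the plane of
curvature `κ = ±1`. The last three fields are the triangle inequalities; the products of two
coordinates are less than `1` if, for `κ = 1`, the sum of the two sides is less than `π`, and always
for `κ = -1`. -/
structure IsTriangleData (κ a b c : ℝ) : Prop where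
  sq_eq : κ ^ 2 = 1
  a_pos : 0 < a
  b_pos : 0 < b
  c_pos : 0 < c
  ab_lt : a * b < 1
  bc_lt : b * c < 1
  one_add_a : 0 < 1 + κ * a ^ 2
  one_add_b : 0 < 1 + κ * b ^ 2
  one_add_c : 0 < 1 + κ * c ^ 2
  lt_a : a * (1 - κ * b * c) < b + c
  lt_b : b * (1 - κ * c * a) < c + a
  lt_c : c * (1 - κ * a * b) < a + b

theorem mul_cosAngle {κ x y z : ℝ} (hx : x ≠ 0) (hy : y ≠ 0) (hz : 1 + κ * z ^ 2 ≠ 0) :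
    2 * x * y * (1 + κ * z ^ 2) * cosAngle κ x y z =
      x ^ 2 + y ^ 2 - z ^ 2 * (1 + x ^ 2 * y ^ 2) := by
  rw [cosAngle]; field_simp

theorem cosAngle_comm (κ x y z : ℝ) : cosAngle κ x y z = cosAngle κ y x z := by
  rw [cosAngle, cosAngle]; ring_nf

theorem abs_cosAngle_lt_one {κ x y z : ℝ} (hκ : κ ^ 2 = 1) (hx : 0 < x) (hy : 0 < y) (hz : 0 < z)
    (hz1 : 0 < 1 + κ * z ^ 2) (h1 : x * (1 - κ * y * z) < y + z) (h2 : y * (1 - κ * z * x) < z + x)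
    (h3 : z * (1 - κ * x * y) < x + y) (hxy : x * y < 1) : |cosAngle κ x y z| < 1 := by
  have hκ1 : κ ≤ 1 := by nlinarith
  have hκ2 : -1 ≤ κ := by nlinarith
  have hxy0 : 0 < x * y := mul_pos hx hy
  have hm : 0 < 1 - κ * x * y := by nlinarith
  have hd : 0 < 2 * x * y * (1 + κ * z ^ 2) := by positivity
  rw [abs_lt]
  constructor
  · rw [cosAngle, lt_div_iff₀ hd]
    have : 0 < (x + y - z * (1 - κ * x * y)) * (x + y + z * (1 - κ * x * y)) :=
      mul_pos (by linarith) (by positivity)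
    have e : (x + y - z * (1 - κ * x * y)) * (x + y + z * (1 - κ * x * y)) =
        (x + y) ^ 2 - z ^ 2 * (1 - 2 * κ * x * y + κ ^ 2 * x ^ 2 * y ^ 2) := by ring
    rw [e, hκ] at this
    linarith
  · rw [cosAngle, div_lt_iff₀ hd]
    have : 0 < (z * (1 + κ * x * y) - (x - y)) * (z * (1 + κ * x * y) + (x - y)) :=
      mul_pos (by linarith) (by linarith)
    have e : (z * (1 + κ * x * y) - (x - y)) * (z * (1 + κ * x * y) + (x - y)) =
        z ^ 2 * (1 + 2 * κ * x * y + κ ^ 2 * x ^ 2 * y ^ 2) - (x - y) ^ 2 := by ring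
    rw [e, hκ] at this
    linarith

section TwoJoint

variable {κ a b c : ℝ}

theorem IsTriangleData.abs_kappa (H : IsTriangleData κ a b c) : |κ| = 1 := by
  rcases mul_self_eq_one_iff.1 ((sq κ).symm.trans H.sq_eq) with h | h <;> simp [h]

theorem IsTriangleData.abs_bc_lt (H : IsTriangleData κ a b c) : |κ * b * c| < 1 := by
  rw [mul_assoc, abs_mul, H.abs_kappa, one_mul, abs_of_pos (mul_pos H.b_pos H.c_pos)]
  exact H.bc_lt

theorem re_one_sub_pos {k : ℝ} (hk : |k| < 1) (x : ℝ) :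
    0 < (1 - k * Complex.exp (x * Complex.I)).re := by
  rw [Complex.sub_re, Complex.one_re, re_real_mul_exp]
  have h1 : |k * cos x| < 1 := by
    rw [abs_mul]
    exact (mul_le_of_le_one_right (abs_nonneg k) (abs_cos_le_one x)).trans_lt hk
  linarith [(abs_lt.1 h1).2]

theorem IsTriangleData.re_den_pos (H : IsTriangleData κ a b c) (x : ℝ) :
    0 < (1 - κ * b * c * Complex.exp (x * Complex.I)).re := by
  have := re_one_sub_pos H.abs_bc_lt x
  push_cast at this
  exact this

theorem IsTriangleData.den_ne_zero (H : IsTriangleData κ a b c) (x : ℝ) :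
    1 - κ * b * c * Complex.exp (x * Complex.I) ≠ 0 := fun h => by
  simpa [h] using H.re_den_pos x

theorem normSq_real_add_mul_exp (s r x : ℝ) :
    Complex.normSq (s + r * Complex.exp (x * Complex.I)) = s ^ 2 + r ^ 2 + 2 * s * r * cos x := by
  rw [Complex.normSq_apply, Complex.add_re, Complex.add_im, re_real_mul_exp,
    Complex.im_ofReal_mul, Complex.exp_ofReal_mul_I_im, Complex.ofReal_re, Complex.ofReal_im]
  linear_combination r ^ 2 * sin_sq_add_cos_sq x

theorem IsTriangleData.sq_norm_twoJoint (H : IsTriangleData κ a b c) (x : ℝ) :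
    ‖twoJoint κ b c x‖ ^ 2 * (1 + b ^ 2 * c ^ 2 - 2 * κ * b * c * cos x) =
      b ^ 2 + c ^ 2 + 2 * b * c * cos x := by
  have h1 := normSq_real_add_mul_exp b c x
  have h2 := normSq_real_add_mul_exp 1 (-(κ * b * c)) x
  have h3 : Complex.normSq (1 - κ * b * c * Complex.exp (x * Complex.I)) =
      1 + b ^ 2 * c ^ 2 - 2 * κ * b * c * cos x := by
    rw [show (1 : ℂ) - κ * b * c * Complex.exp (x * Complex.I) =
      ((1 : ℝ) : ℂ) + ((-(κ * b * c) : ℝ) : ℂ) * Complex.exp (x * Complex.I) by push_cast; ring, h2]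
    linear_combination b ^ 2 * c ^ 2 * H.sq_eq
  have h4 : Complex.normSq (1 - κ * b * c * Complex.exp (x * Complex.I)) ≠ 0 := by
    simpa [Complex.normSq_eq_zero] using H.den_ne_zero x
  rw [← Complex.normSq_eq_norm_sq, twoJoint, map_div₀, ← h3, div_mul_cancel₀ _ h4, h1]

/-- The end of the second joint is at the distance of the third side iff the angle of the
second joint is exterior to the triangle. -/
theorem IsTriangleData.sq_norm_sub (H : IsTriangleData κ a b c) (x : ℝ) :
    0 < 1 + b ^ 2 * c ^ 2 - 2 * κ * b * c * cos x ∧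
    (‖twoJoint κ b c x‖ ^ 2 - a ^ 2) * (1 + b ^ 2 * c ^ 2 - 2 * κ * b * c * cos x) =
      2 * b * c * (1 + κ * a ^ 2) * (cos x + cosAngle κ b c a) := by
  have h1 := H.sq_norm_twoJoint x
  have h2 := mul_cosAngle H.b_pos.ne' H.c_pos.ne' H.one_add_a.ne'
  refine ⟨?_, by linear_combination h1 - h2⟩
  have h3 := normSq_real_add_mul_exp 1 (-(κ * b * c)) x
  have h4 : 0 < Complex.normSq
      (((1 : ℝ) : ℂ) + ((-(κ * b * c) : ℝ) : ℂ) * Complex.exp (x * Complex.I)) := by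
    rw [Complex.normSq_pos]
    have := H.den_ne_zero x
    intro h
    apply this
    rw [← h]; push_cast; ring
  rw [h3] at h4
  have e : (1 : ℝ) ^ 2 + (-(κ * b * c)) ^ 2 + 2 * 1 * -(κ * b * c) * cos x =
      1 + κ ^ 2 * (b ^ 2 * c ^ 2) - 2 * κ * b * c * cos x := by ring
  rw [e, H.sq_eq, one_mul] at h4
  exact h4

theorem IsTriangleData.im_twoJoint (H : IsTriangleData κ a b c) (x : ℝ) :
    ∃ p : ℝ, 0 < p ∧ (twoJoint κ b c x).im = p * sin x := by
  have h4 : 0 < Complex.normSq (1 - κ * b * c * Complex.exp (x * Complex.I)) :=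
    Complex.normSq_pos.2 (H.den_ne_zero x)
  refine ⟨c * (1 + κ * b ^ 2) / Complex.normSq (1 - κ * b * c * Complex.exp (x * Complex.I)),
    div_pos (mul_pos H.c_pos H.one_add_b) h4, ?_⟩
  have e1 : ((κ : ℂ) * b * c * Complex.exp (x * Complex.I)) =
      ((κ * b * c : ℝ) : ℂ) * Complex.exp (x * Complex.I) := by push_cast; ring
  rw [twoJoint, Complex.div_im, ← sub_div, e1]
  rw [e1] at h4
  simp only [Complex.add_re, Complex.add_im, Complex.sub_re, Complex.sub_im, re_real_mul_exp,
    Complex.im_ofReal_mul, Complex.exp_ofReal_mul_I_im, Complex.ofReal_re, Complex.ofReal_im,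
    Complex.one_re, Complex.one_im]
  field_simp
  ring

theorem IsTriangleData.twoJoint_mem_slitPlane (H : IsTriangleData κ a b c) {x : ℝ}
    (hx : |x| < π) : twoJoint κ b c x ∈ Complex.slitPlane := by
  rw [Complex.mem_slitPlane_iff]
  rw [abs_lt] at hx
  by_cases h0 : x = 0
  · left
    subst h0
    have e : twoJoint κ b c 0 = (((b + c) / (1 - κ * b * c) : ℝ) : ℂ) := by
      rw [twoJoint]; push_cast; simp
    rw [e, Complex.ofReal_re]
    have := (abs_lt.1 H.abs_bc_lt).2
    exact div_pos (add_pos H.b_pos H.c_pos) (by linarith)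
  · right
    obtain ⟨p, hp, h⟩ := H.im_twoJoint x
    rw [h]
    refine mul_ne_zero hp.ne' fun hs => h0 ?_
    exact (sin_eq_zero_iff_of_lt_of_lt hx.1 hx.2).1 hs

theorem conj_exp_mul_I (x : ℝ) : (starRingEnd ℂ) (Complex.exp (x * Complex.I)) =
    Complex.exp (((-x : ℝ) : ℂ) * Complex.I) := by
  rw [← Complex.exp_conj]; simp

theorem conj_twoJoint (κ b c x : ℝ) :
    (starRingEnd ℂ) (twoJoint κ b c x) = twoJoint κ b c (-x) := by
  simp only [twoJoint, map_div₀, map_add, map_sub, map_mul, map_one, Complex.conj_ofReal,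
    conj_exp_mul_I]

theorem IsTriangleData.abs_cosAngle_lt (H : IsTriangleData κ a b c) :
    |cosAngle κ b c a| < 1 :=
  abs_cosAngle_lt_one H.sq_eq H.b_pos H.c_pos H.a_pos H.one_add_a H.lt_b H.lt_c H.lt_a H.bc_lt

/-- The argument of the end of a two-joint arm that closes the triangle is the angle between the
first joint and the third side. -/
theorem IsTriangleData.arg_twoJoint (H : IsTriangleData κ a b c) {x : ℝ} (hx0 : 0 < x) (hx : x < π)
    (hn : ‖twoJoint κ b c x‖ = a) :
    Complex.arg (twoJoint κ b c x) = arccos (cosAngle κ a b c) := by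
  obtain ⟨p, hp, him⟩ := H.im_twoJoint x
  have him0 : 0 ≤ (twoJoint κ b c x).im := by
    rw [him]; exact mul_nonneg hp.le (sin_pos_of_pos_of_lt_pi hx0 hx).le
  have hne : twoJoint κ b c x ≠ 0 := by
    rw [← norm_pos_iff, hn]; exact H.a_pos
  rw [Complex.arg_of_im_nonneg_of_ne_zero him0 hne, hn]
  congr 1
  have hden := H.den_ne_zero x
  have h1 : c * Complex.exp (x * Complex.I) * (1 + κ * b * twoJoint κ b c x) =
      twoJoint κ b c x - b := by
    have h : twoJoint κ b c x * (1 - κ * b * c * Complex.exp (x * Complex.I)) =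
        b + c * Complex.exp (x * Complex.I) := div_mul_cancel₀ _ hden
    linear_combination -h
  have h2 := congrArg Complex.normSq h1
  have h3 : (twoJoint κ b c x).re ^ 2 + (twoJoint κ b c x).im ^ 2 = a ^ 2 := by
    rw [← hn, ← Complex.normSq_eq_norm_sq, Complex.normSq_apply]; ring
  generalize twoJoint κ b c x = w at h2 h3 ⊢
  rw [map_mul, map_mul, Complex.normSq_eq_norm_sq (Complex.exp _),
    Complex.norm_exp_ofReal_mul_I, Complex.normSq_ofReal] at h2
  simp only [Complex.normSq_apply, Complex.add_re, Complex.add_im, Complex.sub_re, Complex.sub_im,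
    Complex.mul_re, Complex.mul_im, Complex.ofReal_re, Complex.ofReal_im, Complex.one_re,
    Complex.one_im] at h2
  have ha := H.a_pos
  have hb := H.b_pos
  have hc := H.one_add_c
  rw [cosAngle]
  rw [div_eq_div_iff ha.ne' (by positivity)]
  have h4 : w.re * (2 * b * (1 + κ * c ^ 2)) = a ^ 2 + b ^ 2 - c ^ 2 * (1 + a ^ 2 * b ^ 2) := by
    linear_combination h2 + (1 - c ^ 2 * b ^ 2) * h3 -
      c ^ 2 * b ^ 2 * (w.re ^ 2 + w.im ^ 2) * H.sq_eq
  linear_combination a * h4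

theorem analyticAt_twoJoint (H : IsTriangleData κ a b c) (x : ℝ) :
    AnalyticAt ℝ (twoJoint κ b c) x := by
  have h1 : AnalyticAt ℝ (fun x : ℝ => Complex.exp (x * Complex.I)) x := by
    have h : AnalyticAt ℝ (fun x : ℝ => (x : ℂ) * Complex.I) x :=
      (Complex.ofRealCLM.analyticAt _).mul analyticAt_const
    exact (analyticAt_cexp.restrictScalars (𝕜 := ℝ)).comp h
  exact (analyticAt_const.add (analyticAt_const.mul h1)).div
    (analyticAt_const.sub (analyticAt_const.mul h1)) (H.den_ne_zero x)

theorem IsTriangleData.isLapCurve (H : IsTriangleData κ a b c) :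
    IsLapCurve (twoJoint κ b c) (fun x => Complex.arg (twoJoint κ b c x)) a
      (π - arccos (cosAngle κ b c a)) (arccos (cosAngle κ a b c)) := by
  have hπ := pi_pos
  set δ := π - arccos (cosAngle κ b c a) with hδ
  have habs := abs_lt.1 H.abs_cosAngle_lt
  have hcos : cos δ = -cosAngle κ b c a := by
    rw [hδ, cos_pi_sub, cos_arccos habs.1.le habs.2.le]
  have hδ0 : 0 < δ := sub_pos.2 (arccos_lt_pi.2 habs.1)
  have hδπ : δ < π := sub_lt_self _ (arccos_pos.2 habs.2)
  have ha := H.a_pos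
  have hb := H.b_pos
  have hc := H.c_pos
  have h1a := H.one_add_a
  have hfac : 0 < 2 * b * c * (1 + κ * a ^ 2) := by positivity
  have hbig : ∀ x, cos δ < cos x → a < ‖twoJoint κ b c x‖ := fun x hx => by
    obtain ⟨h1, h2⟩ := H.sq_norm_sub x
    have h3 : 0 < 2 * b * c * (1 + κ * a ^ 2) * (cos x + cosAngle κ b c a) :=
      mul_pos hfac (by linarith)
    rw [← h2] at h3
    exact lt_of_pow_lt_pow_left₀ 2 (norm_nonneg _) (by linarith [pos_of_mul_pos_left h3 h1.le])
  have hsmall : ∀ x, cos x < cos δ → ‖twoJoint κ b c x‖ < a := fun x hx => by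
    obtain ⟨h1, h2⟩ := H.sq_norm_sub x
    have h3 : 0 < 2 * b * c * (1 + κ * a ^ 2) * -(cos x + cosAngle κ b c a) :=
      mul_pos hfac (by linarith)
    rw [mul_neg, ← h2, ← neg_mul] at h3
    exact lt_of_pow_lt_pow_left₀ 2 ha.le (by linarith [pos_of_mul_pos_left h3 h1.le])
  have hδn : ‖twoJoint κ b c δ‖ = a := by
    obtain ⟨h1, h2⟩ := H.sq_norm_sub δ
    rw [hcos, neg_add_cancel, mul_zero] at h2
    rw [hcos] at h1
    have := (mul_eq_zero.1 h2).resolve_right h1.ne'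
    exact (pow_left_inj₀ (norm_nonneg _) ha.le two_ne_zero).1 (by linarith)
  have hargδ := H.arg_twoJoint hδ0 hδπ hδn
  refine ⟨ha, hδ0, hδπ, fun x => ?_, ?_, fun x _ => ?_, fun x => Complex.abs_arg_le_pi _,
    fun x hx => hbig x ?_, fun x hx => hsmall x ?_, hδn, ?_, hargδ, ?_⟩
  · have : Complex.exp (((x + 2 * π : ℝ) : ℂ) * Complex.I) = Complex.exp (x * Complex.I) := by
      push_cast
      rw [add_mul, Complex.exp_periodic]
    rw [twoJoint, twoJoint, this]
  · intro x hx
    have hcont : Continuous (twoJoint κ b c) :=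
      continuous_iff_continuousAt.2 fun x => (analyticAt_twoJoint H x).continuousAt
    refine ((Complex.continuousAt_arg (H.twoJoint_mem_slitPlane ?_)).comp
      hcont.continuousAt).continuousWithinAt
    rw [abs_lt]
    constructor <;> linarith [hx.1, hx.2]
  · exact (Complex.norm_mul_exp_arg_mul_I _).symm
  · rw [← cos_abs x]
    exact cos_lt_cos_of_nonneg_of_le_pi (abs_nonneg x) hδπ.le (abs_lt.2 ⟨by linarith [hx.1], hx.2⟩)
  · rcases le_total x π with h | h
    · exact cos_lt_cos_of_nonneg_of_le_pi hδ0.le h hx.1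
    · rw [← cos_two_pi_sub x]
      exact cos_lt_cos_of_nonneg_of_le_pi hδ0.le (by linarith) (by linarith [hx.2])
  · rw [← conj_twoJoint, Complex.norm_conj, hδn]
  · rw [← conj_twoJoint, Complex.arg_conj, hargδ, if_neg]
    exact (arccos_lt_pi.2 (by
      exact (abs_lt.1 (abs_cosAngle_lt_one H.sq_eq H.a_pos H.b_pos H.c_pos H.one_add_c H.lt_a
        H.lt_b (by linarith [H.lt_c]) H.ab_lt)).1)).ne

theorem IsTriangleData.hasAngularVelocity_numerator (H : IsTriangleData κ a b c)
    {θ ω θ' ω' : ℝ} (hω' : ω' ≠ 0) (hirr : Irrational (ω / ω')) :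
    HasAngularVelocity
      (fun t => (a : ℂ) + Complex.exp (((θ + ω * t : ℝ) : ℂ) * Complex.I) *
        twoJoint κ b c (θ' + ω' * t))
      ((π - arccos (cosAngle κ b c a)) / π * ω + arccos (cosAngle κ a b c) / π * ω') := by
  rcases hω'.lt_or_gt with h | h
  · have := (H.isLapCurve.hasAngularVelocity (analyticAt_twoJoint H) (θ := -θ) (ω := -ω)
      (θ' := -θ') (ω' := -ω') (by linarith) (by rwa [neg_div_neg_eq])).conj
    convert this.congr (w' := fun t => (a : ℂ) + Complex.exp (((θ + ω * t : ℝ) : ℂ) * Complex.I) *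
        twoJoint κ b c (θ' + ω' * t)) fun t _ => ?_ using 1
    · ring
    · rw [map_add, map_mul, conj_exp_mul_I, conj_twoJoint, Complex.conj_ofReal,
        show -(-θ + -ω * t) = θ + ω * t by ring, show -(-ω' * t + -θ') = θ' + ω' * t by ring]
  · convert H.isLapCurve.hasAngularVelocity (analyticAt_twoJoint H) h hirr using 4
    rw [add_comm]

end TwoJoint

/-- The end of a three-joint arm with half-length coordinates `a` and angles `θ` in the conformal
coordinate centred at the start of the arm. -/
noncomputable def armCoord (κ : ℝ) (a θ : Fin 3 → ℝ) : ℂ :=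
  Complex.exp (θ 0 * Complex.I) *
    ((a 0 + Complex.exp (θ 1 * Complex.I) * twoJoint κ (a 1) (a 2) (θ 2)) /
      (1 - κ * a 0 * (Complex.exp (θ 1 * Complex.I) * twoJoint κ (a 1) (a 2) (θ 2))))

section Arm

variable {κ : ℝ} {a : Fin 3 → ℝ}

theorem IsTriangleData.re_armCoord_den_pos (H : IsTriangleData κ (a 0) (a 1) (a 2))
    (hden : ∀ x, a 0 * ‖twoJoint κ (a 1) (a 2) x‖ < 1) (x y : ℝ) :
    0 < (1 - κ * a 0 * (Complex.exp (x * Complex.I) * twoJoint κ (a 1) (a 2) y)).re := by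
  have h2 := Complex.re_le_norm (κ * a 0 * (Complex.exp (x * Complex.I) *
    twoJoint κ (a 1) (a 2) y))
  rw [norm_mul, norm_mul, norm_mul, Complex.norm_exp_ofReal_mul_I, Complex.norm_real,
    Complex.norm_real, Real.norm_eq_abs, H.abs_kappa, one_mul, one_mul,
    norm_of_nonneg H.a_pos.le] at h2
  rw [Complex.sub_re, Complex.one_re]
  linarith [hden y]

theorem IsTriangleData.continuous_twoJoint (H : IsTriangleData κ (a 0) (a 1) (a 2)) :
    Continuous (twoJoint κ (a 1) (a 2)) :=
  continuous_iff_continuousAt.2 fun x => (analyticAt_twoJoint H x).continuousAt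

theorem IsTriangleData.continuous_armCoord (H : IsTriangleData κ (a 0) (a 1) (a 2))
    (hden : ∀ x, a 0 * ‖twoJoint κ (a 1) (a 2) x‖ < 1) (θ ω : Fin 3 → ℝ) :
    Continuous fun t : ℝ => armCoord κ a (fun j => θ j + ω j * t) := by
  have hcont := H.continuous_twoJoint
  refine Continuous.mul (by fun_prop) (Continuous.div (by fun_prop) (by fun_prop) fun t h => ?_)
  have := H.re_armCoord_den_pos hden (θ 1 + ω 1 * t) (θ 2 + ω 2 * t)
  rw [h] at this
  exact lt_irrefl _ this

/-- The mean motion of a three-joint arm in a conformal coordinate centred at its start. The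
denominator stays in the right half-plane and does not contribute. -/
theorem IsTriangleData.hasAngularVelocity (H : IsTriangleData κ (a 0) (a 1) (a 2))
    (hden : ∀ x, a 0 * ‖twoJoint κ (a 1) (a 2) x‖ < 1)
    {θ ω : Fin 3 → ℝ} (hω : ω 2 ≠ 0) (hirr : Irrational (ω 1 / ω 2)) :
    HasAngularVelocity (fun t => armCoord κ a (fun j => θ j + ω j * t))
      (ω 0 + (π - arccos (cosAngle κ (a 1) (a 2) (a 0))) / π * ω 1 +
        arccos (cosAngle κ (a 0) (a 1) (a 2)) / π * ω 2) := by
  have hcont := H.continuous_twoJoint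
  have h1 := (H.hasAngularVelocity_numerator (θ := θ 1) (θ' := θ 2) hω hirr).div_of_re_pos
    (g := fun t => 1 - κ * a 0 * (Complex.exp (((θ 1 + ω 1 * t : ℝ) : ℂ) * Complex.I) *
      twoJoint κ (a 1) (a 2) (θ 2 + ω 2 * t))) (by fun_prop)
    fun t => H.re_armCoord_den_pos hden _ _
  have hk : Tendsto (fun t : ℝ => (θ 0 + ω 0 * t) / t) atTop (𝓝 (ω 0)) := by
    have h := (tendsto_const_nhds (x := θ 0)).div_atTop (tendsto_id (α := ℝ) (x := atTop))
    have h' := h.add (tendsto_const_nhds (x := ω 0))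
    rw [zero_add] at h'
    refine h'.congr' ?_
    filter_upwards [eventually_gt_atTop 0] with t ht
    simp only [id]
    field_simp
  have h2 := h1.mul_exp (k := fun t => θ 0 + ω 0 * t) (c := fun _ => 1)
    (by fun_prop) (by simp) hk (fun t _ => rfl)
  convert h2.congr fun t _ => ?_ using 1
  · ring
  · rw [Complex.ofReal_one, mul_one]
    exact mul_comm _ _

end Arm

theorem irrational_div_of_linearIndependent {ω : Fin 3 → ℝ} (hω : LinearIndependent ℚ ω) :
    ω 2 ≠ 0 ∧ Irrational (ω 1 / ω 2) := by
  have h2 : ω 2 ≠ 0 := hω.ne_zero 2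
  refine ⟨h2, ?_⟩
  rintro ⟨r, hr⟩
  have h := Fintype.linearIndependent_iff.1 hω ![0, 1, -r] (by
    rw [Fin.sum_univ_three]
    simp only [Matrix.cons_val, zero_smul, one_smul, zero_add, neg_smul, Rat.smul_def, hr]
    field_simp
    ring) 1
  simp at h

end SwivelingArm

namespace SwivelingArm

open Filter Topology

/-! ### Change of the complex chart -/

/-- If the derivative vanished, `f - f z` would be the `n`-th power, `n ≥ 2`, of a local
coordinate. -/
theorem deriv_ne_zero_of_injOn {f : ℂ → ℂ} {s : Set ℂ} {z : ℂ} (hs : s ∈ 𝓝 z)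
    (hf : AnalyticAt ℂ f z) (hinj : Set.InjOn f s) : deriv f z ≠ 0 := by
  intro hd
  have hF : AnalyticAt ℂ (fun w => f w - f z) z := hf.sub analyticAt_const
  have hne : ¬ ∀ᶠ w in 𝓝 z, f w - f z = 0 := by
    intro h
    have h1 : ∀ᶠ w in 𝓝[≠] z, f w - f z = 0 ∧ w ∈ s ∧ w ≠ z :=
      (h.filter_mono nhdsWithin_le_nhds).and
        ((eventually_mem_nhdsWithin.and (mem_nhdsWithin_of_mem_nhds hs)).mono
          fun w hw => ⟨hw.2, hw.1⟩)
    obtain ⟨w, hw0, hws, hwz⟩ := h1.exists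
    exact hwz (hinj hws (mem_of_mem_nhds hs) (sub_eq_zero.1 hw0))
  obtain ⟨n, g, hg, hg0, hfg⟩ := (hF.exists_eventuallyEq_pow_smul_nonzero_iff).2 hne
  have hn0 : n ≠ 0 := by
    rintro rfl
    have := hfg.self_of_nhds
    simp at this
    exact hg0 this.symm
  have hn1 : n ≠ 1 := by
    rintro rfl
    have h1 : HasDerivAt (fun w => (w - z) ^ 1 • g w) (g z) z := by
      have := ((hasDerivAt_id z).sub_const z).fun_mul hg.differentiableAt.hasDerivAt
      simpa using this
    have h2 : HasDerivAt (fun w => f w - f z) (g z) z := h1.congr_of_eventuallyEq hfg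
    have h3 : HasDerivAt (fun w => f w - f z) (deriv f z) z :=
      hf.differentiableAt.hasDerivAt.sub_const _
    exact hg0 (by rw [h2.unique h3, hd])
  -- the local coordinate, an `n`-th root of `f - f z` up to the factor `g z`
  set k : ℂ → ℂ := fun w => (w - z) * Complex.exp (Complex.log (g w / g z) / n) with hk
  have hslit : g z / g z ∈ Complex.slitPlane := by
    rw [div_self hg0]; exact Complex.one_mem_slitPlane
  have hroot : AnalyticAt ℂ (fun w => Complex.exp (Complex.log (g w / g z) / n)) z := by
    have h1 : AnalyticAt ℂ (fun w => g w / g z) z := hg.div analyticAt_const hg0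
    exact ((h1.clog hslit).div analyticAt_const (by exact_mod_cast hn0)).cexp
  have hka : AnalyticAt ℂ k z := (analyticAt_id.sub analyticAt_const).mul hroot
  have hkd : HasDerivAt k 1 z := by
    have := ((hasDerivAt_id z).sub_const z).fun_mul hroot.differentiableAt.hasDerivAt
    simpa [div_self hg0] using this
  have hks : HasStrictDerivAt k 1 z := by
    have := hka.hasStrictDerivAt
    rwa [hkd.deriv] at this
  have hkz : k z = 0 := by simp [hk]
  have hpow : ∀ᶠ w in 𝓝 z, f w - f z = g z * k w ^ n := by
    have h1 : ∀ᶠ w in 𝓝 z, g w ≠ 0 := hg.continuousAt.eventually_ne hg0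
    filter_upwards [hfg, h1] with w hw hgw
    rw [hw, hk, mul_pow, ← Complex.exp_nat_mul,
      mul_div_cancel₀ _ (by exact_mod_cast hn0 : (n : ℂ) ≠ 0),
      Complex.exp_log (div_ne_zero hgw hg0), smul_eq_mul]
    field_simp
  have hinv1 := hks.eventually_right_inverse one_ne_zero
  have hinv2 : Tendsto (hks.localInverse k 1 z one_ne_zero) (𝓝 (k z)) (𝓝 z) :=
    HasStrictFDerivAt.localInverse_tendsto _
  rw [hkz] at hinv1 hinv2
  set j := hks.localInverse k 1 z one_ne_zero with hj
  have hgood : ∀ᶠ y in 𝓝 (0 : ℂ), k (j y) = y ∧ j y ∈ s ∧ f (j y) - f z = g z * k (j y) ^ n :=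
    hinv1.and ((hinv2.eventually hs).and (hinv2.eventually hpow))
  set ζ : ℂ := Complex.exp (2 * Real.pi * Complex.I / n) with hζ
  have hprim : IsPrimitiveRoot ζ n := Complex.isPrimitiveRoot_exp n hn0
  have hmul : Tendsto (fun y : ℂ => ζ * y) (𝓝 0) (𝓝 0) := by
    have := (continuous_const_mul ζ).tendsto (0 : ℂ)
    rwa [mul_zero] at this
  have hboth := (hgood.and (hmul.eventually hgood)).filter_mono
    (nhdsWithin_le_nhds (s := {0}ᶜ))
  obtain ⟨y, ⟨⟨h1, h2, h3⟩, h4, h5, h6⟩, hy⟩ := (hboth.and eventually_mem_nhdsWithin).exists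
  have hEq : f (j y) = f (j (ζ * y)) := by
    rw [h1] at h3
    rw [h4, mul_pow, hprim.pow_eq_one, one_mul, ← h3] at h6
    linear_combination -h6
  have h7 : y = ζ * y := h1.symm.trans ((congrArg k (hinj h2 h5 hEq)).trans h4)
  have h8 : ζ = 1 := by
    refine mul_right_cancel₀ (show y ≠ 0 from hy) ?_
    rw [one_mul]; exact h7.symm
  exact hprim.ne_one (by omega) h8

/-- An injective holomorphic function on a disk differs from the coordinate by a factor which has a
continuous logarithm. -/
theorem exists_sub_eq_mul_exp {f : ℂ → ℂ} {ρ : ℝ} (hρ : 0 < ρ)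
    (hd : ∀ w ∈ Metric.closedBall (0 : ℂ) ρ, DifferentiableAt ℂ f w)
    (hinj : Set.InjOn f (Metric.closedBall 0 ρ)) :
    ∃ h : ℂ → ℂ, Continuous h ∧
      ∀ w ∈ Metric.closedBall (0 : ℂ) ρ, f w - f 0 = w * Complex.exp (h w) := by
  have hball : Metric.closedBall (0 : ℂ) ρ ∈ 𝓝 (0 : ℂ) := Metric.closedBall_mem_nhds 0 hρ
  have h0 : (0 : ℂ) ∈ Metric.closedBall (0 : ℂ) ρ := mem_of_mem_nhds hball
  have han : AnalyticAt ℂ f 0 := by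
    have : DifferentiableOn ℂ f (Metric.ball 0 ρ) := fun w hw =>
      (hd w (Metric.ball_subset_closedBall hw)).differentiableWithinAt
    exact this.analyticAt (Metric.ball_mem_nhds 0 hρ)
  have hcont : ContinuousOn (dslope f 0) (Metric.closedBall 0 ρ) :=
    (continuousOn_dslope hball).2
      ⟨fun w hw => (hd w hw).continuousAt.continuousWithinAt, hd 0 h0⟩
  have hne : ∀ w ∈ Metric.closedBall (0 : ℂ) ρ, dslope f 0 w ≠ 0 := by
    intro w hw
    rcases eq_or_ne w 0 with rfl | hw0
    · rw [dslope_same]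
      exact deriv_ne_zero_of_injOn hball han hinj
    · intro h
      have := sub_smul_dslope f 0 w
      rw [h, smul_zero] at this
      exact hw0 (hinj hw h0 (sub_eq_zero.1 this.symm))
  -- the radial retraction onto the disk
  set r : ℂ → ℂ := fun w => ((ρ / max ρ ‖w‖ : ℝ) : ℂ) * w with hr
  have hmax : ∀ w : ℂ, 0 < max ρ ‖w‖ := fun w => lt_max_of_lt_left hρ
  have hrc : Continuous r := by
    refine (Complex.continuous_ofReal.comp (Continuous.div continuous_const (by fun_prop)
      fun w => (hmax w).ne')).mul continuous_id
  have hrm : ∀ w, r w ∈ Metric.closedBall (0 : ℂ) ρ := fun w => by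
    rw [mem_closedBall_zero_iff, hr, norm_mul, Complex.norm_real, Real.norm_eq_abs,
      abs_of_pos (div_pos hρ (hmax w)), div_mul_eq_mul_div, div_le_iff₀ (hmax w)]
    exact mul_le_mul_of_nonneg_left (le_max_right _ _) hρ.le
  have hri : ∀ w ∈ Metric.closedBall (0 : ℂ) ρ, r w = w := fun w hw => by
    rw [mem_closedBall_zero_iff] at hw
    simp only [hr]
    rw [max_eq_left hw, div_self hρ.ne', Complex.ofReal_one, one_mul]
  obtain ⟨h, hh, he⟩ := Complex.exists_continuousOn_eqOn_exp_comp (X := ℂ) (U := Set.univ)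
    (g := fun w => dslope f 0 (r w)) isSimplyConnected_univ_of_module isOpen_univ
    (hcont.comp_continuous hrc hrm).continuousOn
    (by rintro ⟨w, -, hw⟩; exact hne _ (hrm w) hw)
  refine ⟨h, continuousOn_univ.1 hh, fun w hw => ?_⟩
  have h1 := he (Set.mem_univ w)
  simp only [Function.comp, hri w hw] at h1
  rw [h1]
  have := sub_smul_dslope f 0 w
  rw [sub_zero, smul_eq_mul] at this
  exact this.symm

/-- The angular velocity about the centre of a disk is the same in each complex chart of the
disk. -/
theorem HasAngularVelocity.comp_chart {f : ℂ → ℂ} {W : ℝ → ℂ} {ρ a : ℝ}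
    (hW : HasAngularVelocity W a) (hWc : ContinuousOn W (Set.Ici 0))
    (hWρ : ∀ t, 0 ≤ t → ‖W t‖ ≤ ρ)
    (hd : ∀ w ∈ Metric.closedBall (0 : ℂ) ρ, DifferentiableAt ℂ f w)
    (hinj : Set.InjOn f (Metric.closedBall 0 ρ)) :
    HasAngularVelocity (fun t => f (W t) - f 0) a := by
  rcases le_or_gt ρ 0 with hρ | hρ
  · refine hW.congr fun t ht => ?_
    have h0 : W t = 0 := norm_le_zero_iff.1 ((hWρ t ht).trans hρ)
    rw [h0, sub_self]
  obtain ⟨h, hh, he⟩ := exists_sub_eq_mul_exp hρ hd hinj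
  obtain ⟨C, hC⟩ := ((isCompact_closedBall (0 : ℂ) ρ).image hh).isBounded.exists_norm_le
  have hmem : ∀ t, 0 ≤ t → W t ∈ Metric.closedBall (0 : ℂ) ρ := fun t ht =>
    mem_closedBall_zero_iff.2 (hWρ t ht)
  refine hW.mul_cexp (h := fun t => h (W t)) (C := C) (hh.comp_continuousOn hWc)
    (fun t ht => ?_) fun t ht => he _ (hmem t ht)
  exact (Complex.abs_im_le_norm _).trans (hC _ ⟨_, hmem t ht, rfl⟩)

/-! ### The hyperbolic plane: disk coordinates -/

theorem tanh_lt_tanh_iff {x y : ℝ} : Real.tanh x < Real.tanh y ↔ x < y := by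
  rw [← Real.artanh_lt_artanh_iff ⟨Real.neg_one_lt_tanh x, Real.tanh_lt_one x⟩
    ⟨Real.neg_one_lt_tanh y, Real.tanh_lt_one y⟩, Real.artanh_tanh, Real.artanh_tanh]

theorem tanh_pos_of_pos {x : ℝ} (hx : 0 < x) : 0 < Real.tanh x := by
  rw [← Real.tanh_zero]; exact tanh_lt_tanh_iff.2 hx

theorem tanh_add_mul (x y : ℝ) :
    Real.tanh (x + y) * (1 + Real.tanh x * Real.tanh y) = Real.tanh x + Real.tanh y := by
  have hx := (Real.cosh_pos x).ne'
  have hy := (Real.cosh_pos y).ne'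
  have hxy := (Real.cosh_pos (x + y)).ne'
  rw [Real.tanh_eq_sinh_div_cosh, Real.tanh_eq_sinh_div_cosh, Real.tanh_eq_sinh_div_cosh]
  field_simp
  rw [Real.sinh_add, Real.cosh_add]
  ring

theorem tanh_mul_lt_add {x y z : ℝ} (hx : 0 < x) (hy : 0 < y) (h : z < x + y) :
    Real.tanh z * (1 + Real.tanh x * Real.tanh y) < Real.tanh x + Real.tanh y := by
  rw [← tanh_add_mul]
  have := mul_pos (tanh_pos_of_pos hx) (tanh_pos_of_pos hy)
  exact mul_lt_mul_of_pos_right (tanh_lt_tanh_iff.2 h) (by linarith)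

theorem isTriangleData_tanh {x y z : ℝ} (hx : 0 < x) (hy : 0 < y) (hz : 0 < z) (h1 : x < y + z)
    (h2 : y < z + x) (h3 : z < x + y) :
    IsTriangleData (-1) (Real.tanh x) (Real.tanh y) (Real.tanh z) := by
  have px := tanh_pos_of_pos hx
  have py := tanh_pos_of_pos hy
  have pz := tanh_pos_of_pos hz
  have lx := Real.tanh_lt_one x
  have ly := Real.tanh_lt_one y
  have lz := Real.tanh_lt_one z
  have sx := Real.tanh_sq_lt_one x
  have sy := Real.tanh_sq_lt_one y
  have sz := Real.tanh_sq_lt_one z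
  have t1 := tanh_mul_lt_add hy hz h1
  have t2 := tanh_mul_lt_add hz hx h2
  have t3 := tanh_mul_lt_add hx hy h3
  constructor <;> first | assumption | linarith | nlinarith

namespace HypUnitTangent

/-- The Euclidean unit vector in the direction of a tangent vector. -/
noncomputable def unit (ξ : HypUnitTangent) : ℂ := ξ.vec / (ξ.pt.im : ℂ)

/-- The coordinate of the Poincaré disk model in which the base point of `ξ` is the centre and `ξ`
points along the positive real axis. -/
noncomputable def disk (ξ : HypUnitTangent) (z : UpperHalfPlane) : ℂ :=
  Complex.I * (starRingEnd ℂ) ξ.unit * ((z : ℂ) - ξ.pt) / ((z : ℂ) - (starRingEnd ℂ) (ξ.pt : ℂ))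

theorem norm_unit (ξ : HypUnitTangent) : ‖ξ.unit‖ = 1 := by
  rw [unit, norm_div, ξ.norm_vec, Complex.norm_real, Real.norm_of_nonneg ξ.pt.im_pos.le,
    div_self ξ.pt.im_ne_zero]

theorem unit_mul_conj (ξ : HypUnitTangent) : ξ.unit * (starRingEnd ℂ) ξ.unit = 1 := by
  rw [Complex.mul_conj, Complex.normSq_eq_norm_sq, ξ.norm_unit]; simp

theorem sub_conj_ne_zero (z w : UpperHalfPlane) : (z : ℂ) - (starRingEnd ℂ) (w : ℂ) ≠ 0 := by
  intro h
  have := congrArg Complex.im h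
  rw [Complex.sub_im, Complex.conj_im, Complex.zero_im, sub_neg_eq_add, UpperHalfPlane.coe_im,
    UpperHalfPlane.coe_im] at this
  linarith [z.im_pos, w.im_pos]

theorem disk_pt (ξ : HypUnitTangent) : ξ.disk ξ.pt = 0 := by
  rw [disk, sub_self, mul_zero, zero_div]

theorem norm_disk (ξ : HypUnitTangent) (z : UpperHalfPlane) :
    ‖ξ.disk z‖ = Real.tanh (dist ξ.pt z / 2) := by
  rw [dist_comm, UpperHalfPlane.tanh_half_dist, disk, norm_div, norm_mul, norm_mul,
    Complex.norm_conj, ξ.norm_unit, Complex.norm_I, one_mul, one_mul, dist_eq_norm, dist_eq_norm]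

theorem norm_disk_lt (ξ : HypUnitTangent) (z : UpperHalfPlane) : ‖ξ.disk z‖ < 1 := by
  rw [norm_disk]; exact Real.tanh_lt_one _

theorem disk_injective (ξ : HypUnitTangent) : Function.Injective ξ.disk := by
  intro z w h
  have hz := sub_conj_ne_zero z ξ.pt
  have hw := sub_conj_ne_zero w ξ.pt
  have hu : (starRingEnd ℂ) ξ.unit ≠ 0 := right_ne_zero_of_mul_eq_one ξ.unit_mul_conj
  have hp := sub_conj_ne_zero ξ.pt ξ.pt
  rw [disk, disk, div_eq_div_iff hz hw] at h
  have h1 : (Complex.I * (starRingEnd ℂ) ξ.unit * ((ξ.pt : ℂ) - (starRingEnd ℂ) (ξ.pt : ℂ))) *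
      ((z : ℂ) - w) = 0 := by linear_combination h
  have h2 := (mul_eq_zero.1 h1).resolve_left (mul_ne_zero (mul_ne_zero Complex.I_ne_zero hu) hp)
  exact UpperHalfPlane.ext (sub_eq_zero.1 h2)

theorem unit_rotate (ξ : HypUnitTangent) (θ : ℝ) :
    (ξ.rotate θ).unit = Complex.exp (θ * Complex.I) * ξ.unit := by
  rw [unit, unit]
  exact mul_div_assoc _ _ _

theorem disk_rotate (ξ : HypUnitTangent) (θ : ℝ) (z : UpperHalfPlane) :
    ξ.disk z = Complex.exp (θ * Complex.I) * (ξ.rotate θ).disk z := by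
  have h : Complex.exp (θ * Complex.I) * (starRingEnd ℂ) (Complex.exp (θ * Complex.I)) = 1 := by
    rw [Complex.mul_conj, Complex.normSq_eq_norm_sq, Complex.norm_exp_ofReal_mul_I]; simp
  rw [disk, disk, unit_rotate, map_mul]
  change _ = _ * (_ * (_ * _) * ((z : ℂ) - ξ.pt) / ((z : ℂ) - (starRingEnd ℂ) (ξ.pt : ℂ)))
  rw [← mul_div_assoc]
  congr 1
  linear_combination -(Complex.I * (starRingEnd ℂ) ξ.unit * ((z : ℂ) - ξ.pt)) * h

theorem conj_unit_flow (ξ : HypUnitTangent) (s : ℝ) :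
    (starRingEnd ℂ) (ξ.flow s).unit =
      (starRingEnd ℂ) ξ.unit * ξ.den s / (starRingEnd ℂ) (ξ.den s) := by
  have hd := ξ.den_ne_zero s
  have hd' : (starRingEnd ℂ) (ξ.den s) ≠ 0 := by simpa using hd
  have him : ((ξ.flow s).pt.im : ℂ) = (ξ.pt.im : ℂ) / (ξ.den s * (starRingEnd ℂ) (ξ.den s)) := by
    rw [Complex.mul_conj]
    exact_mod_cast ξ.geodesicPoint_im s
  have hp : (ξ.pt.im : ℂ) ≠ 0 := by exact_mod_cast ξ.pt.im_ne_zero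
  have h : (ξ.flow s).unit = ξ.unit * (starRingEnd ℂ) (ξ.den s) / ξ.den s := by
    rw [unit, unit, him]
    change ξ.vec / ξ.den s ^ 2 / _ = _
    field_simp
  rw [h, map_div₀, map_mul, Complex.conj_conj]

/-- Disk coordinates that are centred at two points of a geodesic differ by the translation with
the half-length coordinate `tanh (s / 2)`. -/
theorem disk_flow_mul (ξ : HypUnitTangent) (s : ℝ) (z : UpperHalfPlane) :
    (ξ.flow s).disk z * (1 - Real.tanh (s / 2) * ξ.disk z) =
      ξ.disk z - Real.tanh (s / 2) := by
  have hd := ξ.den_ne_zero s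
  have hd' : (starRingEnd ℂ) (ξ.den s) ≠ 0 := by simpa using hd
  have hu := ξ.unit_mul_conj
  have hY := sub_conj_ne_zero z ξ.pt
  have hY' := sub_conj_ne_zero z (ξ.flow s).pt
  have hc : (Real.cosh (s / 2) : ℂ) ≠ 0 := by exact_mod_cast (Real.cosh_pos _).ne'
  have hden : ξ.den s = Real.cosh (s / 2) + Complex.I * ξ.unit * Real.sinh (s / 2) := rfl
  have hden' : (starRingEnd ℂ) (ξ.den s) =
      Real.cosh (s / 2) - Complex.I * (starRingEnd ℂ) ξ.unit * Real.sinh (s / 2) := by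
    rw [hden]
    simp only [map_add, map_mul, Complex.conj_ofReal, Complex.conj_I]
    ring
  have hpt : ((ξ.flow s).pt : ℂ) * ξ.den s = ξ.pt * Real.cosh (s / 2) +
      Complex.I * ξ.unit * (starRingEnd ℂ) (ξ.pt : ℂ) * Real.sinh (s / 2) :=
    div_mul_cancel₀ _ hd
  have hpt' : (starRingEnd ℂ) ((ξ.flow s).pt : ℂ) * (starRingEnd ℂ) (ξ.den s) =
      (starRingEnd ℂ) (ξ.pt : ℂ) * Real.cosh (s / 2) -
      Complex.I * (starRingEnd ℂ) ξ.unit * ξ.pt * Real.sinh (s / 2) := by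
    rw [← map_mul, hpt]
    simp only [map_add, map_mul, Complex.conj_ofReal, Complex.conj_I, Complex.conj_conj]
    ring
  have hX2 : ((z : ℂ) - (ξ.flow s).pt) * ξ.den s = Real.cosh (s / 2) * ((z : ℂ) - ξ.pt) +
      Complex.I * ξ.unit * Real.sinh (s / 2) * ((z : ℂ) - (starRingEnd ℂ) (ξ.pt : ℂ)) := by
    rw [sub_mul, hpt, hden]; ring
  have hY2 : ((z : ℂ) - (starRingEnd ℂ) ((ξ.flow s).pt : ℂ)) * (starRingEnd ℂ) (ξ.den s) =
      Real.cosh (s / 2) * ((z : ℂ) - (starRingEnd ℂ) (ξ.pt : ℂ)) -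
      Complex.I * (starRingEnd ℂ) ξ.unit * Real.sinh (s / 2) * ((z : ℂ) - ξ.pt) := by
    rw [sub_mul, hpt', hden']; ring
  have hD : (ξ.flow s).disk z = Complex.I * (starRingEnd ℂ) ξ.unit *
      (((z : ℂ) - (ξ.flow s).pt) * ξ.den s) /
      (((z : ℂ) - (starRingEnd ℂ) ((ξ.flow s).pt : ℂ)) * (starRingEnd ℂ) (ξ.den s)) := by
    rw [disk, conj_unit_flow]
    field_simp
  have hne := mul_ne_zero hY' hd'
  rw [hX2, hY2] at hD
  rw [hY2] at hne
  rw [hD, disk, Real.tanh_eq_sinh_div_cosh]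
  push_cast at hc hne ⊢
  generalize (starRingEnd ℂ) ξ.unit = ub at *
  generalize ξ.unit = u at *
  generalize (z : ℂ) - (starRingEnd ℂ) (ξ.pt : ℂ) = Y at *
  generalize (z : ℂ) - (ξ.pt : ℂ) = X at *
  generalize Complex.cosh ((s : ℂ) / 2) = c at *
  generalize Complex.sinh ((s : ℂ) / 2) = d at *
  have e1 : 1 - d / c * (Complex.I * ub * X / Y) = (c * Y - Complex.I * ub * d * X) / (c * Y) := by
    field_simp
  rw [e1, div_mul_div_cancel₀ hne]
  field_simp
  linear_combination d * Y * Complex.I ^ 2 * hu + d * Y * Complex.I_sq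

theorem disk_flow_pt (ξ : HypUnitTangent) (s : ℝ) :
    ξ.disk (ξ.flow s).pt = Real.tanh (s / 2) := by
  have h := ξ.disk_flow_mul s (ξ.flow s).pt
  rw [disk_pt, zero_mul] at h
  exact (sub_eq_zero.1 h.symm)

theorem disk_flow (ξ : HypUnitTangent) (s : ℝ) (z : UpperHalfPlane) :
    ξ.disk z = (Real.tanh (s / 2) + (ξ.flow s).disk z) /
      (1 + Real.tanh (s / 2) * (ξ.flow s).disk z) := by
  have h := ξ.disk_flow_mul s z
  have hne : (1 : ℂ) + Real.tanh (s / 2) * (ξ.flow s).disk z ≠ 0 := by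
    intro h0
    have h1 : ‖(Real.tanh (s / 2) : ℂ) * (ξ.flow s).disk z‖ < 1 := by
      rw [norm_mul, Complex.norm_real, Real.norm_eq_abs]
      exact mul_lt_one_of_nonneg_of_lt_one_left (abs_nonneg _) (Real.abs_tanh_lt_one _)
        ((ξ.flow s).norm_disk_lt z).le
    rw [eq_neg_of_add_eq_zero_right h0, norm_neg, norm_one] at h1
    exact lt_irrefl _ h1
  rw [eq_div_iff hne]
  linear_combination -h

theorem dist_flow_pt (ξ : HypUnitTangent) {s : ℝ} (hs : 0 ≤ s) : dist ξ.pt (ξ.flow s).pt = s := by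
  have h := ξ.norm_disk (ξ.flow s).pt
  rw [disk_flow_pt, Complex.norm_real, Real.norm_eq_abs, abs_of_nonneg] at h
  · have := Real.tanh_injective h
    linarith
  · rcases hs.eq_or_lt with rfl | hs
    · simp
    · exact (tanh_pos_of_pos (by positivity)).le

theorem exists_flow_dist (A B : UpperHalfPlane) :
    ∃ ξ : HypUnitTangent, ξ.pt = A ∧ (ξ.flow (dist A B)).pt = B := by
  set ξ₀ : HypUnitTangent := ⟨A, A.im, by
    rw [Complex.norm_real, Real.norm_of_nonneg A.im_pos.le]⟩ with hξ₀
  set θ := Complex.arg (ξ₀.disk B) with hθ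
  refine ⟨ξ₀.rotate θ, rfl, (ξ₀.rotate θ).disk_injective ?_⟩
  have h1 := ξ₀.disk_rotate θ B
  have h2 := Complex.norm_mul_exp_arg_mul_I (ξ₀.disk B)
  rw [disk_flow_pt, ← show ‖ξ₀.disk B‖ = Real.tanh (dist A B / 2) from ξ₀.norm_disk B]
  refine mul_left_cancel₀ (Complex.exp_ne_zero (θ * Complex.I)) ?_
  rw [← h1, mul_comm]
  exact h2

end HypUnitTangent

/-! ### Hyperbolic triangles -/

open HypUnitTangent

theorem disk_eq_of_pt_eq {ξ η : HypUnitTangent} (h : ξ.pt = η.pt) (z : UpperHalfPlane) :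
    ξ.disk z = (starRingEnd ℂ) ξ.unit * η.unit * η.disk z := by
  simp only [disk, h]
  rw [← mul_div_assoc]
  congr 1
  linear_combination -((starRingEnd ℂ) ξ.unit * Complex.I * ((z : ℂ) - η.pt)) * η.unit_mul_conj

/-- The law of cosines in half-length coordinates. -/
theorem hyp_law_of_cosines {ξ η : HypUnitTangent} (h : ξ.pt = η.pt) (l m : ℝ) :
    Real.tanh (dist (ξ.flow l).pt (η.flow m).pt / 2) ^ 2 *
      (1 + Real.tanh (l / 2) ^ 2 * Real.tanh (m / 2) ^ 2 -
        2 * Real.tanh (l / 2) * Real.tanh (m / 2) * ((starRingEnd ℂ) ξ.unit * η.unit).re) =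
      Real.tanh (l / 2) ^ 2 + Real.tanh (m / 2) ^ 2 -
        2 * Real.tanh (l / 2) * Real.tanh (m / 2) * ((starRingEnd ℂ) ξ.unit * η.unit).re := by
  have h1 := ξ.disk_flow_mul l (η.flow m).pt
  have h2 : ξ.disk (η.flow m).pt =
      (starRingEnd ℂ) ξ.unit * η.unit * Real.tanh (m / 2) := by
    rw [← disk_flow_pt]
    exact disk_eq_of_pt_eq h _
  have hg : ‖(starRingEnd ℂ) ξ.unit * η.unit‖ = 1 := by
    rw [norm_mul, Complex.norm_conj, norm_unit, norm_unit, one_mul]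
  have hg2 : ((starRingEnd ℂ) ξ.unit * η.unit).re ^ 2 +
      ((starRingEnd ℂ) ξ.unit * η.unit).im ^ 2 = 1 := by
    rw [← one_pow 2, ← hg, ← Complex.normSq_eq_norm_sq, Complex.normSq_apply]; ring
  rw [h2] at h1
  have h3 := congrArg Complex.normSq h1
  rw [map_mul, Complex.normSq_eq_norm_sq (disk _ _), norm_disk] at h3
  generalize (starRingEnd ℂ) ξ.unit * η.unit = g at *
  generalize Real.tanh (l / 2) = a at *
  generalize Real.tanh (m / 2) = b at *
  simp only [Complex.normSq_apply, Complex.sub_re, Complex.sub_im, Complex.mul_re,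
    Complex.mul_im, Complex.ofReal_re, Complex.ofReal_im, Complex.one_re, Complex.one_im] at h3
  generalize Real.tanh (dist (ξ.flow l).pt (η.flow m).pt / 2) = t at *
  linear_combination h3 + (b ^ 2 - t ^ 2 * a ^ 2 * b ^ 2) * hg2

theorem angle_vec_eq (ξ η : HypUnitTangent) :
    InnerProductGeometry.angle ξ.vec η.vec =
      Real.arccos ((starRingEnd ℂ) ξ.unit * η.unit).re := by
  rw [InnerProductGeometry.angle, Complex.inner, ξ.norm_vec, η.norm_vec, mul_comm η.vec]
  congr 1
  rw [unit, unit, map_div₀, Complex.conj_ofReal, div_mul_div_comm, ← Complex.ofReal_mul,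
    Complex.div_ofReal_re]

theorem IsHypAngle.eq_arccos {A B C : UpperHalfPlane} {α : ℝ} (h : IsHypAngle A B C α)
    (hB : 0 < dist A B) (hC : 0 < dist A C) :
    α = Real.arccos (cosAngle (-1) (Real.tanh (dist A B / 2)) (Real.tanh (dist A C / 2))
      (Real.tanh (dist B C / 2))) := by
  obtain ⟨ξ, η, hξ, hη, hξB, hηC, rfl⟩ := h
  rw [angle_vec_eq]
  congr 1
  have h1 := hyp_law_of_cosines (hξ.trans hη.symm) (dist A B) (dist A C)
  rw [hξB, hηC] at h1
  have p1 := tanh_pos_of_pos (half_pos hB)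
  have p2 := tanh_pos_of_pos (half_pos hC)
  have p3 := Real.tanh_sq_lt_one (dist B C / 2)
  have hne : 2 * Real.tanh (dist A B / 2) * Real.tanh (dist A C / 2) *
      (1 + -1 * Real.tanh (dist B C / 2) ^ 2) ≠ 0 := by
    have : 0 < 1 + -1 * Real.tanh (dist B C / 2) ^ 2 := by linarith
    positivity
  rw [cosAngle, eq_div_iff hne]
  linear_combination h1

theorem exists_isHypAngle (A B C : UpperHalfPlane) : ∃ α, IsHypAngle A B C α := by
  obtain ⟨ξ, hξ, hξB⟩ := exists_flow_dist A B
  obtain ⟨η, hη, hηC⟩ := exists_flow_dist A C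
  exact ⟨_, ξ, η, hξ, hη, hξB, hηC, rfl⟩

/-- The angles of a triangle with half-length coordinates `a`. -/
noncomputable def triangleAngles (κ : ℝ) (a : Fin 3 → ℝ) (j : Fin 3) : ℝ :=
  Real.arccos (cosAngle κ (a (j + 1)) (a (j + 2)) (a j))

theorem IsHypTriangle.eq_triangleAngles {l α : Fin 3 → ℝ} (hl : ∀ j, 0 < l j)
    (h : IsHypTriangle l α) : α = triangleAngles (-1) fun j => Real.tanh (l j / 2) := by
  obtain ⟨A, B, C, h0, h1, h2, a0, a1, a2⟩ := h
  have e0 := a0.eq_arccos (by rw [h2]; exact hl 2) (by rw [dist_comm, h1]; exact hl 1)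
  have e1 := a1.eq_arccos (by rw [h0]; exact hl 0) (by rw [dist_comm, h2]; exact hl 2)
  have e2 := a2.eq_arccos (by rw [h1]; exact hl 1) (by rw [dist_comm, h0]; exact hl 0)
  rw [dist_comm A C, h0, h1, h2, cosAngle_comm] at e0
  rw [dist_comm B A, h0, h1, h2, cosAngle_comm] at e1
  rw [dist_comm C B, h0, h1, h2, cosAngle_comm] at e2
  funext j
  fin_cases j
  · exact e0
  · exact e1
  · exact e2

theorem exists_isHypTriangle {l : Fin 3 → ℝ} (hl : ∀ j, 0 < l j)
    (h0 : l 0 < l 1 + l 2) (h1 : l 1 < l 2 + l 0) (h2 : l 2 < l 0 + l 1) :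
    ∃ α, IsHypTriangle l α := by
  have H := isTriangleData_tanh (half_pos (hl 0)) (half_pos (hl 1)) (half_pos (hl 2))
    (by linarith) (by linarith) (by linarith)
  set x := cosAngle (-1) (Real.tanh (l 1 / 2)) (Real.tanh (l 2 / 2)) (Real.tanh (l 0 / 2)) with hx
  have hcos : Real.cos (Real.arccos x) = x :=
    Real.cos_arccos (abs_lt.1 H.abs_cosAngle_lt).1.le (abs_lt.1 H.abs_cosAngle_lt).2.le
  set ξ : HypUnitTangent := ⟨UpperHalfPlane.I, 1, by simp⟩
  set η := ξ.rotate (Real.arccos x) with hη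
  have hre : ((starRingEnd ℂ) ξ.unit * η.unit).re = x := by
    rw [hη, unit_rotate, mul_left_comm, mul_comm ((starRingEnd ℂ) ξ.unit), unit_mul_conj, mul_one,
      Complex.exp_ofReal_mul_I_re, hcos]
  have hA : dist ξ.pt (ξ.flow (l 2)).pt = l 2 := ξ.dist_flow_pt (hl 2).le
  have hC : dist ξ.pt (η.flow (l 1)).pt = l 1 := η.dist_flow_pt (hl 1).le
  have hB : dist (ξ.flow (l 2)).pt (η.flow (l 1)).pt = l 0 := by
    have h3 := hyp_law_of_cosines (show ξ.pt = η.pt from rfl) (l 2) (l 1)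
    rw [hre] at h3
    have h4 := mul_cosAngle H.b_pos.ne' H.c_pos.ne' H.one_add_a.ne'
    rw [← hx] at h4
    have hpos : 0 < 1 + Real.tanh (l 2 / 2) ^ 2 * Real.tanh (l 1 / 2) ^ 2 -
        2 * Real.tanh (l 2 / 2) * Real.tanh (l 1 / 2) * x := by
      have hx1 : x < 1 := (abs_lt.1 H.abs_cosAngle_lt).2
      have hp := mul_pos H.b_pos H.c_pos
      nlinarith [sq_nonneg (1 - Real.tanh (l 2 / 2) * Real.tanh (l 1 / 2)),
        mul_lt_mul_of_pos_left hx1 hp]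
    have h5 : Real.tanh (dist (ξ.flow (l 2)).pt (η.flow (l 1)).pt / 2) ^ 2 =
        Real.tanh (l 0 / 2) ^ 2 := by
      refine mul_right_cancel₀ hpos.ne' ?_
      linear_combination h3 - h4
    have h6 := (pow_left_inj₀ (by rw [← norm_disk]; exact norm_nonneg _) H.a_pos.le
      two_ne_zero).1 h5
    have := Real.tanh_injective h6
    linarith
  obtain ⟨α₀, hα₀⟩ := exists_isHypAngle ξ.pt (ξ.flow (l 2)).pt (η.flow (l 1)).pt
  obtain ⟨α₁, hα₁⟩ := exists_isHypAngle (ξ.flow (l 2)).pt (η.flow (l 1)).pt ξ.pt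
  obtain ⟨α₂, hα₂⟩ := exists_isHypAngle (η.flow (l 1)).pt ξ.pt (ξ.flow (l 2)).pt
  exact ⟨![α₀, α₁, α₂], _, _, _, hB, by rw [dist_comm]; exact hC, hA, hα₀, hα₁, hα₂⟩

/-! ### The hyperbolic arm -/

theorem disk_hypArm (ξ : HypUnitTangent) (l θ : Fin 3 → ℝ) :
    ξ.disk (hypArm ξ l θ) = armCoord (-1) (fun j => Real.tanh (l j / 2)) θ := by
  set ξ₁ := (ξ.rotate (θ 0)).flow (l 0) with h1
  set ξ₂ := (ξ₁.rotate (θ 1)).flow (l 1) with h2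
  have e3 : (ξ₂.rotate (θ 2)).disk (hypArm ξ l θ) = Real.tanh (l 2 / 2) := disk_flow_pt _ _
  have e2 : (ξ₁.rotate (θ 1)).disk (hypArm ξ l θ) =
      twoJoint (-1) (Real.tanh (l 1 / 2)) (Real.tanh (l 2 / 2)) (θ 2) := by
    rw [disk_flow _ (l 1), ← h2, disk_rotate ξ₂ (θ 2), e3, twoJoint]
    push_cast
    ring_nf
  rw [disk_rotate ξ (θ 0), disk_flow _ (l 0), ← h1, disk_rotate ξ₁ (θ 1), e2, armCoord]
  push_cast
  ring_nf

theorem dist_hypArm_le (ξ : HypUnitTangent) {l : Fin 3 → ℝ} (hl : ∀ j, 0 < l j)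
    (θ : Fin 3 → ℝ) : dist ξ.pt (hypArm ξ l θ) ≤ l 0 + l 1 + l 2 := by
  set ξ₁ := (ξ.rotate (θ 0)).flow (l 0)
  set ξ₂ := (ξ₁.rotate (θ 1)).flow (l 1)
  have d1 : dist ξ.pt ξ₁.pt = l 0 := (ξ.rotate (θ 0)).dist_flow_pt (hl 0).le
  have d2 : dist ξ₁.pt ξ₂.pt = l 1 := (ξ₁.rotate (θ 1)).dist_flow_pt (hl 1).le
  have d3 : dist ξ₂.pt (hypArm ξ l θ) = l 2 := (ξ₂.rotate (θ 2)).dist_flow_pt (hl 2).le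
  linarith [dist_triangle ξ.pt ξ₁.pt (hypArm ξ l θ), dist_triangle ξ₁.pt ξ₂.pt (hypArm ξ l θ)]

/-- The inverse of the disk coordinate. -/
noncomputable def HypUnitTangent.undisk (ξ : HypUnitTangent) (w : ℂ) : ℂ :=
  ((ξ.pt : ℂ) + Complex.I * ξ.unit * w * (starRingEnd ℂ) (ξ.pt : ℂ)) /
    (1 + Complex.I * ξ.unit * w)

theorem HypUnitTangent.undisk_den_ne_zero (ξ : HypUnitTangent) {w : ℂ} (hw : ‖w‖ < 1) :
    1 + Complex.I * ξ.unit * w ≠ 0 := by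
  intro h
  have h1 := congrArg norm (eq_neg_of_add_eq_zero_right h)
  rw [norm_neg, norm_one, norm_mul, norm_mul, Complex.norm_I, ξ.norm_unit, one_mul, one_mul] at h1
  exact hw.ne h1

theorem HypUnitTangent.undisk_im_pos (ξ : HypUnitTangent) {w : ℂ} (hw : ‖w‖ < 1) :
    0 < (ξ.undisk w).im := by
  have hd := ξ.undisk_den_ne_zero hw
  have hn : ‖Complex.I * ξ.unit * w‖ < 1 := by
    rwa [norm_mul, norm_mul, Complex.norm_I, ξ.norm_unit, one_mul, one_mul]
  rw [undisk]
  generalize Complex.I * ξ.unit * w = v at *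
  have hns : v.re ^ 2 + v.im ^ 2 < 1 := by
    have : v.re ^ 2 + v.im ^ 2 = ‖v‖ ^ 2 := by
      rw [← Complex.normSq_eq_norm_sq, Complex.normSq_apply]; ring
    rw [this]
    nlinarith [norm_nonneg v]
  have h0 := Complex.normSq_pos.2 hd
  rw [Complex.div_im, ← sub_div]
  refine div_pos ?_ h0
  simp only [Complex.add_re, Complex.add_im, Complex.mul_re, Complex.mul_im, Complex.conj_re,
    Complex.conj_im, Complex.one_re, Complex.one_im, UpperHalfPlane.coe_re, UpperHalfPlane.coe_im]
  have := mul_pos ξ.pt.im_pos (sub_pos.2 hns)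
  linarith

theorem HypUnitTangent.disk_undisk (ξ : HypUnitTangent) {w : ℂ} (hw : ‖w‖ < 1) :
    ξ.disk ⟨ξ.undisk w, ξ.undisk_im_pos hw⟩ = w := by
  have hd := ξ.undisk_den_ne_zero hw
  have hu := ξ.unit_mul_conj
  have hp := sub_conj_ne_zero ξ.pt ξ.pt
  rw [disk, div_eq_iff (sub_conj_ne_zero _ _)]
  change Complex.I * (starRingEnd ℂ) ξ.unit * (ξ.undisk w - ξ.pt) =
    w * (ξ.undisk w - (starRingEnd ℂ) (ξ.pt : ℂ))
  rw [undisk]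
  field_simp
  linear_combination
    (Complex.I ^ 2 * w * ((starRingEnd ℂ) (ξ.pt : ℂ) - ξ.pt)) * hu +
    (w * ((starRingEnd ℂ) (ξ.pt : ℂ) - ξ.pt)) * Complex.I_sq

theorem HypHasAngularVelocity.of_disk {ξ : HypUnitTangent} {z : ℝ → UpperHalfPlane} {a L : ℝ}
    (hL : ∀ t, 0 ≤ t → dist ξ.pt (z t) ≤ L)
    (hc : ContinuousOn (fun t => ξ.disk (z t)) (Set.Ici 0))
    (h : HasAngularVelocity (fun t => ξ.disk (z t)) a) : HypHasAngularVelocity ξ.pt z a := by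
  refine ⟨⟨Set.univ, fun p => (p : ℂ), ⟨isOpen_univ, ?_, fun p _ => ?_⟩, L, hL, by simp⟩, ?_⟩
  · exact fun p _ q _ hpq => UpperHalfPlane.ext hpq
  · refine differentiableAt_id.congr_of_eventuallyEq ?_
    filter_upwards [(isOpen_lt continuous_const Complex.continuous_im).mem_nhds
      (show 0 < (p : ℂ).im from p.im_pos)] with w hw
    simp only [Function.comp, id]
    rw [UpperHalfPlane.ofComplex_apply_of_im_pos hw]
  rintro U φ ⟨⟨-, hinj, hdiff⟩, R, hR, hRU⟩
  have hmono : ∀ {x y : ℝ}, Real.tanh (x / 2) ≤ Real.tanh (y / 2) ↔ x ≤ y := fun {x y} => by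
    rw [← not_lt, tanh_lt_tanh_iff, not_lt, div_le_div_iff_of_pos_right two_pos]
  have hlt : ∀ {w : ℂ}, w ∈ Metric.closedBall (0 : ℂ) (Real.tanh (R / 2)) → ‖w‖ < 1 :=
    fun hw => (mem_closedBall_zero_iff.1 hw).trans_lt (Real.tanh_lt_one _)
  have hU : ∀ {w : ℂ} (hw : w ∈ Metric.closedBall (0 : ℂ) (Real.tanh (R / 2))),
      (⟨ξ.undisk w, ξ.undisk_im_pos (hlt hw)⟩ : UpperHalfPlane) ∈ U := fun {w} hw => by
    refine hRU _ (hmono.1 ?_)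
    rw [← norm_disk, disk_undisk _ (hlt hw)]
    exact mem_closedBall_zero_iff.1 hw
  have hcomp : ∀ {w : ℂ} (hw : ‖w‖ < 1), (φ ∘ UpperHalfPlane.ofComplex) (ξ.undisk w) =
      φ ⟨ξ.undisk w, ξ.undisk_im_pos hw⟩ := fun {w} hw => by
    rw [Function.comp, UpperHalfPlane.ofComplex_apply_of_im_pos (ξ.undisk_im_pos hw)]
  have hundisk : ∀ p : UpperHalfPlane, (φ ∘ UpperHalfPlane.ofComplex) (ξ.undisk (ξ.disk p)) =
      φ p := fun p => by
    rw [hcomp (ξ.norm_disk_lt p)]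
    congr 1
    exact ξ.disk_injective (disk_undisk _ (ξ.norm_disk_lt p))
  have key := h.comp_chart (f := fun w => (φ ∘ UpperHalfPlane.ofComplex) (ξ.undisk w)) hc
    (ρ := Real.tanh (R / 2)) (fun t ht => by rw [norm_disk]; exact hmono.2 (hR t ht))
    (fun w hw => ?_) (fun w hw w' hw' hww => ?_)
  · refine key.congr fun t _ => ?_
    rw [hundisk, ← ξ.disk_pt, hundisk]
  · have h1 : DifferentiableAt ℂ ξ.undisk w := by
      have hd := ξ.undisk_den_ne_zero (hlt hw)
      unfold HypUnitTangent.undisk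
      fun_prop (disch := assumption)
    exact DifferentiableAt.comp (g := φ ∘ UpperHalfPlane.ofComplex) w (hdiff _ (hU hw)) h1
  · simp only [hcomp (hlt hw), hcomp (hlt hw')] at hww
    have := congrArg ξ.disk (hinj (hU hw) (hU hw') hww)
    rwa [disk_undisk _ (hlt hw), disk_undisk _ (hlt hw')] at this

/-- The distance of the end of a two-joint arm in the hyperbolic plane is finite. -/
theorem norm_twoJoint_neg_one_lt {a b c : ℝ} (H : IsTriangleData (-1) a b c) (x : ℝ) :
    ‖twoJoint (-1) b c x‖ < 1 := by
  have h1 := H.sq_norm_twoJoint x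
  have h2 := (H.sq_norm_sub x).1
  have h3 : 0 < (1 - ‖twoJoint (-1) b c x‖ ^ 2) *
      (1 + b ^ 2 * c ^ 2 - 2 * (-1) * b * c * Real.cos x) := by
    have := mul_pos (by linarith [H.one_add_b] : 0 < 1 - b ^ 2)
      (by linarith [H.one_add_c] : 0 < 1 - c ^ 2)
    rw [sub_mul, h1]
    linarith
  have h4 := pos_of_mul_pos_left h3 h2.le
  nlinarith [norm_nonneg (twoJoint (-1) b c x)]

theorem hypArm_hasAngularVelocity {l ω : Fin 3 → ℝ} (hl : ∀ j, 0 < l j)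
    (h0 : l 0 < l 1 + l 2) (h1 : l 1 < l 2 + l 0) (h2 : l 2 < l 0 + l 1)
    (hω : LinearIndependent ℚ ω) (ξ : HypUnitTangent) (θ : Fin 3 → ℝ) :
    HypHasAngularVelocity ξ.pt (fun t : ℝ => hypArm ξ l (fun j => θ j + ω j * t))
      (ω 0 + (Real.pi - triangleAngles (-1) (fun j => Real.tanh (l j / 2)) 0) / Real.pi * ω 1 +
        triangleAngles (-1) (fun j => Real.tanh (l j / 2)) 2 / Real.pi * ω 2) := by
  have H := isTriangleData_tanh (half_pos (hl 0)) (half_pos (hl 1)) (half_pos (hl 2))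
    (by linarith) (by linarith) (by linarith)
  obtain ⟨hω2, hirr⟩ := irrational_div_of_linearIndependent hω
  have hlt := norm_twoJoint_neg_one_lt H
  have hden : ∀ x, Real.tanh (l 0 / 2) *
      ‖twoJoint (-1) (Real.tanh (l 1 / 2)) (Real.tanh (l 2 / 2)) x‖ < 1 := fun x =>
    mul_lt_one_of_nonneg_of_lt_one_left H.a_pos.le (Real.tanh_lt_one _) (hlt x).le
  have key := H.hasAngularVelocity (a := fun j => Real.tanh (l j / 2)) hden (θ := θ) hω2 hirr
  refine HypHasAngularVelocity.of_disk (fun t _ => dist_hypArm_le ξ hl _) ?_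
    (key.congr fun t _ => disk_hypArm ξ l _)
  simp only [disk_hypArm]
  exact (H.continuous_armCoord (a := fun j => Real.tanh (l j / 2)) hden θ ω).continuousOn

end SwivelingArm

namespace SwivelingArm

open Filter Topology Real

/-! ### The sphere: frames and stereographic coordinates -/

namespace SphUnitTangent

/-- The vector with the coordinates `a`, `b`, `c` in the positively oriented orthonormal frame that
consists of the direction of `ξ`, this direction turned by a right angle, and the outward normal. -/
noncomputable def comb (ξ : SphUnitTangent) (a b c : ℝ) : E3 :=
  a • ξ.vec + b • cross ξ.pt ξ.vec + c • ξ.pt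

theorem cross_add_left (p q v : E3) : cross (p + q) v = cross p v + cross q v := by
  simp [cross]

theorem cross_smul_left (a : ℝ) (p v : E3) : cross (a • p) v = a • cross p v := by
  simp [cross]

theorem cross_neg_swap (p v : E3) : cross p v = -cross v p := by
  rw [cross, cross, ← cross_anticomm]; exact WithLp.toLp_neg ..

theorem cross_add_right (p v w : E3) : cross p (v + w) = cross p v + cross p w := by
  simp [cross]

theorem cross_smul_right (a : ℝ) (p v : E3) : cross p (a • v) = a • cross p v := by
  simp [cross]

theorem cross_self_eq_zero (p : E3) : cross p p = 0 := by
  simp [cross]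

theorem cross_cross_self (p v : E3) :
    cross p (cross p v) = inner ℝ p v • p - inner ℝ p p • v := by
  ext i; fin_cases i <;>
  · simp only [cross, PiLp.inner_apply, Fin.sum_univ_three, cross_apply, RCLike.inner_apply,
      conj_trivial, Matrix.cons_val, PiLp.sub_apply, PiLp.smul_apply, smul_eq_mul, Fin.zero_eta,
      Fin.mk_one, Fin.reduceFinMk]
    ring

variable (ξ : SphUnitTangent)

theorem inner_pt_pt : inner ℝ ξ.pt ξ.pt = 1 := by
  rw [real_inner_self_eq_norm_sq, ξ.norm_pt, one_pow]

theorem inner_vec_vec : inner ℝ ξ.vec ξ.vec = 1 := by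
  rw [real_inner_self_eq_norm_sq, ξ.norm_vec, one_pow]

theorem inner_vec_pt : inner ℝ ξ.vec ξ.pt = 0 := by
  rw [real_inner_comm, ξ.inner_eq]

theorem cross_pt_normal : cross ξ.pt (cross ξ.pt ξ.vec) = -ξ.vec := by
  rw [cross_cross_self, ξ.inner_eq, ξ.inner_pt_pt]; simp

theorem cross_vec_normal : cross ξ.vec (cross ξ.pt ξ.vec) = ξ.pt := by
  rw [cross_neg_swap ξ.pt, ← neg_one_smul ℝ, cross_smul_right, cross_cross_self, ξ.inner_vec_pt,
    ξ.inner_vec_vec]; simp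

theorem inner_comb (a b c a' b' c' : ℝ) :
    inner ℝ (ξ.comb a b c) (ξ.comb a' b' c') = a * a' + b * b' + c * c' := by
  have h1 := cross_inner_left ξ.pt ξ.vec
  have h2 := cross_inner_right ξ.pt ξ.vec
  have h3 : inner ℝ (cross ξ.pt ξ.vec) (cross ξ.pt ξ.vec) = (1 : ℝ) := by
    rw [real_inner_self_eq_norm_sq, ξ.norm_cross, one_pow]
  have h1' := h1
  have h2' := h2
  rw [real_inner_comm] at h1' h2'
  simp only [comb, inner_add_left, inner_add_right, inner_smul_left, inner_smul_right, h1, h2, h3,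
    h1', h2', ξ.inner_eq, ξ.inner_vec_pt, ξ.inner_pt_pt, ξ.inner_vec_vec, conj_trivial]
  ring

theorem cross_comb (a b c a' b' c' : ℝ) :
    cross (ξ.comb a b c) (ξ.comb a' b' c') =
      ξ.comb (b * c' - c * b') (c * a' - a * c') (a * b' - b * a') := by
  have h1 := ξ.cross_pt_normal
  have h2 := ξ.cross_vec_normal
  have h3 := cross_neg_swap ξ.vec ξ.pt
  have h4 := cross_neg_swap (cross ξ.pt ξ.vec) ξ.pt
  have h5 := cross_neg_swap (cross ξ.pt ξ.vec) ξ.vec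
  rw [h1, neg_neg] at h4
  rw [h2] at h5
  simp only [comb, cross_add_left, cross_add_right, cross_smul_left, cross_smul_right,
      cross_self_eq_zero, h1, h2, h3, h4, h5]
  module

theorem norm_comb {a b c : ℝ} (h : a ^ 2 + b ^ 2 + c ^ 2 = 1) : ‖ξ.comb a b c‖ = 1 := by
  have h1 := ξ.inner_comb a b c a b c
  rw [real_inner_self_eq_norm_sq] at h1
  have h2 : ‖ξ.comb a b c‖ ^ 2 = 1 := by rw [h1]; linarith
  nlinarith [norm_nonneg (ξ.comb a b c)]

theorem comb_rotate (θ a b c : ℝ) : (ξ.rotate θ).comb a b c =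
    ξ.comb (cos θ * a - sin θ * b) (sin θ * a + cos θ * b) c := by
  have h : cross (ξ.rotate θ).pt (ξ.rotate θ).vec =
      cos θ • cross ξ.pt ξ.vec - sin θ • ξ.vec := by
    change cross ξ.pt (cos θ • ξ.vec + sin θ • cross ξ.pt ξ.vec) = _
    rw [cross_add_right, cross_smul_right, cross_smul_right, cross_pt_normal]
    module
  rw [comb, h, comb]
  change a • (cos θ • ξ.vec + sin θ • cross ξ.pt ξ.vec) + _ + c • ξ.pt = _
  module

theorem comb_flow (s a b c : ℝ) : (ξ.flow s).comb a b c =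
    ξ.comb (cos s * a + sin s * c) b (cos s * c - sin s * a) := by
  have h : cross (ξ.flow s).pt (ξ.flow s).vec = cross ξ.pt ξ.vec := by
    change cross (cos s • ξ.pt + sin s • ξ.vec) ((-sin s) • ξ.pt + cos s • ξ.vec) = _
    simp only [cross_add_left, cross_add_right, cross_smul_left, cross_smul_right,
      cross_self_eq_zero, cross_neg_swap ξ.vec ξ.pt]
    have := sin_sq_add_cos_sq s
    match_scalars
    linarith
  rw [comb, h, comb]
  change a • ((-sin s) • ξ.pt + cos s • ξ.vec) + _ + c • (cos s • ξ.pt + sin s • ξ.vec) = _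
  module

theorem eq_comb (p : E3) : p =
    ξ.comb (inner ℝ ξ.vec p) (inner ℝ (cross ξ.pt ξ.vec) p) (inner ℝ ξ.pt p) := by
  have hon : Orthonormal ℝ ![ξ.vec, cross ξ.pt ξ.vec, ξ.pt] := by
    have h1 := cross_inner_left ξ.pt ξ.vec
    have h2 := cross_inner_right ξ.pt ξ.vec
    have h1' := h1
    have h2' := h2
    rw [real_inner_comm] at h1' h2'
    refine ⟨fun i => ?_, fun i j hij => ?_⟩
    · fin_cases i
      exacts [ξ.norm_vec, ξ.norm_cross, ξ.norm_pt]
    · fin_cases i <;> fin_cases j <;>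
        first
        | exact absurd rfl hij
        | exact h1
        | exact h2
        | exact h1'
        | exact h2'
        | exact ξ.inner_eq
        | exact ξ.inner_vec_pt
  have hspan := hon.linearIndependent.span_eq_top_of_card_eq_finrank (by simp)
  have h := (OrthonormalBasis.mk hon hspan.ge).sum_repr' p
  rw [Fin.sum_univ_three] at h
  simp only [OrthonormalBasis.coe_mk, Matrix.cons_val] at h
  exact h.symm

/-- The point of the sphere with the stereographic coordinate `w`, for the projection from the
antipode of the base point of `ξ`; `ξ` points along the positive real axis. -/
noncomputable def ofStereo (w : ℂ) : E3 :=
  ξ.comb (2 * w.re / (1 + ‖w‖ ^ 2)) (2 * w.im / (1 + ‖w‖ ^ 2)) ((1 - ‖w‖ ^ 2) / (1 + ‖w‖ ^ 2))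

/-- The stereographic coordinate. -/
noncomputable def stereo (p : E3) : ℂ :=
  (inner ℝ ξ.vec p + inner ℝ (cross ξ.pt ξ.vec) p * Complex.I) / (1 + inner ℝ ξ.pt p)

theorem norm_sq_eq (w : ℂ) : ‖w‖ ^ 2 = w.re ^ 2 + w.im ^ 2 := by
  rw [← Complex.normSq_eq_norm_sq, Complex.normSq_apply]; ring

theorem norm_ofStereo (w : ℂ) : ‖ξ.ofStereo w‖ = 1 := by
  refine ξ.norm_comb ?_
  have h : 1 + ‖w‖ ^ 2 ≠ 0 := by positivity
  field_simp
  linear_combination (-4) * norm_sq_eq w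

theorem ofStereo_zero : ξ.ofStereo 0 = ξ.pt := by
  simp [ofStereo, comb]

theorem pt_eq_comb : ξ.pt = ξ.comb 0 0 1 := by simp [comb]
theorem vec_eq_comb : ξ.vec = ξ.comb 1 0 0 := by simp [comb]
theorem cross_eq_comb : cross ξ.pt ξ.vec = ξ.comb 0 1 0 := by simp [comb]

theorem inner_pt_comb (a b c : ℝ) : inner ℝ ξ.pt (ξ.comb a b c) = c := by
  conv_lhs => rw [ξ.pt_eq_comb]
  rw [inner_comb]; ring

theorem inner_vec_comb (a b c : ℝ) : inner ℝ ξ.vec (ξ.comb a b c) = a := by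
  conv_lhs => rw [ξ.vec_eq_comb]
  rw [inner_comb]; ring

theorem inner_cross_comb (a b c : ℝ) : inner ℝ (cross ξ.pt ξ.vec) (ξ.comb a b c) = b := by
  conv_lhs => rw [ξ.cross_eq_comb]
  rw [inner_comb]; ring

theorem stereo_ofStereo (w : ℂ) : ξ.stereo (ξ.ofStereo w) = w := by
  have h : (1 : ℝ) + ‖w‖ ^ 2 ≠ 0 := by positivity
  rw [stereo, ofStereo, inner_vec_comb, inner_cross_comb, inner_pt_comb]
  have e : (1 : ℝ) + (1 - ‖w‖ ^ 2) / (1 + ‖w‖ ^ 2) = 2 / (1 + ‖w‖ ^ 2) := by field_simp; ring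
  have e' : (1 : ℂ) + (((1 - ‖w‖ ^ 2) / (1 + ‖w‖ ^ 2) : ℝ) : ℂ) =
      ((2 / (1 + ‖w‖ ^ 2) : ℝ) : ℂ) := by
    rw [← e]; push_cast; ring
  have h' : (1 : ℂ) + (‖w‖ : ℂ) ^ 2 ≠ 0 := by exact_mod_cast h
  rw [e']
  conv_rhs => rw [← Complex.re_add_im w]
  push_cast
  field_simp

theorem ofStereo_stereo {p : E3} (hp : ‖p‖ = 1) (h : -1 < inner ℝ ξ.pt p) :
    ξ.ofStereo (ξ.stereo p) = p := by
  have hc := ξ.eq_comb p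
  have hn := ξ.inner_comb (inner ℝ ξ.vec p) (inner ℝ (cross ξ.pt ξ.vec) p) (inner ℝ ξ.pt p)
    (inner ℝ ξ.vec p) (inner ℝ (cross ξ.pt ξ.vec) p) (inner ℝ ξ.pt p)
  rw [← hc, real_inner_self_eq_norm_sq, hp] at hn
  rw [stereo, ofStereo, norm_sq_eq]
  conv_rhs => rw [hc]
  generalize inner ℝ ξ.vec p = a at *
  generalize inner ℝ (cross ξ.pt ξ.vec) p = b at *
  generalize inner ℝ ξ.pt p = c at *
  have hc1 : 1 + c ≠ 0 := by linarith
  have e : ((a : ℂ) + b * Complex.I) / (1 + c) = ((a / (1 + c) : ℝ) : ℂ) +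
      ((b / (1 + c) : ℝ) : ℂ) * Complex.I := by push_cast; ring
  have hre : (((a : ℂ) + b * Complex.I) / (1 + c)).re = a / (1 + c) := by
    rw [e, Complex.add_re, Complex.ofReal_re, Complex.re_ofReal_mul, Complex.I_re]; ring
  have him : (((a : ℂ) + b * Complex.I) / (1 + c)).im = b / (1 + c) := by
    rw [e, Complex.add_im, Complex.ofReal_im, Complex.im_ofReal_mul, Complex.I_im]; ring
  rw [hre, him]
  have hs : 1 + ((a / (1 + c)) ^ 2 + (b / (1 + c)) ^ 2) = 2 / (1 + c) := by
    field_simp; linarith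
  have hs' : 1 - ((a / (1 + c)) ^ 2 + (b / (1 + c)) ^ 2) = 2 * c / (1 + c) := by
    field_simp; linarith
  rw [hs, hs']
  congr 1 <;> field_simp

theorem sphDist_ofStereo (w : ℂ) : sphDist ξ.pt (ξ.ofStereo w) = 2 * arctan ‖w‖ := by
  rw [sphDist, InnerProductGeometry.angle, ξ.norm_pt, norm_ofStereo, mul_one, div_one, ofStereo,
    inner_pt_comb]
  have h1 : cos (2 * arctan ‖w‖) = (1 - ‖w‖ ^ 2) / (1 + ‖w‖ ^ 2) := by
    rw [cos_two_mul, cos_sq_arctan]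
    field_simp
    ring
  rw [← h1, arccos_cos (by have := arctan_nonneg.2 (norm_nonneg w); positivity)
    (by linarith [arctan_lt_pi_div_two ‖w‖])]

theorem ofStereo_rotate (θ : ℝ) (w : ℂ) :
    (ξ.rotate θ).ofStereo w = ξ.ofStereo (Complex.exp (θ * Complex.I) * w) := by
  rw [ofStereo, comb_rotate, ofStereo, norm_mul, Complex.norm_exp_ofReal_mul_I, one_mul,
    Complex.mul_re, Complex.mul_im, Complex.exp_ofReal_mul_I_re, Complex.exp_ofReal_mul_I_im]
  congr 1 <;> ring

theorem ofStereo_div (n : ℂ) {d : ℂ} (hd : d ≠ 0) : ξ.ofStereo (n / d) =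
    ξ.comb (2 * (n.re * d.re + n.im * d.im) / (n.re ^ 2 + n.im ^ 2 + (d.re ^ 2 + d.im ^ 2)))
      (2 * (n.im * d.re - n.re * d.im) / (n.re ^ 2 + n.im ^ 2 + (d.re ^ 2 + d.im ^ 2)))
      ((d.re ^ 2 + d.im ^ 2 - (n.re ^ 2 + n.im ^ 2)) /
        (n.re ^ 2 + n.im ^ 2 + (d.re ^ 2 + d.im ^ 2))) := by
  have h0 : 0 < d.re ^ 2 + d.im ^ 2 := by
    have := Complex.normSq_pos.2 hd
    rw [Complex.normSq_apply] at this
    linarith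
  have h1 : 0 < n.re ^ 2 + n.im ^ 2 + (d.re ^ 2 + d.im ^ 2) := by positivity
  have e : 1 + ‖n / d‖ ^ 2 =
      (n.re ^ 2 + n.im ^ 2 + (d.re ^ 2 + d.im ^ 2)) / (d.re ^ 2 + d.im ^ 2) := by
    rw [norm_div, div_pow, norm_sq_eq, norm_sq_eq]
    field_simp
    ring
  have e' : 1 - ‖n / d‖ ^ 2 =
      (d.re ^ 2 + d.im ^ 2 - (n.re ^ 2 + n.im ^ 2)) / (d.re ^ 2 + d.im ^ 2) := by
    rw [norm_div, div_pow, norm_sq_eq, norm_sq_eq]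
    field_simp
  have e3 : Complex.normSq d = d.re ^ 2 + d.im ^ 2 := by rw [Complex.normSq_apply]; ring
  rw [ofStereo, e, e', Complex.div_re, Complex.div_im, e3]
  congr 1 <;> field_simp

/-- Moving the base point along a geodesic changes the stereographic coordinate by the rotation of
the sphere with the half-length coordinate `tan (s / 2)`. -/
theorem ofStereo_flow {s : ℝ} (hs : cos (s / 2) ≠ 0) {w : ℂ}
    (hw : 1 - (tan (s / 2) : ℂ) * w ≠ 0) :
    (ξ.flow s).ofStereo w = ξ.ofStereo ((tan (s / 2) + w) / (1 - tan (s / 2) * w)) := by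
  have e1 : cos s = cos (s / 2) ^ 2 - sin (s / 2) ^ 2 := by
    rw [← cos_two_mul', mul_div_cancel₀ _ two_ne_zero]
  have e2 : sin s = 2 * sin (s / 2) * cos (s / 2) := by
    rw [← sin_two_mul, mul_div_cancel₀ _ two_ne_zero]
  have e3 := sin_sq_add_cos_sq (s / 2)
  have hs' : (cos (s / 2) : ℂ) ≠ 0 := by exact_mod_cast hs
  have ht : (tan (s / 2) : ℂ) = sin (s / 2) / cos (s / 2) := by
    rw [tan_eq_sin_div_cos, Complex.ofReal_div]
  have hd : (cos (s / 2) : ℂ) - sin (s / 2) * w ≠ 0 := by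
    rw [ht] at hw
    intro h
    refine hw ?_
    rw [div_mul_eq_mul_div, one_sub_div hs', h, zero_div]
  have hq : ((tan (s / 2) : ℂ) + w) / (1 - tan (s / 2) * w) =
      (sin (s / 2) + cos (s / 2) * w) / (cos (s / 2) - sin (s / 2) * w) := by
    rw [div_eq_div_iff hw hd, ht]
    field_simp
  have h0 : 1 + (w.re ^ 2 + w.im ^ 2) ≠ 0 := by positivity
  rw [hq, ofStereo_div _ _ hd, ofStereo, comb_flow, e1, e2, norm_sq_eq]
  simp only [Complex.add_re, Complex.add_im, Complex.sub_re, Complex.sub_im,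
    Complex.re_ofReal_mul, Complex.im_ofReal_mul, Complex.ofReal_re, Complex.ofReal_im]
  generalize cos (s / 2) = c at *
  generalize sin (s / 2) = d at *
  have e4 : (d + c * w.re) ^ 2 + (0 + c * w.im) ^ 2 +
      ((c - d * w.re) ^ 2 + (0 - d * w.im) ^ 2) = 1 + (w.re ^ 2 + w.im ^ 2) := by
    linear_combination (1 + w.re ^ 2 + w.im ^ 2) * e3
  rw [e4]
  congr 1
  · field_simp
    ring
  · field_simp
    linear_combination -w.im * e3
  · field_simp
    ring

theorem ofStereo_hasFDerivAt (w : ℂ) : ∃ E' : ℂ →L[ℝ] E3, HasFDerivAt ξ.ofStereo E' w ∧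
    inner ℝ (ξ.ofStereo w) (E' 1) = 0 ∧ E' Complex.I = cross (ξ.ofStereo w) (E' 1) := by
  have hs : ∀ w : ℂ, 1 + (w.re ^ 2 + w.im ^ 2) ≠ 0 := fun w => by positivity
  have hd : DifferentiableAt ℝ ξ.ofStereo w := by
    have h : ξ.ofStereo = fun w : ℂ => ξ.comb
        (2 * Complex.reCLM w / (1 + (Complex.reCLM w ^ 2 + Complex.imCLM w ^ 2)))
        (2 * Complex.imCLM w / (1 + (Complex.reCLM w ^ 2 + Complex.imCLM w ^ 2)))
        ((1 - (Complex.reCLM w ^ 2 + Complex.imCLM w ^ 2)) /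
          (1 + (Complex.reCLM w ^ 2 + Complex.imCLM w ^ 2))) := by
      funext w
      rw [ofStereo, norm_sq_eq]
      rfl
    have hw : 1 + (Complex.reCLM w ^ 2 + Complex.imCLM w ^ 2) ≠ 0 := hs w
    rw [h]
    unfold comb
    fun_prop (disch := assumption)
  have key : ∀ u : ℂ, fderiv ℝ ξ.ofStereo w u = ξ.comb
      ((2 * u.re * (1 + (w.re ^ 2 + w.im ^ 2)) - 2 * w.re * (2 * w.re * u.re + 2 * w.im * u.im)) /
        (1 + (w.re ^ 2 + w.im ^ 2)) ^ 2)
      ((2 * u.im * (1 + (w.re ^ 2 + w.im ^ 2)) - 2 * w.im * (2 * w.re * u.re + 2 * w.im * u.im)) /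
        (1 + (w.re ^ 2 + w.im ^ 2)) ^ 2)
      ((-(2 * w.re * u.re + 2 * w.im * u.im) * (1 + (w.re ^ 2 + w.im ^ 2)) -
        (1 - (w.re ^ 2 + w.im ^ 2)) * (2 * w.re * u.re + 2 * w.im * u.im)) /
        (1 + (w.re ^ 2 + w.im ^ 2)) ^ 2) := fun u => by
    have hl := hd.hasFDerivAt.hasLineDerivAt u
    refine HasDerivAt.unique hl ?_
    have hx : HasDerivAt (fun t : ℝ => w.re + t * u.re) u.re 0 := by
      simpa using ((hasDerivAt_id (0 : ℝ)).mul_const u.re).const_add w.re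
    have hy : HasDerivAt (fun t : ℝ => w.im + t * u.im) u.im 0 := by
      simpa using ((hasDerivAt_id (0 : ℝ)).mul_const u.im).const_add w.im
    have hr : HasDerivAt (fun t : ℝ => (w.re + t * u.re) ^ 2 + (w.im + t * u.im) ^ 2)
        (2 * w.re * u.re + 2 * w.im * u.im) 0 :=
      ((hx.pow 2).add (hy.pow 2)).congr_deriv (by simp)
    have h0 : 1 + ((w.re + 0 * u.re) ^ 2 + (w.im + 0 * u.im) ^ 2) ≠ 0 := by positivity
    have h1 := (((hx.const_mul 2).div (hr.const_add 1) h0).smul_const ξ.vec).add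
      (((hy.const_mul 2).div (hr.const_add 1) h0).smul_const (cross ξ.pt ξ.vec))
    have h2 := h1.add (((hr.const_sub 1).div (hr.const_add 1) h0).smul_const ξ.pt)
    simp only [zero_mul, add_zero] at h2
    refine (h2.congr_of_eventuallyEq (Eventually.of_forall fun t => ?_))
    simp only [ofStereo, comb, norm_sq_eq, Complex.add_re, Complex.add_im, Complex.real_smul,
      Complex.re_ofReal_mul, Complex.im_ofReal_mul]
    rfl
  refine ⟨fderiv ℝ ξ.ofStereo w, hd.hasFDerivAt, ?_, ?_⟩
  · rw [key, ofStereo, inner_comb, norm_sq_eq]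
    have := hs w
    simp only [Complex.one_re, Complex.one_im]
    field_simp
    ring
  · rw [key, key, ofStereo, cross_comb, norm_sq_eq]
    have := hs w
    simp only [Complex.one_re, Complex.one_im, Complex.I_re, Complex.I_im]
    congr 1 <;> field_simp <;> ring

end SphUnitTangent

open SphUnitTangent

/-! ### The spherical arm -/

theorem cos_half_pos {x : ℝ} (h0 : 0 ≤ x) (h1 : x < π) : 0 < cos (x / 2) :=
  cos_pos_of_mem_Ioo ⟨by linarith [pi_pos], by linarith⟩

theorem cos_mul_one_add_tan_half_sq {x : ℝ} (h : cos (x / 2) ≠ 0) :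
    cos x * (1 + tan (x / 2) ^ 2) = 1 - tan (x / 2) ^ 2 := by
  have e : cos x = cos (x / 2) ^ 2 - sin (x / 2) ^ 2 := by
    rw [← cos_two_mul', mul_div_cancel₀ _ two_ne_zero]
  have := sin_sq_add_cos_sq (x / 2)
  rw [e, tan_eq_sin_div_cos]
  field_simp
  linear_combination (cos (x / 2) ^ 2 - sin (x / 2) ^ 2) * this

theorem sin_mul_one_add_tan_half_sq {x : ℝ} (h : cos (x / 2) ≠ 0) :
    sin x * (1 + tan (x / 2) ^ 2) = 2 * tan (x / 2) := by
  have e : sin x = 2 * sin (x / 2) * cos (x / 2) := by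
    rw [← sin_two_mul, mul_div_cancel₀ _ two_ne_zero]
  have := sin_sq_add_cos_sq (x / 2)
  rw [e, tan_eq_sin_div_cos]
  field_simp
  linear_combination sin (x / 2) * this

theorem tan_add_mul_one_sub {x y : ℝ} (hx : cos x ≠ 0) (hy : cos y ≠ 0) (h : cos (x + y) ≠ 0) :
    tan (x + y) * (1 - tan x * tan y) = tan x + tan y := by
  rw [tan_eq_sin_div_cos, tan_eq_sin_div_cos, tan_eq_sin_div_cos]
  field_simp
  rw [sin_add, cos_add]
  ring

theorem tan_mul_tan_lt_one {x y : ℝ} (hx : 0 < x) (hy : 0 < y) (h : x + y < π / 2) :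
    tan x * tan y < 1 := by
  have h1 : 0 < cos x := cos_pos_of_mem_Ioo ⟨by linarith, by linarith⟩
  have h2 : 0 < cos y := cos_pos_of_mem_Ioo ⟨by linarith, by linarith⟩
  have h3 : 0 < cos (x + y) := cos_pos_of_mem_Ioo ⟨by linarith, by linarith⟩
  rw [cos_add] at h3
  rw [tan_eq_sin_div_cos, tan_eq_sin_div_cos, div_mul_div_comm, div_lt_one (by positivity)]
  linarith

theorem tan_mul_lt_add {x y z : ℝ} (hx : 0 < x) (hy : 0 < y) (hz : 0 < z) (hxy : x + y < π / 2)
    (h : z < x + y) : tan z * (1 - tan x * tan y) < tan x + tan y := by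
  have h1 : 0 < cos x := cos_pos_of_mem_Ioo ⟨by linarith, by linarith⟩
  have h2 : 0 < cos y := cos_pos_of_mem_Ioo ⟨by linarith, by linarith⟩
  have h3 : 0 < cos (x + y) := cos_pos_of_mem_Ioo ⟨by linarith, by linarith⟩
  rw [← tan_add_mul_one_sub h1.ne' h2.ne' h3.ne']
  exact mul_lt_mul_of_pos_right (tan_lt_tan_of_lt_of_lt_pi_div_two (by linarith) hxy h)
    (sub_pos.2 (tan_mul_tan_lt_one hx hy hxy))

theorem isTriangleData_tan {x y z : ℝ} (hx : 0 < x) (hy : 0 < y) (hz : 0 < z)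
    (hs : x + y + z < π / 2) (h1 : x < y + z) (h2 : y < z + x) (h3 : z < x + y) :
    IsTriangleData 1 (tan x) (tan y) (tan z) where
  sq_eq := one_pow 2
  a_pos := tan_pos_of_pos_of_lt_pi_div_two hx (by linarith)
  b_pos := tan_pos_of_pos_of_lt_pi_div_two hy (by linarith)
  c_pos := tan_pos_of_pos_of_lt_pi_div_two hz (by linarith)
  ab_lt := tan_mul_tan_lt_one hx hy (by linarith)
  bc_lt := tan_mul_tan_lt_one hy hz (by linarith)
  one_add_a := by positivity
  one_add_b := by positivity
  one_add_c := by positivity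
  lt_a := by rw [one_mul]; exact tan_mul_lt_add hy hz hx (by linarith) h1
  lt_b := by rw [one_mul]; exact tan_mul_lt_add hz hx hy (by linarith) h2
  lt_c := by rw [one_mul]; exact tan_mul_lt_add hx hy hz (by linarith) h3

/-- The end of a spherical arm of total length less than `π` stays away from the antipode of its
start. -/
theorem tan_mul_norm_twoJoint_lt {x y z : ℝ} (hx : 0 < x) (hy : 0 < y) (hz : 0 < z)
    (hs : x + y + z < π / 2) (C : ℝ) : tan x * ‖twoJoint 1 (tan y) (tan z) C‖ < 1 := by
  have px := tan_pos_of_pos_of_lt_pi_div_two hx (by linarith)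
  have py := tan_pos_of_pos_of_lt_pi_div_two hy (by linarith)
  have pz := tan_pos_of_pos_of_lt_pi_div_two hz (by linarith)
  have hyz := tan_mul_tan_lt_one hy hz (by linarith)
  have hx2 := tan_mul_tan_lt_one hx (add_pos hy hz) (by linarith)
  have c1 : 0 < cos y := cos_pos_of_mem_Ioo ⟨by linarith, by linarith⟩
  have c2 : 0 < cos z := cos_pos_of_mem_Ioo ⟨by linarith, by linarith⟩
  have c3 : 0 < cos (y + z) := cos_pos_of_mem_Ioo ⟨by linarith, by linarith⟩
  have hadd := tan_add_mul_one_sub c1.ne' c2.ne' c3.ne'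
  have hnum : ‖(tan y : ℂ) + tan z * Complex.exp (C * Complex.I)‖ ≤ tan y + tan z := by
    refine (norm_add_le _ _).trans ?_
    rw [norm_mul, Complex.norm_exp_ofReal_mul_I, Complex.norm_real, Complex.norm_real,
      norm_of_nonneg py.le, norm_of_nonneg pz.le, mul_one]
  have hden : 1 - tan y * tan z ≤
      ‖1 - ((1 : ℝ) : ℂ) * tan y * tan z * Complex.exp (C * Complex.I)‖ := by
    refine le_trans (le_of_eq ?_) (norm_sub_norm_le _ _)
    rw [norm_mul, Complex.norm_exp_ofReal_mul_I, norm_mul, norm_mul, Complex.norm_real,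
      Complex.norm_real, Complex.norm_real, norm_of_nonneg py.le, norm_of_nonneg pz.le]
    simp
  have hpos : 0 < 1 - tan y * tan z := sub_pos.2 hyz
  have hle : ‖twoJoint 1 (tan y) (tan z) C‖ ≤ tan (y + z) := by
    rw [twoJoint, norm_div, div_le_iff₀ (hpos.trans_le hden)]
    refine hnum.trans ?_
    rw [← hadd]
    exact mul_le_mul_of_nonneg_left hden
      (tan_pos_of_pos_of_lt_pi_div_two (add_pos hy hz) (by linarith)).le
  exact (mul_le_mul_of_nonneg_left hle px.le).trans_lt hx2

theorem cos_sphDist {p q : E3} (hp : ‖p‖ = 1) (hq : ‖q‖ = 1) :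
    cos (sphDist p q) = inner ℝ p q := by
  rw [sphDist, InnerProductGeometry.cos_angle, hp, hq, mul_one, div_one]

theorem sphDist_flow_pt (ξ : SphUnitTangent) {s : ℝ} (h0 : 0 ≤ s) (h1 : s ≤ π) :
    sphDist ξ.pt (ξ.flow s).pt = s := by
  refine injOn_cos ⟨InnerProductGeometry.angle_nonneg _ _, InnerProductGeometry.angle_le_pi _ _⟩
    ⟨h0, h1⟩ ?_
  change cos (sphDist _ _) = _
  rw [cos_sphDist ξ.norm_pt (ξ.flow s).norm_pt]
  change inner ℝ ξ.pt (cos s • ξ.pt + sin s • ξ.vec) = _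
  rw [inner_add_right, inner_smul_right, inner_smul_right, ξ.inner_eq, ξ.inner_pt_pt]
  ring

theorem sphDist_comm (p q : E3) : sphDist p q = sphDist q p :=
  InnerProductGeometry.angle_comm _ _

theorem sphDist_sphArm_le (ξ : SphUnitTangent) {l : Fin 3 → ℝ} (hl : ∀ j, 0 < l j)
    (hs : l 0 + l 1 + l 2 < π) (θ : Fin 3 → ℝ) :
    sphDist ξ.pt (sphArm ξ l θ) ≤ l 0 + l 1 + l 2 := by
  have p0 := hl 0
  have p1 := hl 1
  have p2 := hl 2
  set ξ₁ := (ξ.rotate (θ 0)).flow (l 0)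
  set ξ₂ := (ξ₁.rotate (θ 1)).flow (l 1)
  have d1 : sphDist ξ.pt ξ₁.pt = l 0 :=
    sphDist_flow_pt (ξ.rotate (θ 0)) p0.le (by linarith)
  have d2 : sphDist ξ₁.pt ξ₂.pt = l 1 :=
    sphDist_flow_pt (ξ₁.rotate (θ 1)) p1.le (by linarith)
  have d3 : sphDist ξ₂.pt (sphArm ξ l θ) = l 2 :=
    sphDist_flow_pt (ξ₂.rotate (θ 2)) p2.le (by linarith)
  have t1 : sphDist ξ.pt (sphArm ξ l θ) ≤ sphDist ξ.pt ξ₁.pt + sphDist ξ₁.pt (sphArm ξ l θ) :=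
    InnerProductGeometry.angle_le_angle_add_angle _ _ _
  have t2 : sphDist ξ₁.pt (sphArm ξ l θ) ≤ sphDist ξ₁.pt ξ₂.pt + sphDist ξ₂.pt (sphArm ξ l θ) :=
    InnerProductGeometry.angle_le_angle_add_angle _ _ _
  linarith

theorem ofStereo_armCoord (ξ : SphUnitTangent) {l : Fin 3 → ℝ} (hl : ∀ j, 0 < l j)
    (hs : l 0 + l 1 + l 2 < π)
    (H : IsTriangleData 1 (tan (l 0 / 2)) (tan (l 1 / 2)) (tan (l 2 / 2))) (θ : Fin 3 → ℝ) :
    ξ.ofStereo (armCoord 1 (fun j => tan (l j / 2)) θ) = sphArm ξ l θ := by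
  have p0 := hl 0
  have p1 := hl 1
  have p2 := hl 2
  set ξ₁ := (ξ.rotate (θ 0)).flow (l 0) with h1
  set ξ₂ := (ξ₁.rotate (θ 1)).flow (l 1) with h2
  have c0 : cos (l 0 / 2) ≠ 0 := (cos_half_pos p0.le (by linarith)).ne'
  have c1 : cos (l 1 / 2) ≠ 0 := (cos_half_pos p1.le (by linarith)).ne'
  have c2 : cos (l 2 / 2) ≠ 0 := (cos_half_pos p2.le (by linarith)).ne'
  have hden := tan_mul_norm_twoJoint_lt (half_pos p0) (half_pos p1) (half_pos p2) (by linarith)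
  have n1 := H.re_armCoord_den_pos (a := fun j => tan (l j / 2)) hden (θ 1) (θ 2)
  have n2 := H.den_ne_zero (θ 2)
  have e3 : sphArm ξ l θ = (ξ₂.rotate (θ 2)).ofStereo (tan (l 2 / 2)) := by
    change ((ξ₂.rotate (θ 2)).flow (l 2)).pt = _
    rw [← ofStereo_zero, ofStereo_flow _ c2 (by simp)]
    simp
  have e2 : sphArm ξ l θ = (ξ₁.rotate (θ 1)).ofStereo
      (twoJoint 1 (tan (l 1 / 2)) (tan (l 2 / 2)) (θ 2)) := by
    have e : 1 - ((1 : ℝ) : ℂ) * tan (l 1 / 2) * tan (l 2 / 2) * Complex.exp (θ 2 * Complex.I) =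
        1 - tan (l 1 / 2) * (Complex.exp (θ 2 * Complex.I) * tan (l 2 / 2)) := by
      push_cast; ring
    rw [e] at n2
    rw [e3, ofStereo_rotate, h2, ofStereo_flow _ c1 n2, twoJoint, e,
      mul_comm (Complex.exp _) (tan (l 2 / 2) : ℂ)]
  have e1 : 1 - ((1 : ℝ) : ℂ) * tan (l 0 / 2) * (Complex.exp (θ 1 * Complex.I) *
        twoJoint 1 (tan (l 1 / 2)) (tan (l 2 / 2)) (θ 2)) =
      1 - tan (l 0 / 2) * (Complex.exp (θ 1 * Complex.I) *
        twoJoint 1 (tan (l 1 / 2)) (tan (l 2 / 2)) (θ 2)) := by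
    push_cast; ring
  have n1' : 1 - (tan (l 0 / 2) : ℂ) * (Complex.exp (θ 1 * Complex.I) *
      twoJoint 1 (tan (l 1 / 2)) (tan (l 2 / 2)) (θ 2)) ≠ 0 := fun h => by
    rw [e1, h] at n1
    exact lt_irrefl _ n1
  rw [e2, ofStereo_rotate ξ₁, h1, ofStereo_flow _ c0 n1', ofStereo_rotate, armCoord, e1]

/-! ### Spherical charts -/

theorem norm_eq_one_of_mem_S2 {p : E3} (hp : p ∈ S2) : ‖p‖ = 1 := mem_sphere_zero_iff_norm.1 hp

theorem neg_one_lt_inner_of_sphDist_lt {p q : E3} (hp : ‖p‖ = 1) (hq : ‖q‖ = 1)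
    (h : sphDist p q < π) : -1 < inner ℝ p q := by
  rw [← cos_sphDist hp hq, ← cos_pi]
  exact cos_lt_cos_of_nonneg_of_le_pi (InnerProductGeometry.angle_nonneg _ _) le_rfl h

/-- The differential of the stereographic coordinate turns `u ↦ p × u` into the multiplication
by `i`. -/
theorem stereo_hasFDerivAt (ξ : SphUnitTangent) {p : E3} (hp : ‖p‖ = 1)
    (h : -1 < inner ℝ ξ.pt p) : ∃ D : E3 →L[ℝ] ℂ, HasFDerivAt ξ.stereo D p ∧
      ∀ u : E3, inner ℝ p u = 0 → D (cross p u) = Complex.I * D u := by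
  have hM : (1 : ℂ) + ((inner ℝ ξ.pt p : ℝ) : ℂ) ≠ 0 := by
    have : (1 : ℝ) + inner ℝ ξ.pt p ≠ 0 := by linarith
    exact_mod_cast this
  have hd : DifferentiableAt ℝ ξ.stereo p := by
    have hi : ∀ v : E3, DifferentiableAt ℝ (fun q : E3 => ((inner ℝ v q : ℝ) : ℂ)) p := fun v =>
      (Complex.ofRealCLM.comp (innerSL ℝ v)).differentiableAt
    have h1 := hi ξ.vec
    have h2 := hi (cross ξ.pt ξ.vec)
    have h3 := hi ξ.pt
    have h4 : DifferentiableAt ℝ (fun q : E3 => (1 + ((inner ℝ ξ.pt q : ℝ) : ℂ))⁻¹) p :=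
      ((differentiableAt_inv (𝕜 := ℂ) hM).restrictScalars ℝ).comp p (h3.const_add 1)
    unfold SphUnitTangent.stereo
    simp only [div_eq_mul_inv]
    exact (h1.add (h2.mul_const _)).mul h4
  have key : ∀ u : E3, fderiv ℝ ξ.stereo p u =
      ((inner ℝ ξ.vec u + inner ℝ (cross ξ.pt ξ.vec) u * Complex.I) * (1 + inner ℝ ξ.pt p) -
        (inner ℝ ξ.vec p + inner ℝ (cross ξ.pt ξ.vec) p * Complex.I) * inner ℝ ξ.pt u) /
        (1 + inner ℝ ξ.pt p) ^ 2 := fun u => by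
    refine HasDerivAt.unique (hd.hasFDerivAt.hasLineDerivAt u) ?_
    have hi : ∀ v : E3, HasDerivAt (fun t : ℝ => ((inner ℝ v (p + t • u) : ℝ) : ℂ))
        ((inner ℝ v u : ℝ) : ℂ) 0 := fun v => by
      have : HasDerivAt (fun t : ℝ => inner ℝ v p + t * inner ℝ v u) (inner ℝ v u) 0 := by
        simpa using ((hasDerivAt_id (0 : ℝ)).mul_const (inner ℝ v u)).const_add (inner ℝ v p)
      simpa only [inner_add_right, inner_smul_right] using this.ofReal_comp
    have h3 := ((hi ξ.vec).add ((hi (cross ξ.pt ξ.vec)).mul_const Complex.I)).div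
      ((hi ξ.pt).const_add 1) (by simpa using hM)
    simp only [zero_smul, add_zero, Pi.add_apply] at h3
    exact h3
  refine ⟨_, hd.hasFDerivAt, fun u hu => ?_⟩
  rw [key, key, ← mul_div_assoc]
  congr 1
  have hpp : inner ℝ p p = (1 : ℝ) := by rw [real_inner_self_eq_norm_sq, hp, one_pow]
  rw [ξ.eq_comb p, ξ.eq_comb u, inner_comb] at hu
  rw [ξ.eq_comb p, inner_comb] at hpp
  rw [ξ.eq_comb p, ξ.eq_comb u, cross_comb]
  simp only [inner_vec_comb, inner_cross_comb, inner_pt_comb]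
  generalize inner ℝ ξ.vec p = a at *
  generalize inner ℝ (cross ξ.pt ξ.vec) p = b at *
  generalize inner ℝ ξ.pt p = c at *
  generalize inner ℝ ξ.vec u = a' at *
  generalize inner ℝ (cross ξ.pt ξ.vec) u = b' at *
  generalize inner ℝ ξ.pt u = c' at *
  refine Complex.ext ?_ ?_ <;>
    simp only [Complex.sub_re, Complex.sub_im, Complex.mul_re, Complex.mul_im, Complex.add_re,
      Complex.add_im, Complex.ofReal_re, Complex.ofReal_im, Complex.I_re, Complex.I_im,
      Complex.one_re, Complex.one_im]
  · linear_combination b * hu - b' * hpp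
  · linear_combination -a * hu + a' * hpp

theorem isSphChart_stereo (ξ : SphUnitTangent) :
    IsSphChart {p | -1 < inner ℝ ξ.pt p} ξ.stereo := by
  refine ⟨isOpen_lt continuous_const (by fun_prop), fun p hp q hq hpq => ?_, fun p hp => ?_⟩
  · rw [← ξ.ofStereo_stereo (norm_eq_one_of_mem_S2 hp.2) hp.1, hpq,
      ξ.ofStereo_stereo (norm_eq_one_of_mem_S2 hq.2) hq.1]
  · obtain ⟨D, hD, h⟩ := stereo_hasFDerivAt ξ (norm_eq_one_of_mem_S2 hp.2) hp.1
    exact ⟨D, hD.hasFDerivWithinAt, h⟩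

theorem SphHasAngularVelocity.of_stereo {ξ : SphUnitTangent} {z : ℝ → E3} {W : ℝ → ℂ} {a L : ℝ}
    (hLπ : L < π) (hL : ∀ t, 0 ≤ t → sphDist ξ.pt (z t) ≤ L) (hz : ∀ t, ξ.ofStereo (W t) = z t)
    (hc : ContinuousOn W (Set.Ici 0)) (h : HasAngularVelocity W a) :
    SphHasAngularVelocity ξ.pt z a := by
  refine ⟨⟨_, ξ.stereo, isSphChart_stereo ξ, L, hL, fun p hp hpL => ?_⟩, ?_⟩
  · exact neg_one_lt_inner_of_sphDist_lt ξ.norm_pt (norm_eq_one_of_mem_S2 hp)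
      (hpL.trans_lt hLπ)
  rintro U φ ⟨⟨-, hinj, hdiff⟩, R, hR, hRU⟩
  set r := min R L with hr
  have hr0 : 0 ≤ r := (InnerProductGeometry.angle_nonneg ξ.pt (z 0)).trans
    (le_min (hR 0 le_rfl) (hL 0 le_rfl))
  have hrπ : r < π := (min_le_right _ _).trans_lt hLπ
  have hS : ∀ w, ξ.ofStereo w ∈ S2 := fun w => mem_sphere_zero_iff_norm.2 (ξ.norm_ofStereo w)
  have hle : ∀ w, ‖w‖ ≤ tan (r / 2) ↔ sphDist ξ.pt (ξ.ofStereo w) ≤ r := fun w => by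
    rw [sphDist_ofStereo, ← arctan_le_arctan_iff, arctan_tan (by linarith) (by linarith)]
    constructor <;> intro h <;> linarith
  have hU : ∀ w ∈ Metric.closedBall (0 : ℂ) (tan (r / 2)), ξ.ofStereo w ∈ U ∩ S2 := fun w hw =>
    ⟨hRU _ (hS w) (((hle w).1 (mem_closedBall_zero_iff.1 hw)).trans (min_le_left _ _)), hS w⟩
  have key := h.comp_chart (f := fun w => φ (ξ.ofStereo w)) hc (ρ := tan (r / 2))
    (fun t ht => (hle _).2 (by rw [hz]; exact le_min (hR t ht) (hL t ht)))
    (fun w hw => ?_) (fun w hw w' hw' hww => ?_)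
  · refine key.congr fun t _ => ?_
    rw [hz, ofStereo_zero]
  · obtain ⟨D, hD, hDI⟩ := hdiff _ (hU w hw)
    obtain ⟨E', hE, h0, hI⟩ := ξ.ofStereo_hasFDerivAt w
    have hcomp : HasFDerivAt (fun w => φ (ξ.ofStereo w)) (D.comp E') w := by
      rw [← hasFDerivWithinAt_univ] at hE ⊢
      exact HasFDerivWithinAt.comp w hD hE fun w _ => hS w
    rw [differentiableAt_complex_iff_differentiableAt_real]
    refine ⟨hcomp.differentiableAt, ?_⟩
    rw [hcomp.fderiv]
    change D (E' Complex.I) = Complex.I • D (E' 1)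
    rw [hI, hDI _ h0, smul_eq_mul]
  · have := hinj (hU w hw) (hU w' hw') hww
    rw [← ξ.stereo_ofStereo w, this, ξ.stereo_ofStereo]

theorem sphArm_hasAngularVelocity {l ω : Fin 3 → ℝ} (hl : ∀ j, 0 < l j)
    (h0 : l 0 < l 1 + l 2) (h1 : l 1 < l 2 + l 0) (h2 : l 2 < l 0 + l 1)
    (hs : l 0 + l 1 + l 2 < π) (hω : LinearIndependent ℚ ω) (ξ : SphUnitTangent)
    (θ : Fin 3 → ℝ) :
    SphHasAngularVelocity ξ.pt (fun t : ℝ => sphArm ξ l (fun j => θ j + ω j * t))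
      (ω 0 + (π - triangleAngles 1 (fun j => tan (l j / 2)) 0) / π * ω 1 +
        triangleAngles 1 (fun j => tan (l j / 2)) 2 / π * ω 2) := by
  have H := isTriangleData_tan (half_pos (hl 0)) (half_pos (hl 1)) (half_pos (hl 2))
    (by linarith) (by linarith) (by linarith) (by linarith)
  obtain ⟨hω2, hirr⟩ := irrational_div_of_linearIndependent hω
  have hden := tan_mul_norm_twoJoint_lt (half_pos (hl 0)) (half_pos (hl 1)) (half_pos (hl 2))
    (by linarith)
  exact SphHasAngularVelocity.of_stereo hs (fun t _ => sphDist_sphArm_le ξ hl hs _)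
    (fun t => ofStereo_armCoord ξ hl hs H _)
    (H.continuous_armCoord (a := fun j => tan (l j / 2)) hden θ ω).continuousOn
    (H.hasAngularVelocity (a := fun j => tan (l j / 2)) hden hω2 hirr)

/-! ### Spherical triangles -/

/-- The spherical law of cosines, for the angle that is expressed in half-length coordinates. -/
theorem sin_mul_sin_mul_cosAngle_tan {l m n : ℝ} (hl0 : 0 < l) (hl : l < π) (hm0 : 0 < m)
    (hm : m < π) (hn0 : 0 ≤ n) (hn : n < π) :
    sin l * sin m * cosAngle 1 (tan (l / 2)) (tan (m / 2)) (tan (n / 2)) =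
      cos n - cos l * cos m := by
  have cl := (cos_half_pos hl0.le hl).ne'
  have cm := (cos_half_pos hm0.le hm).ne'
  have cn := (cos_half_pos hn0 hn).ne'
  have tl := tan_pos_of_pos_of_lt_pi_div_two (half_pos hl0) (by linarith)
  have tm := tan_pos_of_pos_of_lt_pi_div_two (half_pos hm0) (by linarith)
  have e1 := cos_mul_one_add_tan_half_sq cl
  have e2 := cos_mul_one_add_tan_half_sq cm
  have e3 := cos_mul_one_add_tan_half_sq cn
  have e4 := sin_mul_one_add_tan_half_sq cl
  have e5 := sin_mul_one_add_tan_half_sq cm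
  generalize tan (l / 2) = a at *
  generalize tan (m / 2) = b at *
  generalize tan (n / 2) = t at *
  have p1 : 1 + a ^ 2 ≠ 0 := by positivity
  have p2 : 1 + b ^ 2 ≠ 0 := by positivity
  have p3 : 1 + t ^ 2 ≠ 0 := by positivity
  rw [eq_div_of_mul_eq p1 e1, eq_div_of_mul_eq p2 e2, eq_div_of_mul_eq p3 e3,
    eq_div_of_mul_eq p1 e4, eq_div_of_mul_eq p2 e5, cosAngle, one_mul]
  field_simp
  ring

theorem inner_flow_flow {ξ η : SphUnitTangent} (h : ξ.pt = η.pt) (l m : ℝ) :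
    inner ℝ (ξ.flow l).pt (η.flow m).pt =
      cos l * cos m + sin l * sin m * inner ℝ ξ.vec η.vec := by
  have h1 : inner ℝ ξ.pt η.vec = (0 : ℝ) := by rw [h, η.inner_eq]
  have h2 : inner ℝ ξ.vec η.pt = (0 : ℝ) := by rw [← h, ξ.inner_vec_pt]
  have h3 : inner ℝ ξ.pt η.pt = (1 : ℝ) := by rw [← h, ξ.inner_pt_pt]
  change inner ℝ (cos l • ξ.pt + sin l • ξ.vec) (cos m • η.pt + sin m • η.vec) = _
  simp only [inner_add_left, inner_add_right, inner_smul_left, inner_smul_right, h1, h2, h3,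
    conj_trivial]
  ring

theorem IsSphAngle.eq_arccos {A B C : E3} {α : ℝ} (h : IsSphAngle A B C α)
    (hB0 : 0 < sphDist A B) (hB : sphDist A B < π) (hC0 : 0 < sphDist A C) (hC : sphDist A C < π)
    (hBC : sphDist B C < π) :
    α = arccos (cosAngle 1 (tan (sphDist A B / 2)) (tan (sphDist A C / 2))
      (tan (sphDist B C / 2))) := by
  obtain ⟨ξ, η, hξ, hη, hξB, hηC, rfl⟩ := h
  rw [InnerProductGeometry.angle, ξ.norm_vec, η.norm_vec, mul_one, div_one]
  congr 1
  have h1 := inner_flow_flow (hξ.trans hη.symm) (sphDist A B) (sphDist A C)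
  have h2 := cos_sphDist (ξ.flow (sphDist A B)).norm_pt (η.flow (sphDist A C)).norm_pt
  rw [h1, hξB, hηC] at h2
  have h3 := sin_mul_sin_mul_cosAngle_tan hB0 hB hC0 hC
    (InnerProductGeometry.angle_nonneg B C) hBC
  refine mul_left_cancel₀ (mul_pos (sin_pos_of_pos_of_lt_pi hB0 hB)
    (sin_pos_of_pos_of_lt_pi hC0 hC)).ne' ?_
  refine Eq.trans ?_ h3.symm
  change _ = cos (sphDist B C) - _
  linear_combination -h2

theorem exists_flow_sphDist {A B : E3} (hA : ‖A‖ = 1) (hB : ‖B‖ = 1) (h0 : 0 < sphDist A B)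
    (h : sphDist A B < π) : ∃ ξ : SphUnitTangent, ξ.pt = A ∧ (ξ.flow (sphDist A B)).pt = B := by
  have hs := (sin_pos_of_pos_of_lt_pi h0 h).ne'
  have hAA : inner ℝ A A = (1 : ℝ) := by rw [real_inner_self_eq_norm_sq, hA, one_pow]
  have hBB : inner ℝ B B = (1 : ℝ) := by rw [real_inner_self_eq_norm_sq, hB, one_pow]
  have hAB := (cos_sphDist hA hB).symm
  have hBA : inner ℝ B A = cos (sphDist A B) := by rw [real_inner_comm, hAB]
  have hsc := sin_sq_add_cos_sq (sphDist A B)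
  generalize sphDist A B = d at *
  have hn : ‖(sin d)⁻¹ • (B - cos d • A)‖ ^ 2 = 1 := by
    rw [← real_inner_self_eq_norm_sq]
    simp only [inner_sub_left, inner_sub_right, inner_smul_left, inner_smul_right, hAA, hBB, hAB,
      hBA, conj_trivial]
    field_simp
    linarith
  refine ⟨⟨A, (sin d)⁻¹ • (B - cos d • A), hA, ?_, ?_⟩, rfl, ?_⟩
  · nlinarith [norm_nonneg ((sin d)⁻¹ • (B - cos d • A))]
  · rw [inner_smul_right, inner_sub_right, inner_smul_right, hAA, hAB]
    ring
  · change cos d • A + sin d • (sin d)⁻¹ • (B - cos d • A) = B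
    rw [smul_inv_smul₀ hs]
    abel

theorem exists_isSphAngle {A B C : E3} (hA : ‖A‖ = 1) (hB : ‖B‖ = 1) (hC : ‖C‖ = 1)
    (hB0 : 0 < sphDist A B) (hBπ : sphDist A B < π) (hC0 : 0 < sphDist A C)
    (hCπ : sphDist A C < π) : ∃ α, IsSphAngle A B C α := by
  obtain ⟨ξ, hξ, hξB⟩ := exists_flow_sphDist hA hB hB0 hBπ
  obtain ⟨η, hη, hηC⟩ := exists_flow_sphDist hA hC hC0 hCπ
  exact ⟨_, ξ, η, hξ, hη, hξB, hηC, rfl⟩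

theorem IsSphTriangle.eq_triangleAngles {l α : Fin 3 → ℝ} (hl : ∀ j, 0 < l j)
    (hπ : ∀ j, l j < π) (h : IsSphTriangle l α) :
    α = triangleAngles 1 fun j => tan (l j / 2) := by
  obtain ⟨A, hA, B, hB, C, hC, h0, h1, h2, a0, a1, a2⟩ := h
  have h0' := sphDist_comm B C ▸ h0
  have h1' := sphDist_comm C A ▸ h1
  have h2' := sphDist_comm A B ▸ h2
  have e0 := a0.eq_arccos (by rw [h2]; exact hl 2) (by rw [h2]; exact hπ 2)
    (by rw [h1']; exact hl 1) (by rw [h1']; exact hπ 1) (by rw [h0]; exact hπ 0)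
  have e1 := a1.eq_arccos (by rw [h0]; exact hl 0) (by rw [h0]; exact hπ 0)
    (by rw [h2']; exact hl 2) (by rw [h2']; exact hπ 2) (by rw [h1]; exact hπ 1)
  have e2 := a2.eq_arccos (by rw [h1]; exact hl 1) (by rw [h1]; exact hπ 1)
    (by rw [h0']; exact hl 0) (by rw [h0']; exact hπ 0) (by rw [h2]; exact hπ 2)
  rw [h1', h0, h2, cosAngle_comm] at e0
  rw [h0, h1, h2', cosAngle_comm] at e1
  rw [h0', h1, h2, cosAngle_comm] at e2
  funext j
  fin_cases j
  · exact e0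
  · exact e1
  · exact e2

theorem exists_isSphTriangle {l : Fin 3 → ℝ} (hl : ∀ j, 0 < l j)
    (h0 : l 0 < l 1 + l 2) (h1 : l 1 < l 2 + l 0) (h2 : l 2 < l 0 + l 1)
    (hs : l 0 + l 1 + l 2 < π) : ∃ α, IsSphTriangle l α := by
  have p0 := hl 0
  have p1 := hl 1
  have p2 := hl 2
  have H := isTriangleData_tan (half_pos p0) (half_pos p1) (half_pos p2)
    (by linarith) (by linarith) (by linarith) (by linarith)
  set x := cosAngle 1 (tan (l 1 / 2)) (tan (l 2 / 2)) (tan (l 0 / 2)) with hx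
  have hcos : cos (arccos x) = x :=
    cos_arccos (abs_lt.1 H.abs_cosAngle_lt).1.le (abs_lt.1 H.abs_cosAngle_lt).2.le
  set ξ : SphUnitTangent := ⟨EuclideanSpace.single 0 1, EuclideanSpace.single 1 1, by simp,
    by simp, by simp [EuclideanSpace.inner_single_left]⟩
  set η := ξ.rotate (arccos x) with hη
  have hin : inner ℝ ξ.vec η.vec = x := by
    change inner ℝ ξ.vec (cos (arccos x) • ξ.vec + sin (arccos x) • cross ξ.pt ξ.vec) = x
    rw [inner_add_right, inner_smul_right, inner_smul_right, cross_inner_right, ξ.inner_vec_vec,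
      hcos]
    ring
  have nA := ξ.norm_pt
  have nB := (ξ.flow (l 2)).norm_pt
  have nC := (η.flow (l 1)).norm_pt
  have dAB : sphDist ξ.pt (ξ.flow (l 2)).pt = l 2 := sphDist_flow_pt ξ p2.le (by linarith)
  have dAC : sphDist ξ.pt (η.flow (l 1)).pt = l 1 := sphDist_flow_pt η p1.le (by linarith)
  have dBC : sphDist (ξ.flow (l 2)).pt (η.flow (l 1)).pt = l 0 := by
    refine injOn_cos ⟨InnerProductGeometry.angle_nonneg _ _,
      InnerProductGeometry.angle_le_pi _ _⟩ ⟨p0.le, by linarith⟩ ?_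
    change cos (sphDist _ _) = _
    rw [cos_sphDist nB nC, inner_flow_flow (show ξ.pt = η.pt from rfl), hin]
    have := sin_mul_sin_mul_cosAngle_tan p1 (by linarith) p2 (by linarith) p0.le
      (show l 0 < π by linarith)
    linear_combination this
  generalize (ξ.flow (l 2)).pt = B at *
  generalize (η.flow (l 1)).pt = C at *
  generalize ξ.pt = A at *
  have dBA := sphDist_comm A B ▸ dAB
  have dCA := sphDist_comm A C ▸ dAC
  have dCB := sphDist_comm B C ▸ dBC
  obtain ⟨α₀, hα₀⟩ := exists_isSphAngle nA nB nC (by rw [dAB]; exact p2) (by rw [dAB]; linarith)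
    (by rw [dAC]; exact p1) (by rw [dAC]; linarith)
  obtain ⟨α₁, hα₁⟩ := exists_isSphAngle nB nC nA (by rw [dBC]; exact p0) (by rw [dBC]; linarith)
    (by rw [dBA]; exact p2) (by rw [dBA]; linarith)
  obtain ⟨α₂, hα₂⟩ := exists_isSphAngle nC nA nB (by rw [dCA]; exact p1) (by rw [dCA]; linarith)
    (by rw [dCB]; exact p0) (by rw [dCB]; linarith)
  exact ⟨![α₀, α₁, α₂], A, mem_sphere_zero_iff_norm.2 nA, B, mem_sphere_zero_iff_norm.2 nB, C,
    mem_sphere_zero_iff_norm.2 nC, dBC, dCA, dAB, hα₀, hα₁, hα₂⟩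

end SwivelingArm

theorem theorem4p2 (l ω : Fin 3 → ℝ) (hl : ∀ j, 0 < l j)
    (h0 : l 0 < l 1 + l 2) (h1 : l 1 < l 2 + l 0) (h2 : l 2 < l 0 + l 1)
    (hω : LinearIndependent ℚ ω) :
    (∃ α : Fin 3 → ℝ, SwivelingArm.IsHypTriangle l α ∧
      (∀ β : Fin 3 → ℝ, SwivelingArm.IsHypTriangle l β → β = α) ∧
      ∀ (ξ : SwivelingArm.HypUnitTangent) (θ : Fin 3 → ℝ),
        SwivelingArm.HypHasAngularVelocity ξ.pt
          (fun t : ℝ => SwivelingArm.hypArm ξ l (fun j => θ j + ω j * t))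
          (ω 0 + (Real.pi - α 0) / Real.pi * ω 1 + α 2 / Real.pi * ω 2)) ∧
    (l 0 + l 1 + l 2 < Real.pi →
      ∃ α : Fin 3 → ℝ, SwivelingArm.IsSphTriangle l α ∧
        (∀ β : Fin 3 → ℝ, SwivelingArm.IsSphTriangle l β → β = α) ∧
        ∀ (ξ : SwivelingArm.SphUnitTangent) (θ : Fin 3 → ℝ),
          SwivelingArm.SphHasAngularVelocity ξ.pt
            (fun t : ℝ => SwivelingArm.sphArm ξ l (fun j => θ j + ω j * t))
            (ω 0 + (Real.pi - α 0) / Real.pi * ω 1 + α 2 / Real.pi * ω 2)) := by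
  refine ⟨?_, fun hs => ?_⟩
  · obtain ⟨α, hα⟩ := SwivelingArm.exists_isHypTriangle hl h0 h1 h2
    obtain rfl := hα.eq_triangleAngles hl
    exact ⟨_, hα, fun β hβ => hβ.eq_triangleAngles hl, fun ξ θ =>
      SwivelingArm.hypArm_hasAngularVelocity hl h0 h1 h2 hω ξ θ⟩
  · have p0 := hl 0
    have p1 := hl 1
    have p2 := hl 2
    have hπ : ∀ j, l j < Real.pi := by
      intro j
      fin_cases j <;> dsimp <;> linarith
    obtain ⟨α, hα⟩ := SwivelingArm.exists_isSphTriangle hl h0 h1 h2 hs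
    obtain rfl := hα.eq_triangleAngles hl hπ
    exact ⟨_, hα, fun β hβ => hβ.eq_triangleAngles hl hπ, fun ξ θ =>
      SwivelingArm.sphArm_hasAngularVelocity hl h0 h1 h2 hs hω ξ θ⟩
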